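/- Let $n\ge 3$. For a vector field $g:\mathbb R^n\to\mathbb R^n$ put $|g|_\infty=\sup_x|g(x)|$ with $|\cdot|$ the Euclidean norm, and $|\mathcal D^j g|_\infty=\max_{|\alpha|=j}|D^\alpha g|_\infty$, the maximum over all multi-indices $\alpha$ of order $j$. There is a constant $c_0>0$ and, for every $j=0,1,2,\dots$, a constant $K_j$, all depending only on $n$, such that the following holds. Let $f:\mathbb R^n\to\mathbb R^n$ be smooth, $2\pi$-periodic in each variable, with $\nabla\cdot f=0$, and let $(u,p)$ be a solution of the Navier–Stokes Cauchy problem $$u_t+u\cdot\nabla u+\nabla p=\Delta u,\qquad \nabla\cdot u=0,\qquad u(\cdot,0)=f,$$ with velocity $u$ and pressure $p$ smooth on $\mathbb R^n\times[0,T_f)$ and $2\pi$-periodic in each space variable, whose interval of existence $[0,T_f)$, $0<T_f\le\infty$, is maximal (there is no such solution on a longer interval whose velocity extends $u$). Then $T_f>c_0/|f|_\infty^2$, and $$t^{j/2}\,|\mathcal D^j u(\cdot,t)|_\infty\le K_j|f|_\infty\qquad\text{for } 0<t\le \frac{c_0}{|f|_\infty^2}\text{ and all } j=0,1,2,\dots$$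 (If $f=0$, then $c_0/|f|_\infty^2$ is read as $\infty$: $T_f=\infty$ and the bound holds for all $t>0$.) -/

import Mathlib

open scoped ContDiff

noncomputable section

namespace NavierStokes

/-- `ℝⁿ` with the Euclidean norm. -/
abbrev Rn (n : ℕ) : Type := EuclideanSpace ℝ (Fin n)

/-- The `i`-th standard basis vector of `ℝⁿ`. -/
def stdVec {n : ℕ} (i : Fin n) : Rn n := EuclideanSpace.single i (1 : ℝ)

/-- `2π`-periodicity in each of the `n` space variables. -/
def IsPeriodic {n : ℕ} {F : Type*} (g : Rn n → F) : Prop :=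
  ∀ (i : Fin n) (x : Rn n), g (x + (2 * Real.pi) • stdVec i) = g x

/-- The partial derivative `D_i = ∂/∂x_i` of a vector field. -/
def partialD {n : ℕ} (i : Fin n) (g : Rn n → Rn n) : Rn n → Rn n :=
  fun x => fderiv ℝ g x (stdVec i)

/-- `D^α = D_1^{α_1} ⋯ D_n^{α_n}` for a multi-index `α`. -/
def multiD {n : ℕ} (α : Fin n → ℕ) (g : Rn n → Rn n) : Rn n → Rn n :=
  (List.finRange n).foldr (fun i h => (partialD i)^[α i] h) g

/-- The divergence `∇ · g = ∑ i, D_i g_i`. -/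
def divergence {n : ℕ} (g : Rn n → Rn n) (x : Rn n) : ℝ :=
  ∑ i : Fin n, partialD i g x i

/-- The maximum norm `|g|_∞ = sup_x |g(x)|`, with `|·|` the Euclidean norm. It is applied only to
continuous periodic fields, for which the supremum is finite. -/
def supNorm {n : ℕ} (g : Rn n → Rn n) : ℝ := ⨆ x : Rn n, ‖g x‖

/-- `|𝒟^j g|_∞ = max_{|α| = j} |D^α g|_∞`, a maximum over finitely many multi-indices. -/
def derivNorm {n : ℕ} (j : ℕ) (g : Rn n → Rn n) : ℝ :=
  ⨆ α : {α : Fin n → ℕ // ∑ i, α i = j}, supNorm (multiD α.1 g)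

/-- The time interval `0 ≤ t < T`, where `T = ⊤` is allowed. -/
def timeInterval (T : EReal) : Set ℝ := {t : ℝ | 0 ≤ t ∧ (t : EReal) < T}

/-- `(u, p)` is a smooth `2π`-periodic solution on `ℝⁿ × [0, T)` of
`u_t + (u · ∇) u + ∇ p = Δ u`, `∇ · u = 0`, `u(0) = f`.
Here `u t` is the velocity field and `p t` the pressure at time `t`; values at times outside
`[0, T)` play no role. -/
structure IsSolution {n : ℕ} (f : Rn n → Rn n) (T : EReal)
    (u : ℝ → Rn n → Rn n) (p : ℝ → Rn n → ℝ) : Prop where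
  pos : 0 < T
  smooth_velocity :
    ContDiffOn ℝ ∞ (fun q : ℝ × Rn n => u q.1 q.2) (timeInterval T ×ˢ Set.univ)
  smooth_pressure :
    ContDiffOn ℝ ∞ (fun q : ℝ × Rn n => p q.1 q.2) (timeInterval T ×ˢ Set.univ)
  periodic_velocity : ∀ t ∈ timeInterval T, IsPeriodic (u t)
  periodic_pressure : ∀ t ∈ timeInterval T, IsPeriodic (p t)
  momentum : ∀ t : ℝ, 0 < t → (t : EReal) < T → ∀ x : Rn n,
    deriv (fun s => u s x) t + fderiv ℝ (u t) x (u t x) + gradient (p t) x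
      = Laplacian.laplacian (u t) x
  incompressible : ∀ t ∈ timeInterval T, ∀ x : Rn n, divergence (u t) x = 0
  initial : u 0 = f

/-- `(u, p)` is a smooth periodic solution whose interval of existence `[0, T)` is maximal: `u` is
not the restriction of a smooth periodic solution on a longer interval `[0, T')`. -/
structure IsMaximalSolution {n : ℕ} (f : Rn n → Rn n) (T : EReal)
    (u : ℝ → Rn n → Rn n) (p : ℝ → Rn n → ℝ) : Prop where
  isSolution : IsSolution f T u p
  maximal : ∀ (T' : EReal) (u' : ℝ → Rn n → Rn n) (p' : ℝ → Rn n → ℝ),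
    T < T' → IsSolution f T' u' p' → ¬ ∀ t ∈ timeInterval T, u' t = u t

end NavierStokes

end

/-!
The velocity is bounded on a short time interval by a continuity argument, a bounded solution has
derivatives of all orders bounded with the parabolic scaling, and a bounded solution cannot stop
existing at a finite time. The constants in the first two steps depend only on the dimension.

*The basic estimate.* Write the system in conservative form,
`∂_t U_i = Δ U_i - ∑ k, D_k (U_k U_i) - D_i Q`. Duhamel's principle compares `U_i` with its heat
evolution, and the error involves the right-hand side smoothed by a Gaussian of width `α`. Each
space derivative on a smoothed function costs a factor `1/α`. For the quadratic terms this gives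
`C G / α` with `G` a bound of the products. The pressure gradient obeys the same bound
(`SmoothPer.abs_gop_pressure_le`): the derivative of its average with respect to `α` is an average
of `α Δ D_i Q`, a third derivative of the products by the pressure equation, hence of size `G / α²`,
and the average tends to zero as `α → ∞`. No singular integral and no solution operator for the
Poisson equation is needed. Since `1 / √(t - s)` is integrable, the error over a time step of
length `h` is at most `C G √h` (`IsNS.abs_sub_gop_le`).

*Bounds.* Applied to `U` itself, the estimate shows that the maximum norm at most doubles as long as
`t F²` is small, where `F` bounds the initial velocity (`exists_bootstrap_const`). Applied to
`∂_t^m D^I U` over the step `ε (t - c) / (m + 1)`, it gives by induction a bound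
`A_j M B^m m! (m + 1)^j (t - c)^(-m - j/2)` for the derivatives of order `m` in time and `j` in
space, where the rate `B` does not depend on `j` (`exists_deriv_estimate`). The highest derivatives
also occur in the quadratic terms, but with a small factor, so that they can be absorbed; the
weights `m! / (m + 1)²` keep the Leibniz rule from accumulating constants.

*Continuation.* The factor `B^m m!` makes a bounded solution analytic in time up to the end of its
interval of existence, with a uniform radius of convergence, together with all its space
derivatives. So its Taylor series in time about a time shortly before the end converges beyond the
end, may be differentiated term by term, and satisfies the same equations
(`IsNS.extend`, `exists_continuation`). No local existence theorem is needed.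
-/

open scoped ContDiff

/-! ### Smooth periodic functions on a strip -/

noncomputable section

namespace NavierStokes

open Set

variable {n : ℕ} {a b : ℝ}

/-- The space-time strip `(a, b) × ℝⁿ`. -/
def strip (n : ℕ) (a b : ℝ) : Set (ℝ × Rn n) := Ioo a b ×ˢ univ

theorem isOpen_strip : IsOpen (strip n a b) := isOpen_Ioo.prod isOpen_univ

@[simp] theorem mem_strip {t : ℝ} {x : Rn n} : (t, x) ∈ strip n a b ↔ t ∈ Ioo a b := by
  simp [strip]

/-- The algebra of scalar functions that are smooth and `2π`-periodic in space on the strip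
`(a, b) × ℝⁿ`. The value off the strip is fixed to be zero, so that elements are equal as soon
as they agree on the strip. -/
def smoothPer (n : ℕ) (a b : ℝ) : NonUnitalSubalgebra ℝ (ℝ × Rn n → ℝ) where
  carrier := {F | ContDiffOn ℝ ∞ F (strip n a b) ∧ (∀ t ∈ Ioo a b, IsPeriodic fun x => F (t, x)) ∧
    ∀ q ∉ strip n a b, F q = 0}
  add_mem' := by
    rintro F G ⟨h1, h2, h3⟩ ⟨k1, k2, k3⟩
    refine ⟨h1.add k1, fun t ht i x => ?_, fun q hq => ?_⟩
    · have := h2 t ht i x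
      have := k2 t ht i x
      simp_all
    · simp [h3 q hq, k3 q hq]
  zero_mem' := ⟨contDiffOn_const, fun t _ i x => rfl, fun q _ => rfl⟩
  mul_mem' := by
    rintro F G ⟨h1, h2, h3⟩ ⟨k1, k2, k3⟩
    refine ⟨h1.mul k1, fun t ht i x => ?_, fun q hq => ?_⟩
    · have := h2 t ht i x
      have := k2 t ht i x
      simp_all
    · simp [h3 q hq, k3 q hq]
  smul_mem' := by
    rintro c F ⟨h1, h2, h3⟩
    refine ⟨h1.const_smul c, fun t ht i x => ?_, fun q hq => ?_⟩
    · have := h2 t ht i x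
      simp_all
    · simp [h3 q hq]

/-- The elements of `smoothPer n a b`, as a type. -/
abbrev SmoothPer (n : ℕ) (a b : ℝ) : Type := ↥(smoothPer n a b)

namespace SmoothPer

instance : CoeFun (SmoothPer n a b) fun _ => ℝ × Rn n → ℝ := ⟨fun F => F.1⟩

theorem contDiffOn (F : SmoothPer n a b) : ContDiffOn ℝ ∞ F (strip n a b) := F.2.1

theorem periodic (F : SmoothPer n a b) {t : ℝ} (ht : t ∈ Ioo a b) :
    IsPeriodic fun x => F (t, x) := F.2.2.1 t ht

theorem eq_zero (F : SmoothPer n a b) {q : ℝ × Rn n} (hq : q ∉ strip n a b) : F q = 0 :=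
  F.2.2.2 q hq

theorem ext {F G : SmoothPer n a b} (h : ∀ q ∈ strip n a b, F q = G q) : F = G := by
  apply Subtype.ext
  funext q
  by_cases hq : q ∈ strip n a b
  · exact h q hq
  · rw [F.eq_zero hq, G.eq_zero hq]

@[simp] theorem coe_add (F G : SmoothPer n a b) (q : ℝ × Rn n) : (F + G) q = F q + G q := rfl
@[simp] theorem coe_sub (F G : SmoothPer n a b) (q : ℝ × Rn n) : (F - G) q = F q - G q := rfl
@[simp] theorem coe_neg (F : SmoothPer n a b) (q : ℝ × Rn n) : (-F) q = - F q := rfl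
@[simp] theorem coe_mul (F G : SmoothPer n a b) (q : ℝ × Rn n) : (F * G) q = F q * G q := rfl
@[simp] theorem coe_smul (c : ℝ) (F : SmoothPer n a b) (q : ℝ × Rn n) : (c • F) q = c * F q := rfl
@[simp] theorem coe_zero (q : ℝ × Rn n) : (0 : SmoothPer n a b) q = 0 := rfl

@[simp] theorem coe_sum {ι : Type*} (s : Finset ι) (F : ι → SmoothPer n a b) (q : ℝ × Rn n) :
    (∑ i ∈ s, F i) q = ∑ i ∈ s, F i q := by
  have := AddSubmonoidClass.coe_finsetSum (S := smoothPer n a b) F s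
  rw [this, Finset.sum_apply]

theorem contDiffAt (F : SmoothPer n a b) {q : ℝ × Rn n} (hq : q ∈ strip n a b) :
    ContDiffAt ℝ ∞ F q := F.contDiffOn.contDiffAt (isOpen_strip.mem_nhds hq)

theorem differentiableAt (F : SmoothPer n a b) {q : ℝ × Rn n} (hq : q ∈ strip n a b) :
    DifferentiableAt ℝ F q := (F.contDiffAt hq).differentiableAt (by simp)

theorem continuousAt (F : SmoothPer n a b) {q : ℝ × Rn n} (hq : q ∈ strip n a b) :
    ContinuousAt F q := (F.contDiffAt hq).continuousAt

theorem fderiv_mem (F : SmoothPer n a b) (v : ℝ × Rn n) :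
    (strip n a b).indicator (fun q => fderiv ℝ F q v) ∈ smoothPer n a b := by
  refine ⟨?_, fun t ht i x => ?_, fun q hq => indicator_of_notMem hq _⟩
  · refine ContDiffOn.congr (f := fun q => fderiv ℝ F q v) ?_
      fun q hq => indicator_of_mem hq _
    exact (F.contDiffOn.fderiv_of_isOpen (m := ∞) isOpen_strip le_rfl).clm_apply contDiffOn_const
  · have hs : ∀ y : Rn n, (t, y) ∈ strip n a b := fun y => by simpa using ht
    simp only [indicator_of_mem (hs _)]
    have : F.1 =ᶠ[nhds (t, x)] fun q => F.1 (q + (0, (2 * Real.pi) • stdVec i)) := by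
      filter_upwards [isOpen_strip.mem_nhds (hs x)] with q hq
      have := F.periodic (t := q.1) (by simpa [strip] using hq) i q.2
      simp only at this
      rw [← this]
      exact congrArg F.1 (Prod.ext (by simp) (by simp))
    rw [this.fderiv_eq, fderiv_comp_add_right]
    simp

/-- The derivative in the space-time direction `v`, as a linear operator on `SmoothPer n a b`. -/
def der (v : ℝ × Rn n) : Module.End ℝ (SmoothPer n a b) where
  toFun F := ⟨_, F.fderiv_mem v⟩
  map_add' F G := by
    apply ext
    intro q hq
    simp only [indicator_of_mem hq, coe_add]
    change fderiv ℝ (F.1 + G.1) q v = _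
    rw [fderiv_add (F.differentiableAt hq) (G.differentiableAt hq)]
    rfl
  map_smul' c F := by
    apply ext
    intro q hq
    simp only [indicator_of_mem hq, coe_smul, RingHom.id_apply]
    change fderiv ℝ (c • F.1) q v = _
    rw [fderiv_const_smul (F.differentiableAt hq)]
    rfl

theorem der_apply (v : ℝ × Rn n) (F : SmoothPer n a b) {q : ℝ × Rn n} (hq : q ∈ strip n a b) :
    der v F q = fderiv ℝ F q v :=
  indicator_of_mem (f := fun q => fderiv ℝ F q v) hq

theorem der_mul (v : ℝ × Rn n) (F G : SmoothPer n a b) :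
    der v (F * G) = der v F * G + F * der v G := by
  apply ext
  intro q hq
  rw [der_apply v _ hq]
  change fderiv ℝ (F.1 * G.1) q v = _
  rw [fderiv_mul (F.differentiableAt hq) (G.differentiableAt hq)]
  simp [der_apply v _ hq]
  ring

theorem der_comm (v w : ℝ × Rn n) : Commute (der v : Module.End ℝ (SmoothPer n a b)) (der w) := by
  apply LinearMap.ext
  intro F
  apply ext
  intro q hq
  have key : ∀ v w : ℝ × Rn n, der v (der w F) q = fderiv ℝ (fderiv ℝ F) q v w := by
    intro v w
    rw [der_apply v _ hq]
    have h1 : (der w F).1 =ᶠ[nhds q] fun q => fderiv ℝ F q w := by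
      filter_upwards [isOpen_strip.mem_nhds hq] with q hq
      exact der_apply w F hq
    have h2 : DifferentiableAt ℝ (fderiv ℝ F) q :=
      ((F.contDiffAt hq).fderiv_right (m := 1) (by norm_cast)).differentiableAt (by simp)
    rw [h1.fderiv_eq, fderiv_clm_apply h2 (differentiableAt_const w)]
    simp
  change der v (der w F) q = der w (der v F) q
  rw [key, key]
  exact ((F.contDiffAt hq).isSymmSndFDerivAt (by simp; norm_cast)).eq v w

/-- The time derivative `∂_t`. -/
def dt : Module.End ℝ (SmoothPer n a b) := der (1, 0)

/-- The space derivative `D_i`. -/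
def dx (i : Fin n) : Module.End ℝ (SmoothPer n a b) := der (0, stdVec i)

/-- The iterated space derivative `D_{i₁} ⋯ D_{i_j}` for a list of indices `i₁, …, i_j`. -/
def dxs (I : List (Fin n)) : Module.End ℝ (SmoothPer n a b) := (I.map dx).prod

/-- The mixed derivative `∂_t^m D_{i₁} ⋯ D_{i_j}`. -/
def dtx (m : ℕ) (I : List (Fin n)) : Module.End ℝ (SmoothPer n a b) := dt ^ m * dxs I

/-- The spatial Laplacian `∑ i, D_i D_i`. -/
def lap : Module.End ℝ (SmoothPer n a b) := ∑ i, dx i * dx i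

theorem lap_apply (F : SmoothPer n a b) : lap F = ∑ i, dx i (dx i F) := by
  simp [lap, LinearMap.sum_apply]

@[simp] theorem dxs_nil : (dxs [] : Module.End ℝ (SmoothPer n a b)) = 1 := rfl

@[simp] theorem dxs_cons (i : Fin n) (I : List (Fin n)) :
    (dxs (i :: I) : Module.End ℝ (SmoothPer n a b)) = dx i * dxs I := by simp [dxs]

theorem dx_comm (i j : Fin n) : Commute (dx i : Module.End ℝ (SmoothPer n a b)) (dx j) :=
  der_comm _ _

theorem dt_comm (i : Fin n) : Commute (dt : Module.End ℝ (SmoothPer n a b)) (dx i) :=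
  der_comm _ _

theorem dxs_comm_dx (I : List (Fin n)) (i : Fin n) :
    Commute (dxs I : Module.End ℝ (SmoothPer n a b)) (dx i) := by
  induction I with
  | nil => simp
  | cons j I ih => rw [dxs_cons]; exact (dx_comm j i).mul_left ih

theorem dxs_comm_dt (I : List (Fin n)) :
    Commute (dxs I : Module.End ℝ (SmoothPer n a b)) dt := by
  induction I with
  | nil => simp
  | cons j I ih => rw [dxs_cons]; exact (dt_comm j).symm.mul_left ih

theorem dtx_comm_dx (m : ℕ) (I : List (Fin n)) (i : Fin n) :
    Commute (dtx m I : Module.End ℝ (SmoothPer n a b)) (dx i) :=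
  ((dt_comm i).pow_left m).mul_left (dxs_comm_dx I i)

theorem dtx_comm_dt (m : ℕ) (I : List (Fin n)) :
    Commute (dtx m I : Module.End ℝ (SmoothPer n a b)) dt :=
  ((Commute.refl dt).pow_left m).mul_left (dxs_comm_dt I)

theorem dtx_comm_lap (m : ℕ) (I : List (Fin n)) :
    Commute (dtx m I : Module.End ℝ (SmoothPer n a b)) lap :=
  Commute.sum_right _ _ _ fun i _ => (dtx_comm_dx m I i).mul_right (dtx_comm_dx m I i)

theorem lap_comm_dx (i : Fin n) : Commute (lap : Module.End ℝ (SmoothPer n a b)) (dx i) :=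
  Commute.sum_left _ _ _ fun j _ => (dx_comm j i).mul_left (dx_comm j i)

theorem dtx_dx (m : ℕ) (I : List (Fin n)) (i : Fin n) (F : SmoothPer n a b) :
    dtx m I (dx i F) = dx i (dtx m I F) := LinearMap.congr_fun (dtx_comm_dx m I i) F

theorem dtx_dt (m : ℕ) (I : List (Fin n)) (F : SmoothPer n a b) :
    dtx m I (dt F) = dt (dtx m I F) := LinearMap.congr_fun (dtx_comm_dt m I) F

theorem dtx_lap (m : ℕ) (I : List (Fin n)) (F : SmoothPer n a b) :
    dtx m I (lap F) = lap (dtx m I F) := LinearMap.congr_fun (dtx_comm_lap m I) F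

theorem dtx_cons (m : ℕ) (i : Fin n) (I : List (Fin n)) (F : SmoothPer n a b) :
    dtx m (i :: I) F = dx i (dtx m I F) := by
  rw [← dtx_dx, dtx, dxs_cons, ← (dxs_comm_dx I i).eq]; rfl

theorem dtx_cons' (m : ℕ) (i : Fin n) (I : List (Fin n)) (F : SmoothPer n a b) :
    dtx m (i :: I) F = dtx m I (dx i F) := by
  rw [dtx_cons, dtx_dx]

theorem dtx_succ (m : ℕ) (I : List (Fin n)) (F : SmoothPer n a b) :
    dtx (m + 1) I F = dt (dtx m I F) := by
  rw [dtx, pow_succ']; rfl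

theorem dtx_succ' (m : ℕ) (I : List (Fin n)) (F : SmoothPer n a b) :
    dtx (m + 1) I F = dtx m I (dt F) := by
  rw [dtx_succ, dtx_dt]

@[simp] theorem dtx_zero_nil (F : SmoothPer n a b) : dtx 0 [] F = F := by
  simp [dtx]

theorem hasDerivAt_time (F : SmoothPer n a b) {t : ℝ} (ht : t ∈ Ioo a b) (x : Rn n) :
    HasDerivAt (fun s => F (s, x)) (dt F (t, x)) t := by
  have hq : (t, x) ∈ strip n a b := by simpa using ht
  have h1 := (F.differentiableAt hq).hasFDerivAt
  have h2 : HasDerivAt (fun s : ℝ => (s, x)) ((1 : ℝ), (0 : Rn n)) t :=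
    (hasDerivAt_id t).prodMk (hasDerivAt_const t x)
  rw [dt, der_apply _ _ hq]
  exact h1.comp_hasDerivAt t h2

theorem _root_.NavierStokes.norm_le_of_forall_abs_le {v : Rn n} {C : ℝ} (h : ∀ i, |v i| ≤ C) :
    ‖v‖ ≤ n * C := by
  have e : ∑ j, EuclideanSpace.single j (v j) = v := by
    ext i
    simp
  have h1 := norm_sum_le Finset.univ fun j => EuclideanSpace.single j (v j)
  rw [e] at h1
  refine h1.trans ((Finset.sum_le_card_nsmul _ _ C fun j _ => ?_).trans ?_)
  · simpa using h j
  · simp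

/-- Every point is congruent modulo the periods to a point of a fixed ball, which makes estimates
for periodic functions uniform in space by compactness. -/
theorem _root_.NavierStokes.exists_bounded_representative (x : Rn n) :
    ∃ y : Rn n, ‖y‖ ≤ n * (2 * Real.pi) ∧
      ∀ g : Rn n → ℝ, IsPeriodic g → g y = g x := by
  -- translation by an integer multiple of the period
  have hZ : ∀ (i : Fin n) (k : ℤ) (g : Rn n → ℝ), IsPeriodic g → ∀ x,
      g (x + (k * (2 * Real.pi)) • stdVec i) = g x := by
    intro i k g hg x
    have hp : Function.Periodic (fun s : ℝ => g (x + s • stdVec i)) (2 * Real.pi) := by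
      intro s
      simp only [add_smul, ← add_assoc]
      exact hg i _
    simpa using hp.int_mul k 0
  let k : Fin n → ℤ := fun i => -⌊x i / (2 * Real.pi)⌋
  -- the coordinates with index in `s` have been reduced to `[0, 2π)`
  let z : Finset (Fin n) → Rn n := fun s => x + ∑ i ∈ s, ((k i : ℝ) * (2 * Real.pi)) • stdVec i
  have hz : ∀ s (g : Rn n → ℝ), IsPeriodic g → g (z s) = g x := by
    intro s g hg
    induction s using Finset.induction_on with
    | empty => simp [z]
    | insert i s hi ih =>
      rw [← ih, ← hZ i (k i) g hg (z s)]
      simp only [z, Finset.sum_insert hi]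
      congr 1
      abel
  refine ⟨z Finset.univ, ?_, hz _⟩
  have hco : ∀ j, ‖(z Finset.univ) j‖ ≤ 2 * Real.pi := by
    intro j
    have h0 : 0 < 2 * Real.pi := by positivity
    have : (z Finset.univ) j = x j + k j * (2 * Real.pi) := by
      simp [z, stdVec, Pi.single_apply]
    rw [this]
    have h1 := Int.floor_le (x j / (2 * Real.pi))
    have h2 := Int.lt_floor_add_one (x j / (2 * Real.pi))
    rw [le_div_iff₀ h0] at h1
    rw [div_lt_iff₀ h0] at h2
    simp only [k, Int.cast_neg, Real.norm_eq_abs]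
    rw [abs_le]
    constructor <;> nlinarith
  exact norm_le_of_forall_abs_le hco

theorem exists_bound (F : SmoothPer n a b) {c d : ℝ} (hc : a < c) (hd : d < b) :
    ∃ C, 0 ≤ C ∧ ∀ t ∈ Icc c d, ∀ x, |F (t, x)| ≤ C := by
  have hK : IsCompact (Icc c d ×ˢ Metric.closedBall (0 : Rn n) (n * (2 * Real.pi))) :=
    isCompact_Icc.prod (isCompact_closedBall _ _)
  have hcont : ContinuousOn F.1 (Icc c d ×ˢ Metric.closedBall (0 : Rn n) (n * (2 * Real.pi))) :=
    F.contDiffOn.continuousOn.mono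
      (prod_mono (fun t ht => ⟨hc.trans_le ht.1, ht.2.trans_lt hd⟩) (subset_univ _))
  obtain ⟨C, hC⟩ := hK.exists_bound_of_continuousOn hcont
  refine ⟨max C 0, le_max_right _ _, fun t ht x => le_max_of_le_left ?_⟩
  obtain ⟨y, hy, hyx⟩ := exists_bounded_representative x
  rw [← hyx _ (F.periodic ⟨hc.trans_le ht.1, ht.2.trans_lt hd⟩)]
  exact hC (t, y) ⟨ht, by simpa using hy⟩

theorem exists_bound_at (F : SmoothPer n a b) {t : ℝ} (ht : t ∈ Ioo a b) :
    ∃ C, 0 ≤ C ∧ ∀ x, |F (t, x)| ≤ C := by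
  obtain ⟨C, h0, hC⟩ := F.exists_bound ht.1 ht.2
  exact ⟨C, h0, hC t ⟨le_rfl, le_rfl⟩⟩

/-- Multiplication of a scalar function of space-time by the indicator of the strip. -/
def mk (F : ℝ × Rn n → ℝ) (h1 : ContDiffOn ℝ ∞ F (strip n a b))
    (h2 : ∀ t ∈ Ioo a b, IsPeriodic fun x => F (t, x)) : SmoothPer n a b :=
  ⟨(strip n a b).indicator F, h1.congr fun q hq => indicator_of_mem hq _, fun t ht i x => by
    have hs : ∀ y : Rn n, (t, y) ∈ strip n a b := fun y => by simpa using ht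
    simp only [indicator_of_mem (hs _)]
    exact h2 t ht i x, fun q hq => indicator_of_notMem hq _⟩

theorem mk_apply {F : ℝ × Rn n → ℝ} {h1 : ContDiffOn ℝ ∞ F (strip n a b)}
    {h2 : ∀ t ∈ Ioo a b, IsPeriodic fun x => F (t, x)} {q : ℝ × Rn n} (hq : q ∈ strip n a b) :
    mk F h1 h2 q = F q := indicator_of_mem hq _

end SmoothPer

end NavierStokes

end

/-! ### Gaussian averages -/

noncomputable section

namespace NavierStokes

open Set MeasureTheory Filter Topology

variable {n : ℕ} {a b : ℝ}

/-- The Gaussian weight `P(z) exp(-|z|²/2)` with a polynomial factor `P`. -/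
def wt (P : MvPolynomial (Fin n) ℝ) (z : Rn n) : ℝ :=
  MvPolynomial.eval (fun i => z i) P * Real.exp (-‖z‖ ^ 2 / 2)

/-- The polynomial factor of the derivative of `wt P` in the direction of the `i`-th coordinate. -/
def wtDeriv (i : Fin n) (P : MvPolynomial (Fin n) ℝ) : MvPolynomial (Fin n) ℝ :=
  MvPolynomial.pderiv i P - MvPolynomial.X i * P

theorem continuous_wt (P : MvPolynomial (Fin n) ℝ) : Continuous (wt P) := by
  have h : Continuous fun z : Rn n => MvPolynomial.eval (fun i => z i) P :=
    (MvPolynomial.continuous_eval P).comp (by fun_prop)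
  unfold wt
  fun_prop

theorem exists_abs_eval_le (P : MvPolynomial (Fin n) ℝ) :
    ∃ (C : ℝ) (N : ℕ), 0 ≤ C ∧ ∀ z : Rn n,
      |MvPolynomial.eval (fun i => z i) P| ≤ C * Real.exp (N * ‖z‖) := by
  induction P using MvPolynomial.induction_on with
  | C r => exact ⟨|r|, 0, abs_nonneg r, fun z => by simp⟩
  | add P Q hP hQ =>
    obtain ⟨C, N, hC, h⟩ := hP
    obtain ⟨C', N', hC', h'⟩ := hQ
    refine ⟨C + C', N + N', by positivity, fun z => ?_⟩
    rw [map_add, add_mul]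
    have e1 : Real.exp (N * ‖z‖) ≤ Real.exp ((N + N' : ℕ) * ‖z‖) := by
      gcongr; simp
    have e2 : Real.exp (N' * ‖z‖) ≤ Real.exp ((N + N' : ℕ) * ‖z‖) := by
      gcongr; simp
    exact (abs_add_le _ _).trans (add_le_add ((h z).trans (by gcongr)) ((h' z).trans (by gcongr)))
  | mul_X P i hP =>
    obtain ⟨C, N, hC, h⟩ := hP
    refine ⟨C, N + 1, hC, fun z => ?_⟩
    rw [map_mul, MvPolynomial.eval_X, abs_mul]
    have h1 : |z i| ≤ Real.exp ‖z‖ :=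
      (PiLp.norm_apply_le z i).trans ((by linarith : ‖z‖ ≤ ‖z‖ + 1).trans (Real.add_one_le_exp _))
    calc |MvPolynomial.eval (fun i => z i) P| * |z i| ≤ C * Real.exp (N * ‖z‖) * Real.exp ‖z‖ :=
          mul_le_mul (h z) h1 (abs_nonneg _) (by positivity)
      _ = _ := by rw [mul_assoc, ← Real.exp_add]; congr 2; push_cast; ring

theorem integrable_exp_neg_norm_sq {c : ℝ} (hc : 0 < c) :
    Integrable fun z : Rn n => Real.exp (-c * ‖z‖ ^ 2) := by
  by_contra h
  have h1 := GaussianFourier.integral_rexp_neg_mul_sq_norm (V := Rn n) hc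
  rw [integral_undef h] at h1
  have : 0 < (Real.pi / c) ^ (Module.finrank ℝ (Rn n) / 2 : ℝ) := by positivity
  linarith

theorem integrable_wt (P : MvPolynomial (Fin n) ℝ) : Integrable (wt P) := by
  obtain ⟨C, N, hC, h⟩ := exists_abs_eval_le P
  refine ((integrable_exp_neg_norm_sq (n := n) (c := 1 / 4) (by norm_num)).const_mul
    (C * Real.exp (N ^ 2))).mono' (continuous_wt P).aestronglyMeasurable (.of_forall fun z => ?_)
  rw [wt, norm_mul, Real.norm_eq_abs, Real.norm_eq_abs, abs_of_pos (Real.exp_pos _)]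
  calc _ ≤ C * Real.exp (N * ‖z‖) * Real.exp (-‖z‖ ^ 2 / 2) := by gcongr; exact h z
    _ = C * Real.exp (N * ‖z‖ + -‖z‖ ^ 2 / 2) := by rw [mul_assoc, ← Real.exp_add]
    _ ≤ C * Real.exp (N ^ 2 + -(1 / 4) * ‖z‖ ^ 2) := by
        refine mul_le_mul_of_nonneg_left (Real.exp_le_exp.2 ?_) hC
        nlinarith [sq_nonneg ((N : ℝ) - ‖z‖ / 2)]
    _ = _ := by rw [Real.exp_add, mul_assoc]

/-- Differentiation of the Gaussian weight turns the polynomial factor `P` into `wtDeriv i P`. -/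
theorem hasLineDerivAt_wt (P : MvPolynomial (Fin n) ℝ) (i : Fin n) (z : Rn n) :
    HasLineDerivAt ℝ (wt P) (wt (wtDeriv i P) z) z (stdVec i) := by
  have hco : ∀ j, HasDerivAt (fun s : ℝ => (z + s • stdVec i : Rn n) j)
      ((Pi.single i 1 : Fin n → ℝ) j) 0 := by
    intro j
    have : (fun s : ℝ => (z + s • stdVec i : Rn n) j)
        = fun s => z j + s * (Pi.single i 1 : Fin n → ℝ) j := by
      funext s; simp [stdVec, Pi.single_apply]
    rw [this]
    simpa using ((hasDerivAt_id (0 : ℝ)).mul_const ((Pi.single i 1 : Fin n → ℝ) j)).const_add (z j)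
  have hP : HasDerivAt (fun s : ℝ => MvPolynomial.eval (fun j => (z + s • stdVec i : Rn n) j) P)
      (MvPolynomial.eval (fun j => z j) (MvPolynomial.pderiv i P)) 0 := by
    induction P using MvPolynomial.induction_on with
    | C r => simpa using hasDerivAt_const (0 : ℝ) r
    | add P Q hP hQ => simp only [map_add]; exact hP.add hQ
    | mul_X P j hP =>
      have := hP.mul (hco j)
      simp only [map_mul, MvPolynomial.eval_X, Derivation.leibniz, MvPolynomial.pderiv_X, map_add,
        smul_eq_mul]
      convert! this using 1
      by_cases hij : j = i
      · subst hij; simp; ring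
      · simp [hij]
        ring
  have hG : HasDerivAt (fun s : ℝ => Real.exp (-‖z + s • stdVec i‖ ^ 2 / 2))
      (Real.exp (-‖z‖ ^ 2 / 2) * -z i) 0 := by
    have e : (fun s : ℝ => Real.exp (-‖z + s • stdVec i‖ ^ 2 / 2))
        = fun s => Real.exp (-(‖z‖ ^ 2 + 2 * (s * z i) + s ^ 2) / 2) := by
      funext s
      rw [norm_add_sq_real, norm_smul, inner_smul_right]
      simp [stdVec, EuclideanSpace.inner_single_right]
    rw [e]
    have h1 : HasDerivAt (fun s : ℝ => -(‖z‖ ^ 2 + 2 * (s * z i) + s ^ 2) / 2) (-z i) 0 := by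
      have := ((((hasDerivAt_id (0 : ℝ)).mul_const (z i)).const_mul 2).const_add (‖z‖ ^ 2)).add
        ((hasDerivAt_id (0 : ℝ)).pow 2)
      convert! (this.neg.div_const 2) using 1
      simp
      ring
    simpa using h1.exp
  have := hP.mul hG
  unfold HasLineDerivAt
  convert! this using 1
  simp [wt, wtDeriv]
  ring

/-- The mass `∫ |P(z)| exp(-|z|²/2) dz`. -/
def mass (P : MvPolynomial (Fin n) ℝ) : ℝ := ∫ z, |wt P z|

theorem mass_nonneg (P : MvPolynomial (Fin n) ℝ) : 0 ≤ mass P :=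
  integral_nonneg fun _ => abs_nonneg _

/-- The constant polynomial that turns the Gaussian weight into a probability density. -/
def unitPoly (n : ℕ) : MvPolynomial (Fin n) ℝ :=
  MvPolynomial.C (∫ z : Rn n, Real.exp (-‖z‖ ^ 2 / 2))⁻¹

theorem wt_unitPoly_nonneg (z : Rn n) : 0 ≤ wt (unitPoly n) z := by
  simp only [wt, unitPoly, MvPolynomial.eval_C]
  exact mul_nonneg (inv_nonneg.2 (integral_nonneg fun _ => (Real.exp_pos _).le)) (Real.exp_pos _).le

theorem integral_wt_unitPoly : ∫ z : Rn n, wt (unitPoly n) z = 1 := by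
  simp only [wt, unitPoly, MvPolynomial.eval_C]
  rw [integral_const_mul]
  apply inv_mul_cancel₀
  have h1 := GaussianFourier.integral_rexp_neg_mul_sq_norm (V := Rn n) (b := 1 / 2) (by norm_num)
  have e : (fun z : Rn n => Real.exp (-‖z‖ ^ 2 / 2)) = fun z => Real.exp (-(1 / 2) * ‖z‖ ^ 2) := by
    funext z; ring_nf
  rw [e, h1]
  positivity

theorem mass_unitPoly : mass (unitPoly n) = 1 := by
  rw [mass, ← integral_wt_unitPoly (n := n)]
  simp_rw [abs_of_nonneg (wt_unitPoly_nonneg _)]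

/-- The Gaussian average `∫ P(z) exp(-|z|²/2) F(s, x + αz) dz`. For `P = unitPoly n` and
`α = √(2r)` this is the heat semigroup at time `r`, applied to `F(s, ·)`. -/
def gop (P : MvPolynomial (Fin n) ℝ) (α : ℝ) (F : SmoothPer n a b) (s : ℝ) (x : Rn n) : ℝ :=
  ∫ z, wt P z * F (s, x + α • z)

namespace SmoothPer

theorem continuous_slice (F : SmoothPer n a b) {s : ℝ} (hs : s ∈ Ioo a b) (x : Rn n) (α : ℝ) :
    Continuous fun z => F (s, x + α • z) := by
  rw [continuous_iff_continuousAt]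
  intro z
  exact (F.continuousAt (mem_strip.2 hs)).comp (f := fun z => (s, x + α • z)) (by fun_prop)

theorem integrable_wt_mul (P : MvPolynomial (Fin n) ℝ) (α : ℝ) (F : SmoothPer n a b) {s : ℝ}
    (hs : s ∈ Ioo a b) (x : Rn n) : Integrable fun z => wt P z * F (s, x + α • z) := by
  obtain ⟨C, -, hC⟩ := F.exists_bound_at hs
  exact (integrable_wt P).mul_bdd (c := C) (F.continuous_slice hs x α).aestronglyMeasurable
    (.of_forall fun z => hC _)

theorem abs_gop_le (P : MvPolynomial (Fin n) ℝ) (α : ℝ) (F : SmoothPer n a b) {s C : ℝ}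
    (hC : ∀ y, |F (s, y)| ≤ C) (x : Rn n) : |gop P α F s x| ≤ mass P * C := by
  rw [mass, ← integral_mul_const, gop, ← Real.norm_eq_abs]
  refine norm_integral_le_of_norm_le ((integrable_wt P).abs.mul_const C) (.of_forall fun z => ?_)
  rw [norm_mul]
  exact mul_le_mul_of_nonneg_left (hC _) (abs_nonneg _)

theorem gop_add (P : MvPolynomial (Fin n) ℝ) (α : ℝ) (F G : SmoothPer n a b) {s : ℝ}
    (hs : s ∈ Ioo a b) (x : Rn n) : gop P α (F + G) s x = gop P α F s x + gop P α G s x := by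
  simp only [gop, coe_add, mul_add]
  exact integral_add (F.integrable_wt_mul P α hs x) (G.integrable_wt_mul P α hs x)

theorem gop_neg (P : MvPolynomial (Fin n) ℝ) (α : ℝ) (F : SmoothPer n a b) (s : ℝ) (x : Rn n) :
    gop P α (-F) s x = -gop P α F s x := by
  simp [gop, integral_neg]

theorem gop_sub (P : MvPolynomial (Fin n) ℝ) (α : ℝ) (F G : SmoothPer n a b) {s : ℝ}
    (hs : s ∈ Ioo a b) (x : Rn n) : gop P α (F - G) s x = gop P α F s x - gop P α G s x := by
  rw [sub_eq_add_neg, gop_add P α F _ hs, gop_neg, sub_eq_add_neg]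

theorem gop_sum {ι : Type*} (S : Finset ι) (P : MvPolynomial (Fin n) ℝ) (α : ℝ)
    (F : ι → SmoothPer n a b) {s : ℝ} (hs : s ∈ Ioo a b) (x : Rn n) :
    gop P α (∑ i ∈ S, F i) s x = ∑ i ∈ S, gop P α (F i) s x := by
  simp only [gop, coe_sum, Finset.mul_sum]
  exact integral_finsetSum S fun i _ => (F i).integrable_wt_mul P α hs x

theorem hasFDerivAt_slice (F : SmoothPer n a b) {s : ℝ} (hs : s ∈ Ioo a b) (x : Rn n) :
    HasFDerivAt (fun y => F (s, y)) ((fderiv ℝ F (s, x)).comp (.inr ℝ ℝ (Rn n))) x :=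
  (F.differentiableAt (mem_strip.2 hs)).hasFDerivAt.comp x (hasFDerivAt_prodMk_right s x)

theorem fderiv_inr_eq_sum (F : SmoothPer n a b) {s : ℝ} (hs : s ∈ Ioo a b) (x z : Rn n) :
    fderiv ℝ F (s, x) (0, z) = ∑ k, z k * dx k F (s, x) := by
  have e : ((0 : ℝ), z) = ∑ k, z k • ((0 : ℝ), (stdVec k : Rn n)) := by
    refine Prod.ext (by simp [Prod.fst_sum]) ?_
    simp only [Prod.snd_sum, Prod.smul_snd]
    ext j
    simp [stdVec, Pi.single_apply]
  rw [e, map_sum]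
  refine Finset.sum_congr rfl fun k _ => ?_
  rw [map_smul, dx, der_apply _ _ (mem_strip.2 hs), smul_eq_mul]

/-- Integration by parts: a space derivative is moved onto the Gaussian weight, at the cost of a
factor `1/α`. -/
theorem gop_dx (P : MvPolynomial (Fin n) ℝ) {α : ℝ} (hα : α ≠ 0) (i : Fin n) (F : SmoothPer n a b)
    {s : ℝ} (hs : s ∈ Ioo a b) (x : Rn n) :
    gop P α (dx i F) s x = -(1 / α) * gop (wtDeriv i P) α F s x := by
  have h := integral_bilinear_hasLineDerivAt_right_eq_neg_left_of_integrable
    (μ := (volume : Measure (Rn n))) (f := wt P) (f' := wt (wtDeriv i P)) (v := stdVec i)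
    (g := fun z => F (s, x + α • z)) (g' := fun z => α * dx i F (s, x + α • z))
    (B := ContinuousLinearMap.mul ℝ ℝ)
    (F.integrable_wt_mul _ α hs x)
    (by
      have := ((dx i F).integrable_wt_mul P α hs x).const_mul α
      refine this.congr (.of_forall fun z => ?_)
      simp only [ContinuousLinearMap.mul_apply']
      ring)
    (F.integrable_wt_mul _ α hs x)
    (fun z _ => hasLineDerivAt_wt P i z)
    (fun z _ => by
      have h1 := F.hasFDerivAt_slice hs (x + α • z)
      have h2 : HasDerivAt (fun r : ℝ => x + α • (z + r • stdVec i)) (α • stdVec i) 0 := by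
        have := (((hasDerivAt_id (0 : ℝ)).smul_const (stdVec i : Rn n)).const_add z).const_smul α
        simpa using this.const_add x
      have h3 := HasFDerivAt.comp_hasDerivAt_of_eq (0 : ℝ) h1 h2 (by simp)
      unfold HasLineDerivAt
      convert! h3 using 1
      rw [dx, der_apply _ _ (mem_strip.2 hs)]
      simp)
  simp only [ContinuousLinearMap.mul_apply'] at h
  have e : ∫ z, wt P z * (α * dx i F (s, x + α • z)) = α * gop P α (dx i F) s x := by
    rw [gop, ← integral_const_mul]
    congr 1
    funext z
    ring
  rw [e] at h
  change _ = -gop (wtDeriv i P) α F s x at h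
  field_simp
  linarith

/-- Differentiation of a Gaussian average along a curve `r ↦ (σ r, α r)` of times and widths. -/
theorem hasDerivAt_gop (P : MvPolynomial (Fin n) ℝ) (F : SmoothPer n a b) (x : Rn n)
    {σ α σ' α' : ℝ → ℝ} {r₀ c d L : ℝ} (hc : a < c) (hd : d < b)
    (hσ : ∀ᶠ r in 𝓝 r₀, HasDerivAt σ (σ' r) r ∧ σ r ∈ Icc c d ∧ |σ' r| ≤ L)
    (hα : ∀ᶠ r in 𝓝 r₀, HasDerivAt α (α' r) r ∧ |α' r| ≤ L) :
    HasDerivAt (fun r => gop P (α r) F (σ r) x)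
      (σ' r₀ * gop P (α r₀) (dt F) (σ r₀) x +
        α' r₀ * ∑ k, gop (MvPolynomial.X k * P) (α r₀) (dx k F) (σ r₀) x) r₀ := by
  have hcd : ∀ s ∈ Icc c d, s ∈ Ioo a b := fun s hs => ⟨hc.trans_le hs.1, hs.2.trans_lt hd⟩
  obtain ⟨C, hC0, hC⟩ := (dt F).exists_bound hc hd
  choose C' hC0' hC' using fun k => (dx k F).exists_bound hc hd
  have hs₀ := hcd _ hσ.self_of_nhds.2.1
  have hL : 0 ≤ L := (abs_nonneg _).trans hα.self_of_nhds.2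
  have hder : ∀ r, HasDerivAt σ (σ' r) r → HasDerivAt α (α' r) r → σ r ∈ Icc c d → ∀ z,
      HasDerivAt (fun r => wt P z * F (σ r, x + α r • z))
        (σ' r * (wt P z * dt F (σ r, x + α r • z)) +
          α' r * ∑ k, wt (MvPolynomial.X k * P) z * dx k F (σ r, x + α r • z)) r := by
    intro r h1 h2 h3 z
    have hm : (σ r, x + α r • z) ∈ strip n a b := mem_strip.2 (hcd _ h3)
    have h4 : HasDerivAt (fun r => (σ r, x + α r • z)) (σ' r, α' r • z) r :=
      h1.prodMk ((h2.smul_const z).const_add x)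
    have h5 := ((F.differentiableAt hm).hasFDerivAt.comp_hasDerivAt r h4).const_mul (wt P z)
    convert! h5 using 1
    have e : (σ' r, α' r • z) = σ' r • ((1 : ℝ), (0 : Rn n)) + α' r • ((0 : ℝ), z) := by simp
    rw [e, map_add, map_smul, map_smul, F.fderiv_inr_eq_sum (hcd _ h3), dt, der_apply _ _ hm]
    simp only [smul_eq_mul, mul_add, Finset.mul_sum, wt, map_mul, MvPolynomial.eval_X]
    congr 1
    · ring
    · exact Finset.sum_congr rfl fun k _ => by ring
  have key := (hasDerivAt_integral_of_dominated_loc_of_deriv_le (μ := (volume : Measure (Rn n)))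
    (x₀ := r₀) (F := fun r z => wt P z * F (σ r, x + α r • z))
    (F' := fun r z => σ' r * (wt P z * dt F (σ r, x + α r • z)) +
          α' r * ∑ k, wt (MvPolynomial.X k * P) z * dx k F (σ r, x + α r • z))
    (bound := fun z => L * (|wt P z| * C) + L * ∑ k, |wt (MvPolynomial.X k * P) z| * C' k)
    (hσ.and hα) ?_ (F.integrable_wt_mul P _ hs₀ x) ?_
    (.of_forall fun z r hr => ?_) ?_ (.of_forall fun z r hr => hder r hr.1.1 hr.2.1 hr.1.2.1 z)).2
  · have e : ∫ z, (σ' r₀ * (wt P z * dt F (σ r₀, x + α r₀ • z)) +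
          α' r₀ * ∑ k, wt (MvPolynomial.X k * P) z * dx k F (σ r₀, x + α r₀ • z))
        = σ' r₀ * gop P (α r₀) (dt F) (σ r₀) x +
          α' r₀ * ∑ k, gop (MvPolynomial.X k * P) (α r₀) (dx k F) (σ r₀) x := by
      rw [integral_add, integral_const_mul, integral_const_mul, integral_finsetSum]
      · rfl
      · exact fun k _ => (dx k F).integrable_wt_mul _ _ hs₀ x
      · exact ((dt F).integrable_wt_mul _ _ hs₀ x).const_mul _
      · exact (integrable_finsetSum _ fun k _ => (dx k F).integrable_wt_mul _ _ hs₀ x).const_mul _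
    rw [e] at key
    exact key
  · filter_upwards [hσ] with r hr
    exact (F.integrable_wt_mul P _ (hcd _ hr.2.1) x).aestronglyMeasurable
  · exact ((((dt F).integrable_wt_mul _ _ hs₀ x).const_mul _).add
      ((integrable_finsetSum _ fun k _ =>
        (dx k F).integrable_wt_mul _ _ hs₀ x).const_mul _)).aestronglyMeasurable
  · refine (norm_add_le _ _).trans (add_le_add ?_ ?_)
    · rw [norm_mul, norm_mul]
      exact mul_le_mul hr.1.2.2 (mul_le_mul_of_nonneg_left (hC _ hr.1.2.1 _) (abs_nonneg _))
        (by positivity) hL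
    · rw [norm_mul]
      refine mul_le_mul hr.2.2 ((norm_sum_le _ _).trans (Finset.sum_le_sum fun k _ => ?_))
        (by positivity) hL
      rw [norm_mul]
      exact mul_le_mul_of_nonneg_left (hC' k _ hr.1.2.1 _) (abs_nonneg _)
  · exact (((integrable_wt P).abs.mul_const C).const_mul L).add
      ((integrable_finsetSum _ fun k _ =>
        (integrable_wt (MvPolynomial.X k * P)).abs.mul_const (C' k)).const_mul L)

/-- The Gaussian average with the probability weight satisfies the heat equation. -/
theorem hasDerivAt_gop_unitPoly (F : SmoothPer n a b) (x : Rn n)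
    {σ α σ' α' : ℝ → ℝ} {r₀ c d L : ℝ} (hc : a < c) (hd : d < b) (h0 : α r₀ ≠ 0)
    (hσ : ∀ᶠ r in 𝓝 r₀, HasDerivAt σ (σ' r) r ∧ σ r ∈ Icc c d ∧ |σ' r| ≤ L)
    (hα : ∀ᶠ r in 𝓝 r₀, HasDerivAt α (α' r) r ∧ |α' r| ≤ L) :
    HasDerivAt (fun r => gop (unitPoly n) (α r) F (σ r) x)
      (σ' r₀ * gop (unitPoly n) (α r₀) (dt F) (σ r₀) x +
        α' r₀ * α r₀ * gop (unitPoly n) (α r₀) (lap F) (σ r₀) x) r₀ := by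
  have hs₀ : σ r₀ ∈ Ioo a b :=
    ⟨hc.trans_le hσ.self_of_nhds.2.1.1, hσ.self_of_nhds.2.1.2.trans_lt hd⟩
  convert! hasDerivAt_gop (unitPoly n) F x hc hd hσ hα using 2
  rw [mul_assoc]
  congr 1
  rw [lap_apply, gop_sum _ _ _ _ hs₀, Finset.mul_sum]
  refine Finset.sum_congr rfl fun k _ => ?_
  rw [gop_dx _ h0 _ _ hs₀]
  have e : wtDeriv k (unitPoly n) = -(MvPolynomial.X k * unitPoly n) := by
    simp [wtDeriv, unitPoly]
  have e2 : gop (wtDeriv k (unitPoly n)) (α r₀) (dx k F) (σ r₀) x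
      = -gop (MvPolynomial.X k * unitPoly n) (α r₀) (dx k F) (σ r₀) x := by
    rw [e]
    simp [gop, wt, integral_neg]
  rw [e2]
  field_simp

end SmoothPer

end NavierStokes

end

/-! ### Smoothing estimates and Duhamel's principle -/

noncomputable section

namespace NavierStokes

open Set MeasureTheory Filter Topology

variable {n : ℕ} {a b : ℝ}

/-- The total mass of the derivatives of orders one, two and three of the Gaussian density: a
common constant in the smoothing estimates for the heat semigroup. -/
def heatConst (n : ℕ) : ℝ :=
  ∑ i, mass (wtDeriv i (unitPoly n)) + ∑ i, ∑ j, mass (wtDeriv j (wtDeriv i (unitPoly n))) +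
    ∑ i, ∑ j, ∑ k, mass (wtDeriv k (wtDeriv j (wtDeriv i (unitPoly n))))

theorem sum_mass_le : (∑ i, mass (wtDeriv i (unitPoly n)) ≤ heatConst n ∧
    ∑ i, ∑ j, mass (wtDeriv j (wtDeriv i (unitPoly n))) ≤ heatConst n ∧
    ∑ i, ∑ j, ∑ k, mass (wtDeriv k (wtDeriv j (wtDeriv i (unitPoly n)))) ≤ heatConst n) ∧
    0 ≤ heatConst n := by
  have h1 : 0 ≤ ∑ i, mass (wtDeriv i (unitPoly n)) := Finset.sum_nonneg fun i _ => mass_nonneg _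
  have h2 : 0 ≤ ∑ i, ∑ j, mass (wtDeriv j (wtDeriv i (unitPoly n))) :=
    Finset.sum_nonneg fun i _ => Finset.sum_nonneg fun j _ => mass_nonneg _
  have h3 : 0 ≤ ∑ i, ∑ j, ∑ k, mass (wtDeriv k (wtDeriv j (wtDeriv i (unitPoly n)))) :=
    Finset.sum_nonneg fun i _ => Finset.sum_nonneg fun j _ =>
      Finset.sum_nonneg fun k _ => mass_nonneg _
  unfold heatConst
  refine ⟨⟨?_, ?_, ?_⟩, ?_⟩ <;> linarith

theorem heatConst_nonneg : 0 ≤ heatConst n := sum_mass_le.2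

namespace SmoothPer

variable {s α G : ℝ} {x : Rn n}

/-- The heat semigroup applied to a divergence gains a factor `1/α`. -/
theorem abs_gop_div_le (hα : 0 < α) (hs : s ∈ Ioo a b) (g : Fin n → SmoothPer n a b)
    (hg : ∀ k y, |g k (s, y)| ≤ G) (hG : 0 ≤ G) :
    |gop (unitPoly n) α (∑ k, dx k (g k)) s x| ≤ heatConst n * G / α := by
  rw [gop_sum _ _ _ _ hs]
  calc |∑ k, gop (unitPoly n) α (dx k (g k)) s x|
      ≤ ∑ k, mass (wtDeriv k (unitPoly n)) * G / α := by
        refine (Finset.abs_sum_le_sum_abs _ _).trans (Finset.sum_le_sum fun k _ => ?_)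
        rw [gop_dx _ hα.ne' _ _ hs, abs_mul, abs_neg, abs_of_pos (by positivity : 0 < 1 / α)]
        have := abs_gop_le (wtDeriv k (unitPoly n)) α (g k) (hg k) x
        calc _ ≤ 1 / α * (mass (wtDeriv k (unitPoly n)) * G) := by gcongr
          _ = _ := by ring
    _ = (∑ k, mass (wtDeriv k (unitPoly n))) * G / α := by rw [Finset.sum_mul, Finset.sum_div]
    _ ≤ _ := by gcongr; exact sum_mass_le.1.1

theorem abs_gop_dx_le (hα : 0 < α) (hs : s ∈ Ioo a b) (i : Fin n) (F : SmoothPer n a b)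
    (hF : ∀ y, |F (s, y)| ≤ G) :
    |gop (unitPoly n) α (dx i F) s x| ≤ heatConst n * G / α := by
  have hG : 0 ≤ G := (abs_nonneg _).trans (hF 0)
  have := abs_gop_div_le (x := x) hα hs (fun k => if k = i then F else 0) (G := G) (fun k y => by
    split_ifs
    · exact hF y
    · simpa using hG) hG
  have e : ∑ k, dx k (if k = i then F else 0) = dx i F := by
    rw [Finset.sum_eq_single i] <;> simp +contextual
  rwa [e] at this

theorem abs_gop_lap_le (hα : 0 < α) (hs : s ∈ Ioo a b) (F : SmoothPer n a b)
    (hF : ∀ y, |F (s, y)| ≤ G) :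
    |gop (unitPoly n) α (lap F) s x| ≤ heatConst n * G / α ^ 2 := by
  have hG : 0 ≤ G := (abs_nonneg _).trans (hF 0)
  rw [lap_apply, gop_sum _ _ _ _ hs]
  calc _ ≤ ∑ i, ∑ j, mass (wtDeriv j (wtDeriv i (unitPoly n))) * G / α ^ 2 := by
        refine (Finset.abs_sum_le_sum_abs _ _).trans (Finset.sum_le_sum fun k _ => ?_)
        refine le_trans ?_ (Finset.single_le_sum
          (f := fun j => mass (wtDeriv j (wtDeriv k (unitPoly n))) * G / α ^ 2)
          (fun j _ => by have := mass_nonneg (wtDeriv j (wtDeriv k (unitPoly n))); positivity)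
          (Finset.mem_univ k))
        rw [gop_dx _ hα.ne' _ _ hs, gop_dx _ hα.ne' _ _ hs, abs_mul, abs_mul, abs_neg,
          abs_of_pos (by positivity : 0 < 1 / α)]
        have := abs_gop_le (wtDeriv k (wtDeriv k (unitPoly n))) α F hF x
        calc _ ≤ 1 / α * (1 / α * (mass (wtDeriv k (wtDeriv k (unitPoly n))) * G)) := by gcongr
          _ = _ := by field_simp
    _ = (∑ i, ∑ j, mass (wtDeriv j (wtDeriv i (unitPoly n)))) * G / α ^ 2 := by
        simp only [Finset.sum_mul, Finset.sum_div]
    _ ≤ _ := by gcongr; exact sum_mass_le.1.2.1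

theorem abs_gop_dx_dx_dx_le (hα : 0 < α) (hs : s ∈ Ioo a b) (i : Fin n)
    (g : Fin n → Fin n → SmoothPer n a b) (hg : ∀ j k y, |g j k (s, y)| ≤ G) (hG : 0 ≤ G) :
    |gop (unitPoly n) α (dx i (∑ j, ∑ k, dx j (dx k (g j k)))) s x| ≤ heatConst n * G / α ^ 3 := by
  simp only [map_sum]
  rw [gop_sum _ _ _ _ hs]
  have hm := fun P : MvPolynomial (Fin n) ℝ => mass_nonneg P
  calc _ ≤ ∑ j, ∑ k, mass (wtDeriv k (wtDeriv j (wtDeriv i (unitPoly n)))) * G / α ^ 3 := by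
        refine (Finset.abs_sum_le_sum_abs _ _).trans (Finset.sum_le_sum fun j _ => ?_)
        rw [gop_sum _ _ _ _ hs]
        refine (Finset.abs_sum_le_sum_abs _ _).trans (Finset.sum_le_sum fun k _ => ?_)
        rw [gop_dx _ hα.ne' _ _ hs, gop_dx _ hα.ne' _ _ hs, gop_dx _ hα.ne' _ _ hs, abs_mul,
          abs_mul, abs_mul, abs_neg, abs_of_pos (by positivity : 0 < 1 / α)]
        have := abs_gop_le (wtDeriv k (wtDeriv j (wtDeriv i (unitPoly n)))) α (g j k) (hg j k) x
        calc _ ≤ 1 / α * (1 / α * (1 / α *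
              (mass (wtDeriv k (wtDeriv j (wtDeriv i (unitPoly n)))) * G))) := by gcongr
          _ = _ := by field_simp
    _ ≤ ∑ i, ∑ j, ∑ k, mass (wtDeriv k (wtDeriv j (wtDeriv i (unitPoly n)))) * G / α ^ 3 :=
        Finset.single_le_sum (f := fun i => ∑ j, ∑ k,
          mass (wtDeriv k (wtDeriv j (wtDeriv i (unitPoly n)))) * G / α ^ 3)
          (fun i _ => Finset.sum_nonneg fun j _ => Finset.sum_nonneg fun k _ => by
            have := hm (wtDeriv k (wtDeriv j (wtDeriv i (unitPoly n))))
            positivity) (Finset.mem_univ i)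
    _ = (∑ i, ∑ j, ∑ k, mass (wtDeriv k (wtDeriv j (wtDeriv i (unitPoly n))))) * G / α ^ 3 := by
        simp only [Finset.sum_mul, Finset.sum_div]
    _ ≤ _ := by gcongr; exact sum_mass_le.1.2.2

/-- Estimate for the smoothed pressure gradient. Instead of inverting the Laplacian, the average
`gop α (dx i Q)` is followed as the width `α` grows: it tends to zero as `α → ∞`, and its
`α`-derivative is `α gop α (lap (dx i Q))`, of size `G/α²` by the pressure equation. -/
theorem abs_gop_pressure_le (hα : 0 < α) (hs : s ∈ Ioo a b) (i : Fin n) (Q : SmoothPer n a b)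
    (g : Fin n → Fin n → SmoothPer n a b) (hQ : lap Q = -∑ j, ∑ k, dx j (dx k (g j k)))
    (hg : ∀ j k y, |g j k (s, y)| ≤ G) (hG : 0 ≤ G) :
    |gop (unitPoly n) α (dx i Q) s x| ≤ heatConst n * G / α := by
  obtain ⟨S, hS0, hS⟩ := Q.exists_bound_at hs
  have hK := heatConst_nonneg (n := n)
  have hder : ∀ r, 0 < r → HasDerivAt (fun r => gop (unitPoly n) r (dx i Q) s x)
      (r * gop (unitPoly n) r (lap (dx i Q)) s x) r := by
    intro r hr
    have := hasDerivAt_gop_unitPoly (dx i Q) x (σ := fun _ => s) (σ' := fun _ => 0) (α := id)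
      (α' := fun _ => 1) (r₀ := r) (c := s) (d := s) (L := 1) hs.1 hs.2 hr.ne'
      (.of_forall fun r => ⟨hasDerivAt_const r s, ⟨le_rfl, le_rfl⟩, by simp⟩)
      (.of_forall fun r => ⟨hasDerivAt_id r, by simp⟩)
    simpa using this
  have hlap : ∀ r, 0 < r → |r * gop (unitPoly n) r (lap (dx i Q)) s x| ≤
      heatConst n * G / r ^ 2 := by
    intro r hr
    have e : lap (dx i Q) = -dx i (∑ j, ∑ k, dx j (dx k (g j k))) := by
      rw [← map_neg, ← hQ]
      exact LinearMap.congr_fun (lap_comm_dx i) Q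
    rw [e, gop_neg, abs_mul, abs_neg, abs_of_pos hr]
    calc _ ≤ r * (heatConst n * G / r ^ 3) := by
          gcongr; exact abs_gop_dx_dx_dx_le hr hs i g hg hG
      _ = _ := by field_simp
  have hdiff : ∀ β, α ≤ β → |gop (unitPoly n) β (dx i Q) s x - gop (unitPoly n) α (dx i Q) s x| ≤
      heatConst n * G * (1 / α - 1 / β) := by
    intro β hβ
    refine image_norm_le_of_norm_deriv_right_le_deriv_boundary' (a := α) (b := β)
      (f := fun r => gop (unitPoly n) r (dx i Q) s x - gop (unitPoly n) α (dx i Q) s x)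
      (f' := fun r => r * gop (unitPoly n) r (lap (dx i Q)) s x)
      (B := fun r => heatConst n * G * (1 / α - 1 / r))
      (B' := fun r => heatConst n * G / r ^ 2) ?_ ?_ (by simp) ?_ ?_ ?_ ⟨hβ, le_rfl⟩
    · exact fun r hr =>
        ((hder r (hα.trans_le hr.1)).continuousAt.sub continuousAt_const).continuousWithinAt
    · exact fun r hr => ((hder r (hα.trans_le hr.1)).sub_const _).hasDerivWithinAt
    · refine ContinuousOn.mul continuousOn_const (continuousOn_const.sub ?_)
      exact continuousOn_const.div continuousOn_id fun r hr => (hα.trans_le hr.1).ne'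
    · intro r hr
      have hr0 : r ≠ 0 := (hα.trans_le hr.1).ne'
      have := (((hasDerivAt_inv hr0).const_sub (1 / α)).const_mul (heatConst n * G))
      simp only [← one_div] at this
      convert! this.hasDerivWithinAt using 1
      field_simp
    · exact fun r hr => hlap r (hα.trans_le hr.1)
  -- a width `β` at which the average of `dx i Q` is at most `ε`
  refine le_of_forall_pos_le_add fun ε hε => ?_
  let β := max α (heatConst n * S / ε)
  have hβ : α ≤ β := le_max_left _ _
  have hβ0 : 0 < β := hα.trans_le hβ
  have h1 := hdiff β hβ
  have h2 := abs_gop_dx_le (x := x) hβ0 hs i Q hS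
  have h3 : heatConst n * S / β ≤ ε := by
    rw [div_le_iff₀ hβ0, ← div_le_iff₀' hε]
    exact le_max_right _ _
  have h4 : heatConst n * G * (1 / α - 1 / β) ≤ heatConst n * G / α := by
    rw [mul_sub, mul_one_div]
    have : 0 ≤ heatConst n * G * (1 / β) := by positivity
    linarith
  have h5 := abs_sub_abs_le_abs_sub (gop (unitPoly n) α (dx i Q) s x)
    (gop (unitPoly n) β (dx i Q) s x)
  rw [abs_sub_comm] at h5
  linarith

theorem gop_unitPoly_zero (F : SmoothPer n a b) (s : ℝ) (x : Rn n) :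
    gop (unitPoly n) 0 F s x = F (s, x) := by
  simp [gop, integral_mul_const, integral_wt_unitPoly]

/-- Duhamel's principle in the form of an estimate: if the smoothed residual `∂_t W - Δ W` at
width `α` is bounded by `D/α`, then `W` at time `t` differs from the heat evolution of `W(s₀, ·)`
by at most `D √(2(t - s₀))`. -/
theorem abs_sub_gop_le (W : SmoothPer n a b) {s₀ t D : ℝ} (h₀ : a < s₀) (hst : s₀ ≤ t) (ht : t < b)
    (x : Rn n)
    (hD : ∀ s ∈ Ico s₀ t, ∀ α, 0 < α → |gop (unitPoly n) α (dt W - lap W) s x| ≤ D / α) :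
    |W (t, x) - gop (unitPoly n) √(2 * (t - s₀)) W s₀ x| ≤ D * √(2 * (t - s₀)) := by
  have hmem : ∀ s ∈ Icc s₀ t, s ∈ Ioo a b := fun s hs => ⟨h₀.trans_le hs.1, hs.2.trans_lt ht⟩
  have hsq : ∀ s ∈ Ico s₀ t, 0 < √(2 * (t - s)) := fun s hs =>
    Real.sqrt_pos.2 (by linarith [hs.2])
  have hsqd : ∀ s, s < t → HasDerivAt (fun s => √(2 * (t - s))) (-(1 / √(2 * (t - s)))) s := by
    intro s hs
    have h1 : HasDerivAt (fun s => 2 * (t - s)) (-2) s := by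
      simpa using ((hasDerivAt_id s).const_sub t).const_mul 2
    have h3 : 0 < √(2 * (t - s)) := Real.sqrt_pos.2 (by linarith)
    convert! h1.sqrt (by linarith [hs]) using 1
    field_simp
  obtain ⟨C, -, hC⟩ := W.exists_bound h₀ ht
  have hcont : ContinuousOn (fun s => gop (unitPoly n) √(2 * (t - s)) W s x) (Icc s₀ t) := by
    refine continuousOn_of_dominated (bound := fun z => |wt (unitPoly n) z| * C)
      (fun s hs => (W.integrable_wt_mul _ _ (hmem s hs) x).aestronglyMeasurable)
      (fun s hs => .of_forall fun z => ?_) ((integrable_wt _).abs.mul_const C)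
      (.of_forall fun z s hs => ContinuousAt.continuousWithinAt ?_)
    · rw [norm_mul]
      exact mul_le_mul_of_nonneg_left (hC s hs _) (abs_nonneg _)
    · refine continuousAt_const.mul ?_
      exact (W.continuousAt (mem_strip.2 (hmem s hs))).comp
        (f := fun s => (s, x + √(2 * (t - s)) • z)) (by fun_prop)
  -- the evolution from time `s` to time `t` of `W(s, ·)` varies with `s` only by the residual
  have hder : ∀ s ∈ Ico s₀ t, HasDerivAt (fun s => gop (unitPoly n) √(2 * (t - s)) W s x)
      (gop (unitPoly n) √(2 * (t - s)) (dt W - lap W) s x) s := by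
    intro s hs
    have hs' := hmem s (Ico_subset_Icc_self hs)
    have hlt : (s + t) / 2 < t := by linarith [hs.2]
    have hpos : 0 < √(2 * (t - (s + t) / 2)) := Real.sqrt_pos.2 (by linarith)
    have h2 : (a + s) / 2 < s := by linarith [hs'.1]
    have hnear : ∀ᶠ r in 𝓝 s, r ∈ Icc ((a + s) / 2) ((s + t) / 2) :=
      Icc_mem_nhds h2 (by linarith [hs.2])
    have := hasDerivAt_gop_unitPoly W x (σ := id) (σ' := fun _ => 1)
      (α := fun s => √(2 * (t - s))) (α' := fun s => -(1 / √(2 * (t - s)))) (r₀ := s)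
      (c := (a + s) / 2) (d := (s + t) / 2) (L := max 1 (1 / √(2 * (t - (s + t) / 2))))
      (by linarith [hs'.1]) (by linarith) (hsq s hs).ne'
      (hnear.mono fun r hr => ⟨hasDerivAt_id r, hr, by simp⟩)
      (hnear.mono fun r hr => ⟨hsqd r (hr.2.trans_lt hlt), by
        rw [abs_neg, abs_of_nonneg (by positivity)]
        refine le_max_of_le_right (one_div_le_one_div_of_le hpos (Real.sqrt_le_sqrt ?_))
        linarith [hr.2]⟩)
    rw [gop_sub _ _ _ _ hs']
    convert! this using 1
    have := (hsq s hs).ne'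
    simp only [id]
    field_simp
    ring
  have key := image_norm_le_of_norm_deriv_right_le_deriv_boundary' (a := s₀) (b := t)
    (f := fun s => gop (unitPoly n) √(2 * (t - s)) W s x -
      gop (unitPoly n) √(2 * (t - s₀)) W s₀ x)
    (f' := fun s => gop (unitPoly n) √(2 * (t - s)) (dt W - lap W) s x)
    (B := fun s => D * (√(2 * (t - s₀)) - √(2 * (t - s))))
    (B' := fun s => D / √(2 * (t - s)))
    (hcont.sub continuousOn_const)
    (fun s hs => ((hder s hs).sub_const _).hasDerivWithinAt) (by simp)
    (by fun_prop) (fun s hs => by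
      have := ((hsqd s hs.2).const_sub √(2 * (t - s₀))).const_mul D
      convert! this.hasDerivWithinAt using 1
      field_simp) (fun s hs => hD s hs _ (hsq s hs)) ⟨hst, le_rfl⟩
  simpa [gop_unitPoly_zero] using key

end SmoothPer

end NavierStokes

end

/-! ### The Leibniz rule with factorial weights -/

noncomputable section

namespace NavierStokes

open Filter Topology
open Finset.HasAntidiagonal (antidiagonal)

variable {n : ℕ} {a b : ℝ}

theorem sum_antidiagonal_choose_succ {R : Type*} [NonAssocSemiring R] (f : ℕ → ℕ → R) (m : ℕ) :
    ∑ p ∈ antidiagonal (m + 1), ((m + 1).choose p.1 : R) * f p.1 p.2 =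
      ∑ p ∈ antidiagonal m, (m.choose p.1 : R) * f (p.1 + 1) p.2 +
        ∑ p ∈ antidiagonal m, (m.choose p.1 : R) * f p.1 (p.2 + 1) := by
  rw [Finset.sum_antidiagonal_choose_succ_mul, add_comm]
  congr 1
  refine Finset.sum_congr rfl fun p hp => ?_
  rw [Nat.choose_symm_of_eq_add (Finset.HasAntidiagonal.mem_antidiagonal.1 hp).symm]

namespace SmoothPer

theorem dtx_zero (I : List (Fin n)) (F : SmoothPer n a b) : dtx 0 I F = dxs I F := by
  simp [dtx]

theorem dt_mul (F G : SmoothPer n a b) : dt (F * G) = dt F * G + F * dt G := der_mul _ F G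

theorem dx_mul (i : Fin n) (F G : SmoothPer n a b) : dx i (F * G) = dx i F * G + F * dx i G :=
  der_mul _ F G

theorem abs_dxs_mul_le (q : ℝ × Rn n) (I : List (Fin n)) (F G : SmoothPer n a b) (c : ℕ → ℕ → ℝ)
    (hc : ∀ J J' : List (Fin n), J.length + J'.length = I.length →
      |dxs J F q| * |dxs J' G q| ≤ c J.length J'.length) :
    |dxs I (F * G) q| ≤
      ∑ r ∈ antidiagonal I.length, (I.length.choose r.1 : ℝ) * c r.1 r.2 := by
  have hcons : ∀ (i : Fin n) (J : List (Fin n)) (F : SmoothPer n a b),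
      dxs J (dx i F) = dxs (i :: J) F := by
    intro i J F
    simpa [dtx_zero] using (dtx_cons' 0 i J F).symm
  induction I generalizing F G c with
  | nil =>
    have := hc [] [] rfl
    rw [← abs_mul] at this
    simpa using this
  | cons i I ih =>
    rw [← hcons, dx_mul, map_add, List.length_cons, sum_antidiagonal_choose_succ]
    refine (abs_add_le _ _).trans (add_le_add ?_ ?_)
    · refine ih _ _ (fun l l' => c (l + 1) l') fun J J' hJ => ?_
      rw [hcons]
      exact hc (i :: J) J' (by simp; omega)
    · refine ih _ _ (fun l l' => c l (l' + 1)) fun J J' hJ => ?_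
      rw [hcons]
      exact hc J (i :: J') (by simp; omega)

/-- The Leibniz rule for a mixed derivative, as an estimate at a point. -/
theorem abs_dtx_mul_le (q : ℝ × Rn n) (m : ℕ) (I : List (Fin n)) (F G : SmoothPer n a b)
    (c : ℕ → ℕ → ℕ → ℕ → ℝ)
    (hc : ∀ (k k' : ℕ) (J J' : List (Fin n)), k + k' = m → J.length + J'.length = I.length →
      |dtx k J F q| * |dtx k' J' G q| ≤ c k k' J.length J'.length) :
    |dtx m I (F * G) q| ≤ ∑ p ∈ antidiagonal m, (m.choose p.1 : ℝ) *
      ∑ r ∈ antidiagonal I.length, (I.length.choose r.1 : ℝ) * c p.1 p.2 r.1 r.2 := by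
  induction m generalizing F G c with
  | zero =>
    rw [dtx_zero]
    refine (abs_dxs_mul_le q I F G (c 0 0) fun J J' hJ => ?_).trans (by simp)
    simpa [dtx_zero] using hc 0 0 J J' rfl hJ
  | succ m ih =>
    rw [dtx_succ', dt_mul, map_add]
    rw [sum_antidiagonal_choose_succ fun k k' =>
      ∑ r ∈ antidiagonal I.length, (I.length.choose r.1 : ℝ) * c k k' r.1 r.2]
    refine (abs_add_le _ _).trans (add_le_add ?_ ?_)
    · refine ih _ _ (fun k k' => c (k + 1) k') fun k k' J J' hk hJ => ?_
      rw [← dtx_succ']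
      exact hc (k + 1) k' J J' (by omega) hJ
    · refine ih _ _ (fun k k' => c k (k' + 1)) fun k k' J J' hk hJ => ?_
      rw [← dtx_succ']
      exact hc k (k' + 1) J J' (by omega) hJ

/-- The Leibniz rule for pure time derivatives. -/
theorem dtx_nil_mul (m : ℕ) (F G : SmoothPer n a b) (q : ℝ × Rn n) :
    dtx m [] (F * G) q = ∑ p ∈ antidiagonal m,
      (m.choose p.1 : ℝ) * (dtx p.1 [] F q * dtx p.2 [] G q) := by
  induction m generalizing F G with
  | zero => simp
  | succ m ih =>
    rw [dtx_succ', dt_mul, map_add, coe_add, ih, ih,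
      sum_antidiagonal_choose_succ fun k k' => dtx k [] F q * dtx k' [] G q]
    simp only [dtx_succ']

end SmoothPer

/-- The weights `m!/(m + 1)²` that measure time derivatives. The factor `1/(m + 1)²` makes them
stable under the Leibniz rule, up to a constant that does not depend on `m`. -/
def weight (m : ℕ) : ℝ := m.factorial / ((m : ℝ) + 1) ^ 2

theorem weight_pos (m : ℕ) : 0 < weight m := by
  unfold weight
  have := m.factorial_pos
  positivity

theorem sum_inv_sq_le (m : ℕ) : ∑ k ∈ Finset.range (m + 1), 1 / ((k : ℝ) + 1) ^ 2 ≤ 2 := by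
  -- the stronger bound telescopes
  have : ∀ m : ℕ, ∑ k ∈ Finset.range (m + 1), 1 / ((k : ℝ) + 1) ^ 2 ≤ 2 - 1 / ((m : ℝ) + 1) := by
    intro m
    induction m with
    | zero => norm_num
    | succ m ih =>
      rw [Finset.sum_range_succ]
      have h : 1 / (((m + 1 : ℕ) : ℝ) + 1) ^ 2 ≤
          1 / ((m : ℝ) + 1) - 1 / (((m + 1 : ℕ) : ℝ) + 1) := by
        push_cast
        rw [div_sub_div _ _ (by positivity) (by positivity), div_le_div_iff₀ (by positivity)
          (by positivity)]
        nlinarith [Nat.cast_nonneg (α := ℝ) m]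
      linarith
  refine (this m).trans ?_
  have : 0 ≤ 1 / ((m : ℝ) + 1) := by positivity
  linarith

theorem sum_inv_sq_mul_inv_sq_le (m : ℕ) :
    ∑ p ∈ antidiagonal m, 1 / (((p.1 : ℝ) + 1) ^ 2 * ((p.2 : ℝ) + 1) ^ 2) ≤
      8 / ((m : ℝ) + 1) ^ 2 := by
  have h : ∀ p ∈ antidiagonal m, 1 / (((p.1 : ℝ) + 1) ^ 2 * ((p.2 : ℝ) + 1) ^ 2) ≤
      2 / ((m : ℝ) + 1) ^ 2 * (1 / ((p.1 : ℝ) + 1) ^ 2 + 1 / ((p.2 : ℝ) + 1) ^ 2) := by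
    intro p hp
    have hm : (m : ℝ) = p.1 + p.2 := by
      rw [← Finset.HasAntidiagonal.mem_antidiagonal.1 hp]
      push_cast
      ring
    rw [hm]
    have h1 := Nat.cast_nonneg (α := ℝ) p.1
    have h2 := Nat.cast_nonneg (α := ℝ) p.2
    rw [div_add_div _ _ (by positivity) (by positivity), div_mul_div_comm,
      div_le_div_iff₀ (by positivity) (by positivity)]
    have : ((p.1 : ℝ) + p.2 + 1) ^ 2 ≤ 2 * (1 * ((p.2 : ℝ) + 1) ^ 2 + ((p.1 : ℝ) + 1) ^ 2 * 1) := by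
      nlinarith [sq_nonneg ((p.1 : ℝ) - p.2)]
    nlinarith [mul_le_mul_of_nonneg_right this
      (by positivity : 0 ≤ ((p.1 : ℝ) + 1) ^ 2 * ((p.2 : ℝ) + 1) ^ 2)]
  refine (Finset.sum_le_sum h).trans ?_
  rw [← Finset.mul_sum, Finset.sum_add_distrib]
  have h1 : ∑ p ∈ antidiagonal m, 1 / ((p.1 : ℝ) + 1) ^ 2 ≤ 2 := by
    rw [Finset.Nat.sum_antidiagonal_eq_sum_range_succ_mk]
    exact sum_inv_sq_le m
  have h2 : ∑ p ∈ antidiagonal m, 1 / ((p.2 : ℝ) + 1) ^ 2 ≤ 2 := by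
    rw [← Finset.Nat.sum_antidiagonal_swap]
    exact h1
  calc _ ≤ 2 / ((m : ℝ) + 1) ^ 2 * (2 + 2) := by gcongr
    _ = _ := by ring

/-- The weights are stable under binomial convolution, which is what the Leibniz rule requires. -/
theorem sum_choose_mul_weight_le (m : ℕ) :
    ∑ p ∈ antidiagonal m, (m.choose p.1 : ℝ) * (weight p.1 * weight p.2) ≤
      8 * weight m := by
  have : ∀ p ∈ antidiagonal m, (m.choose p.1 : ℝ) * (weight p.1 * weight p.2) =
      m.factorial * (1 / (((p.1 : ℝ) + 1) ^ 2 * ((p.2 : ℝ) + 1) ^ 2)) := by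
    intro p hp
    obtain rfl := (Finset.HasAntidiagonal.mem_antidiagonal.1 hp).symm
    have h := Nat.add_choose_mul_factorial_mul_factorial p.1 p.2
    rw [← h, Nat.choose_symm_add]
    unfold weight
    push_cast
    field_simp
  rw [Finset.sum_congr rfl this, ← Finset.mul_sum]
  calc _ ≤ (m.factorial : ℝ) * (8 / ((m : ℝ) + 1) ^ 2) := by
        gcongr; exact sum_inv_sq_mul_inv_sq_le m
    _ = _ := by unfold weight; ring

namespace SmoothPer

/-- Leibniz rule in terms of weights: products of derivatives that are controlled by the weights
yield a product whose derivatives are controlled in the same way. -/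
theorem abs_dtx_mul_le_weight (q : ℝ × Rn n) (m : ℕ) (I : List (Fin n)) (F G : SmoothPer n a b)
    {κ : ℝ} (hκ : 0 ≤ κ)
    (hc : ∀ (k k' : ℕ) (J J' : List (Fin n)), k + k' = m → J.length + J'.length = I.length →
      |dtx k J F q| * |dtx k' J' G q| ≤
        κ * (weight k * ((k : ℝ) + 1) ^ J.length) * (weight k' * ((k' : ℝ) + 1) ^ J'.length)) :
    |dtx m I (F * G) q| ≤
      8 * 2 ^ I.length * κ * (weight m * ((m : ℝ) + 1) ^ I.length) := by
  refine (abs_dtx_mul_le q m I F G (fun k k' l l' =>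
    κ * (weight k * ((k : ℝ) + 1) ^ l) * (weight k' * ((k' : ℝ) + 1) ^ l')) hc).trans ?_
  have hI : ∑ r ∈ antidiagonal I.length, (I.length.choose r.1 : ℝ) = 2 ^ I.length := by
    rw [Finset.Nat.sum_antidiagonal_eq_sum_range_succ_mk]
    exact_mod_cast Nat.sum_range_choose I.length
  have : ∀ p ∈ antidiagonal m, (m.choose p.1 : ℝ) *
      ∑ r ∈ antidiagonal I.length, (I.length.choose r.1 : ℝ) *
        (κ * (weight p.1 * ((p.1 : ℝ) + 1) ^ r.1) * (weight p.2 * ((p.2 : ℝ) + 1) ^ r.2)) ≤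
      2 ^ I.length * κ * ((m : ℝ) + 1) ^ I.length *
        ((m.choose p.1 : ℝ) * (weight p.1 * weight p.2)) := by
    intro p hp
    have w1 := weight_pos p.1
    have w2 := weight_pos p.2
    have hm : (m : ℝ) = p.1 + p.2 := by
      rw [← Finset.HasAntidiagonal.mem_antidiagonal.1 hp]
      push_cast
      ring
    have h1 := Nat.cast_nonneg (α := ℝ) p.1
    have h2 := Nat.cast_nonneg (α := ℝ) p.2
    have l1 : (p.1 : ℝ) + 1 ≤ m + 1 := by linarith
    have l2 : (p.2 : ℝ) + 1 ≤ m + 1 := by linarith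
    calc _ ≤ (m.choose p.1 : ℝ) * ∑ r ∈ antidiagonal I.length, (I.length.choose r.1 : ℝ) *
          (κ * (weight p.1 * weight p.2) * ((m : ℝ) + 1) ^ I.length) := by
          refine mul_le_mul_of_nonneg_left (Finset.sum_le_sum fun r hr =>
            mul_le_mul_of_nonneg_left ?_ (Nat.cast_nonneg _)) (Nat.cast_nonneg _)
          have hr' := Finset.HasAntidiagonal.mem_antidiagonal.1 hr
          calc _ = κ * (weight p.1 * weight p.2) *
                (((p.1 : ℝ) + 1) ^ r.1 * ((p.2 : ℝ) + 1) ^ r.2) := by ring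
            _ ≤ κ * (weight p.1 * weight p.2) * (((m : ℝ) + 1) ^ r.1 * ((m : ℝ) + 1) ^ r.2) := by
                refine mul_le_mul_of_nonneg_left ?_ (by positivity)
                exact mul_le_mul (pow_le_pow_left₀ (by positivity) l1 _)
                  (pow_le_pow_left₀ (by positivity) l2 _) (by positivity) (by positivity)
            _ = _ := by rw [← pow_add, hr']
      _ = _ := by rw [← Finset.sum_mul, hI]; ring
  refine (Finset.sum_le_sum this).trans ?_
  rw [← Finset.mul_sum]
  calc _ ≤ 2 ^ I.length * κ * ((m : ℝ) + 1) ^ I.length * (8 * weight m) := by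
        gcongr; exact sum_choose_mul_weight_le m
    _ = _ := by ring

end SmoothPer

end NavierStokes

end

/-! ### The system in conservative form and bounds for its derivatives -/

noncomputable section

namespace NavierStokes

open Set Filter Topology

variable {n : ℕ} {a b : ℝ}

open SmoothPer

/-- The Navier–Stokes system in conservative form, for velocity components and a pressure in
`SmoothPer n a b`. -/
structure IsNS (U : Fin n → SmoothPer n a b) (Q : SmoothPer n a b) : Prop where
  momentum : ∀ i, dt (U i) = lap (U i) - ∑ k, dx k (U k * U i) - dx i Q
  incompressible : ∑ i, dx i (U i) = 0

namespace IsNS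

variable {U : Fin n → SmoothPer n a b} {Q : SmoothPer n a b}

/-- The pressure equation, which is the divergence of the momentum equation. -/
theorem pressure (h : IsNS U Q) : lap Q = -∑ j, ∑ k, dx j (dx k (U j * U k)) := by
  have h1 : ∑ i, dx i (dt (U i)) = 0 := by
    have : ∀ i, dx i (dt (U i)) = dt (dx i (U i)) := fun i =>
      (LinearMap.congr_fun (dt_comm i) (U i)).symm
    simp only [this]
    rw [← map_sum, h.incompressible, map_zero]
  have h2 : ∑ i, dx i (lap (U i)) = 0 := by
    have : ∀ i, dx i (lap (U i)) = lap (dx i (U i)) := fun i =>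
      (LinearMap.congr_fun (lap_comm_dx i) (U i)).symm
    simp only [this]
    rw [← map_sum, h.incompressible, map_zero]
  simp only [h.momentum, map_sub, Finset.sum_sub_distrib, h2, map_sum] at h1
  have e : ∑ i, ∑ k, dx i (dx k (U k * U i)) = ∑ j, ∑ k, dx j (dx k (U j * U k)) :=
    Finset.sum_congr rfl fun i _ => Finset.sum_congr rfl fun k _ => by rw [mul_comm]
  rw [e, ← lap_apply] at h1
  exact (eq_neg_of_add_eq_zero_left (a := lap Q) (by rw [← neg_eq_zero, ← h1]; abel))

theorem momentum_dtx (h : IsNS U Q) (m : ℕ) (I : List (Fin n)) (i : Fin n) :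
    dt (dtx m I (U i)) =
      lap (dtx m I (U i)) - ∑ k, dx k (dtx m I (U k * U i)) - dx i (dtx m I Q) := by
  rw [← dtx_dt, h.momentum, map_sub, map_sub, map_sum, dtx_lap, dtx_dx]
  simp only [dtx_dx]

theorem pressure_dtx (h : IsNS U Q) (m : ℕ) (I : List (Fin n)) :
    lap (dtx m I Q) = -∑ j, ∑ k, dx j (dx k (dtx m I (U j * U k))) := by
  rw [← dtx_lap, h.pressure, map_neg, map_sum]
  simp only [map_sum, dtx_dx]

/-- After smoothing at width `α`, the residual of the heat equation is bounded by the quadratic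
terms alone, since the pressure gradient is controlled by them. -/
theorem abs_gop_residual_le (h : IsNS U Q) (m : ℕ) (I : List (Fin n)) (i : Fin n) {s α G : ℝ}
    (hs : s ∈ Ioo a b) (hα : 0 < α) (hG : 0 ≤ G)
    (hg : ∀ j k y, |dtx m I (U j * U k) (s, y)| ≤ G) (x : Rn n) :
    |gop (unitPoly n) α (dt (dtx m I (U i)) - lap (dtx m I (U i))) s x| ≤
      2 * heatConst n * G / α := by
  have e : dt (dtx m I (U i)) - lap (dtx m I (U i)) =
      -(∑ k, dx k (dtx m I (U k * U i)) + dx i (dtx m I Q)) := by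
    rw [h.momentum_dtx]; abel
  rw [e, gop_neg, abs_neg, gop_add _ _ _ _ hs]
  have h1 := abs_gop_div_le (x := x) hα hs (fun k => dtx m I (U k * U i)) (fun k => hg k i) hG
  have h2 := abs_gop_pressure_le (x := x) hα hs i _ _ (h.pressure_dtx m I) hg hG
  refine (abs_add_le _ _).trans ((add_le_add h1 h2).trans (le_of_eq ?_))
  ring

/-- Distance of a derivative of the velocity from its heat evolution, by Duhamel's principle. -/
theorem abs_sub_gop_le (h : IsNS U Q) (m : ℕ) (I : List (Fin n)) (i : Fin n) {s₀ t G : ℝ}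
    (h₀ : a < s₀) (hst : s₀ ≤ t) (ht : t < b) (hG : 0 ≤ G)
    (hg : ∀ s ∈ Ico s₀ t, ∀ j k y, |dtx m I (U j * U k) (s, y)| ≤ G) (x : Rn n) :
    |dtx m I (U i) (t, x) - gop (unitPoly n) √(2 * (t - s₀)) (dtx m I (U i)) s₀ x| ≤
      2 * heatConst n * G * √(2 * (t - s₀)) :=
  SmoothPer.abs_sub_gop_le _ h₀ hst ht x fun s hs _ hα =>
    h.abs_gop_residual_le m I i ⟨h₀.trans_le hs.1, hs.2.trans ht⟩ hα hG (hg s hs) x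

end IsNS

/-- Scale-invariant bound, with constant `A`, for the mixed derivatives of the velocity of order
`j` in space and `m` in time on `[c, e]`; the singular weights `√(s - c) ^ j (s - c) ^ m` refer to
the initial time `c`. Here `M` stands for a bound of the velocity and `B` for the growth rate of
the time derivatives. -/
def DerivBound (U : Fin n → SmoothPer n a b) (c e M B : ℝ) (j m : ℕ) (A : ℝ) : Prop :=
  ∀ s ∈ Icc c e, ∀ I : List (Fin n), I.length = j → ∀ i x,
    √(s - c) ^ j * (s - c) ^ m * |dtx m I (U i) (s, x)| ≤
      A * (M * B ^ m * (weight m * ((m : ℝ) + 1) ^ j))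

/-- An estimate that improves each constant `Λ ≥ A` to `(A + Λ)/2` holds with the constant `A`. -/
theorem of_forall_improve {P : ℝ → Prop} {A : ℝ} (hmono : ∀ Λ Λ', Λ ≤ Λ' → P Λ → P Λ')
    (hclosed : (∀ ε > 0, P (A + ε)) → P A) (hex : ∃ Λ, P Λ)
    (himp : ∀ Λ, A ≤ Λ → P Λ → P (A / 2 + Λ / 2)) : P A := by
  obtain ⟨Λ, hΛ⟩ := hex
  have hall : ∀ k : ℕ, P (A + |Λ - A| / 2 ^ k) := by
    intro k
    induction k with
    | zero => exact hmono Λ _ (by have := le_abs_self (Λ - A); simp; linarith) hΛ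
    | succ k ih =>
      have h0 : 0 ≤ |Λ - A| / 2 ^ k := by positivity
      refine hmono _ _ (le_of_eq ?_) (himp _ (by linarith) ih)
      rw [pow_succ]
      field_simp
      ring
  refine hclosed fun ε hε => ?_
  have hlim : Tendsto (fun k : ℕ => |Λ - A| / 2 ^ k) atTop (𝓝 0) :=
    tendsto_const_nhds.div_atTop (tendsto_pow_atTop_atTop_of_one_lt (by norm_num))
  obtain ⟨k, hk⟩ := (hlim.eventually (gt_mem_nhds hε)).exists
  exact hmono _ _ (by linarith) (hall k)

namespace DerivBound

variable {U : Fin n → SmoothPer n a b} {c e M B : ℝ} {j m : ℕ}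

theorem mono (hM : 0 ≤ M) (hB : 0 ≤ B) {A A' : ℝ} (hA : A ≤ A') (h : DerivBound U c e M B j m A) :
    DerivBound U c e M B j m A' := fun s hs I hI i x => (h s hs I hI i x).trans <| by
  have := (weight_pos m).le
  gcongr

/-- The set of admissible constants is closed. -/
theorem of_forall_add {A : ℝ} (hM : 0 ≤ M) (hB : 0 ≤ B)
    (h : ∀ ε > 0, DerivBound U c e M B j m (A + ε)) : DerivBound U c e M B j m A := by
  intro s hs I hI i x
  have := (weight_pos m).le
  set Y := M * B ^ m * (weight m * ((m : ℝ) + 1) ^ j)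
  have hY : 0 ≤ Y := by positivity
  refine le_of_forall_pos_le_add fun ε hε =>
    (h (ε / (Y + 1)) (by positivity) s hs I hI i x).trans ?_
  rw [add_mul]
  gcongr
  rw [div_mul_eq_mul_div, div_le_iff₀ (by positivity)]
  nlinarith

/-- Some constant is admissible on a compact time interval, by periodicity and compactness. -/
theorem exists_const (hc : a < c) (he : e < b) (hM : 0 < M) (hB : 0 < B) :
    ∃ Λ, DerivBound U c e M B j m Λ := by
  choose C hC0 hC using fun (I : List (Fin n)) i => (dtx m I (U i)).exists_bound hc he
  have hfin : {I : List (Fin n) | I.length = j}.Finite := List.finite_length_eq _ _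
  have hw := weight_pos m
  set Y := M * B ^ m * (weight m * ((m : ℝ) + 1) ^ j)
  have hY : 0 < Y := by positivity
  refine ⟨√(e - c) ^ j * (e - c) ^ m * (∑ I ∈ hfin.toFinset, ∑ i, C I i) / Y,
    fun s hs I hI i x => ?_⟩
  rw [div_mul_cancel₀ _ hY.ne']
  have h1 : |dtx m I (U i) (s, x)| ≤ ∑ I ∈ hfin.toFinset, ∑ i, C I i :=
    (hC I i s hs x).trans <| (Finset.single_le_sum (f := fun i => C I i) (fun i _ => hC0 I i)
      (Finset.mem_univ i)).trans <| Finset.single_le_sum (f := fun I => ∑ i, C I i)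
        (fun I _ => Finset.sum_nonneg fun i _ => hC0 I i) (hfin.mem_toFinset.2 hI)
  have h2 : 0 ≤ s - c := by linarith [hs.1]
  have h3 : 0 ≤ e - c := by linarith [hs.1, hs.2]
  have h4 : s - c ≤ e - c := by linarith [hs.2]
  gcongr

/-- Products of velocity components inherit the bounds for the derivatives. The constants `A`, `A'`
of the two factors may depend on how the derivatives are distributed; only the products `A A'` have
to be bounded by a common `κ`. -/
theorem abs_dtx_mul_le {κ D s : ℝ} (hM : 0 ≤ M) (hB : 0 ≤ B) (hκ : 0 ≤ κ) (hD : 0 < D)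
    (hs : s ∈ Icc c e) (hDs : D ≤ 2 * (√(s - c) ^ j * (s - c) ^ m))
    (h : ∀ k k' l l', k + k' = m → l + l' = j → ∃ A A', DerivBound U c e M B l k A ∧
      DerivBound U c e M B l' k' A' ∧ 0 ≤ A ∧ A * A' ≤ κ)
    (I : List (Fin n)) (hI : I.length = j) (p q : Fin n) (y : Rn n) :
    |dtx m I (U p * U q) (s, y)| ≤
      16 * 2 ^ j * κ * (M ^ 2 * B ^ m * (weight m * ((m : ℝ) + 1) ^ j)) / D := by
  have hsc : 0 ≤ s - c := by linarith [hs.1]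
  have hw := fun k => (weight_pos k).le
  refine (abs_dtx_mul_le_weight (s, y) m I (U p) (U q) (κ := 2 * κ * (M ^ 2 * B ^ m) / D)
    (by positivity) ?_).trans (le_of_eq (by rw [hI]; ring))
  intro k k' J J' hk hJ
  obtain ⟨A, A', hA, hA', hA0, hAA⟩ := h k k' J.length J'.length hk (by omega)
  have h1 := hA s hs J rfl p y
  have h2 := hA' s hs J' rfl q y
  have h3 := mul_le_mul h1 h2 (by positivity)
    (mul_nonneg hA0 (by have := hw k; positivity))
  set X := |dtx k J (U p) (s, y)| * |dtx k' J' (U q) (s, y)| with hX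
  have hX0 : 0 ≤ X := by positivity
  have e1 : √(s - c) ^ J.length * (s - c) ^ k * |dtx k J (U p) (s, y)| *
      (√(s - c) ^ J'.length * (s - c) ^ k' * |dtx k' J' (U q) (s, y)|) =
      √(s - c) ^ j * (s - c) ^ m * X := by
    rw [hX, ← hk, ← hI, ← hJ, pow_add, pow_add]; ring
  set w := (weight k * ((k : ℝ) + 1) ^ J.length) * (weight k' * ((k' : ℝ) + 1) ^ J'.length)
  have hw0 : 0 ≤ w := by have := hw k; have := hw k'; positivity
  have e2 : A * (M * B ^ k * (weight k * ((k : ℝ) + 1) ^ J.length)) *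
      (A' * (M * B ^ k' * (weight k' * ((k' : ℝ) + 1) ^ J'.length))) =
      A * A' * (M ^ 2 * B ^ m * w) := by
    rw [← hk, pow_add]; ring
  rw [e1, e2] at h3
  have e3 : 2 * κ * (M ^ 2 * B ^ m) / D * (weight k * ((k : ℝ) + 1) ^ J.length) *
      (weight k' * ((k' : ℝ) + 1) ^ J'.length) = 2 * (κ * (M ^ 2 * B ^ m * w)) / D := by ring
  rw [e3, le_div_iff₀ hD]
  have h4 : A * A' * (M ^ 2 * B ^ m * w) ≤ κ * (M ^ 2 * B ^ m * w) := by gcongr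
  calc X * D ≤ X * (2 * (√(s - c) ^ j * (s - c) ^ m)) := by gcongr
    _ ≤ _ := by linarith

end DerivBound

/-- Going back from `t` by a small fraction `η` of the elapsed time `t - c` changes the singular
weight at most by a factor of two. -/
theorem weight_le_two_mul {c t s η : ℝ} {j m : ℕ} (hη0 : 0 ≤ η) (hη : η * (j + m) ≤ 1 / 2)
    (hη1 : η ≤ 1) (hct : c ≤ t) (hs : t - η * (t - c) ≤ s) :
    √(t - c) ^ j * (t - c) ^ m ≤ 2 * (√(s - c) ^ j * (s - c) ^ m) := by
  have hd : 0 ≤ t - c := by linarith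
  have h1 : (1 - η) * (t - c) ≤ s - c := by nlinarith
  have h10 : 0 ≤ 1 - η := by linarith
  have hsc : 0 ≤ s - c := (mul_nonneg h10 hd).trans h1
  have h2 : (1 - η) * √(t - c) ≤ √(s - c) := by
    refine Real.le_sqrt_of_sq_le ?_
    rw [mul_pow, Real.sq_sqrt hd]
    refine le_trans ?_ h1
    gcongr
    nlinarith
  have h3 : 1 / 2 ≤ (1 - η) ^ (j + m) := by
    have := one_add_mul_le_pow (a := -η) (by linarith) (j + m)
    push_cast at this
    rw [← sub_eq_add_neg] at this
    nlinarith
  calc √(t - c) ^ j * (t - c) ^ m = 2 * (1 / 2 * (√(t - c) ^ j * (t - c) ^ m)) := by ring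
    _ ≤ 2 * ((1 - η) ^ (j + m) * (√(t - c) ^ j * (t - c) ^ m)) := by gcongr
    _ = 2 * (((1 - η) * √(t - c)) ^ j * ((1 - η) * (t - c)) ^ m) := by
        rw [mul_pow, mul_pow, pow_add]; ring
    _ ≤ _ := by gcongr

end NavierStokes

end

/-! ### Absorption of the highest derivatives -/

noncomputable section

namespace NavierStokes

open Set Filter Topology SmoothPer

variable {n : ℕ} {a b : ℝ}

variable {U : Fin n → SmoothPer n a b} {Q : SmoothPer n a b} {c e M B ε κ : ℝ} {j m : ℕ}

/-- The length `η = ε / (m + 1)` of a step, relative to the elapsed time, satisfies the assumptions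
of `weight_le_two_mul`. -/
theorem step_size (hε : 0 < ε) (hεj : ε * (j + 1) ≤ 1 / 2) (m : ℕ) :
    0 < ε / ((m : ℝ) + 1) ∧ ε / ((m : ℝ) + 1) ≤ ε ∧ ε / ((m : ℝ) + 1) * (j + m) ≤ 1 / 2 ∧
      ε / ((m : ℝ) + 1) ≤ 1 / 2 := by
  have hm : (0 : ℝ) ≤ m := Nat.cast_nonneg m
  have hj : (0 : ℝ) ≤ j := Nat.cast_nonneg j
  have h1 : ε / ((m : ℝ) + 1) ≤ ε := div_le_self hε.le (by linarith)
  have h2 : 0 ≤ ε * j := by positivity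
  refine ⟨by positivity, h1, ?_, h1.trans (by linarith)⟩
  rw [div_mul_eq_mul_div, div_le_iff₀ (by positivity)]
  have h3 := mul_le_mul_of_nonneg_right hεj hm
  have h4 : 0 ≤ ε * j * m := by positivity
  linarith

/-- Duhamel estimate from the time `t - η (t - c)` with `η = ε / (m + 1)`, in weighted form. -/
theorem IsNS.weighted_duhamel (h : IsNS U Q) (hc : a < c) (he : e < b) (hM : 0 < M)
    (hce : (e - c) * M ^ 2 ≤ 1) (hB : 0 ≤ B) (hε : 0 < ε) (hεj : ε * (j + 1) ≤ 1 / 2) (hκ : 0 ≤ κ)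
    (hpair : ∀ k k' l l', k + k' = m → l + l' = j → ∃ A A', DerivBound U c e M B l k A ∧
      DerivBound U c e M B l' k' A' ∧ 0 ≤ A ∧ A * A' ≤ κ)
    {t : ℝ} (ht : t ∈ Ioc c e) (I : List (Fin n)) (hI : I.length = j) (i : Fin n) (x : Rn n) :
    √(t - c) ^ j * (t - c) ^ m * |dtx m I (U i) (t, x)| ≤
      √(t - c) ^ j * (t - c) ^ m * |gop (unitPoly n) √(2 * (ε / (m + 1) * (t - c)))
        (dtx m I (U i)) (t - ε / (m + 1) * (t - c)) x| +
      64 * 2 ^ j * heatConst n * κ * √ε * (M * B ^ m * (weight m * ((m : ℝ) + 1) ^ j)) := by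
  have hd : 0 < t - c := by linarith [ht.1]
  have hK := heatConst_nonneg (n := n)
  have hw := weight_pos m
  have hm0 : (0 : ℝ) ≤ m := Nat.cast_nonneg m
  have hj0 : (0 : ℝ) ≤ j := Nat.cast_nonneg j
  have hstep := step_size hε hεj m
  set η := ε / ((m : ℝ) + 1) with hη
  obtain ⟨hη0, hηε, hηj, hη1⟩ := hstep
  set D := √(t - c) ^ j * (t - c) ^ m with hDdef
  have hsd : 0 < √(t - c) := Real.sqrt_pos.2 hd
  have hD : 0 < D := by positivity
  set Y := M * B ^ m * (weight m * ((m : ℝ) + 1) ^ j) with hY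
  have hY0 : 0 ≤ Y := by positivity
  set s₀ := t - η * (t - c) with hs₀
  have hηd := mul_pos hη0 hd
  have hηd' := mul_le_mul_of_nonneg_right hη1 hd.le
  have hs₀c : c < s₀ := by linarith
  have hs₀t : s₀ ≤ t := by linarith
  have hG := h.abs_sub_gop_le m I i (s₀ := s₀) (t := t)
    (G := 16 * 2 ^ j * κ * (M ^ 2 * B ^ m * (weight m * ((m : ℝ) + 1) ^ j)) / D)
    (hc.trans hs₀c) hs₀t (ht.2.trans_lt he) (by positivity)
    (fun s hs p q y => DerivBound.abs_dtx_mul_le hM.le hB hκ hD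
      ⟨(hs₀c.trans_le hs.1).le, hs.2.le.trans ht.2⟩
      (weight_le_two_mul hη0.le hηj (by linarith) ht.1.le hs.1) hpair I hI p q y) x
  have hts : t - s₀ = η * (t - c) := by rw [hs₀]; ring
  rw [hts] at hG
  have hsq : √(2 * (η * (t - c))) ≤ 2 * √ε * √(t - c) := by
    rw [Real.sqrt_le_left (by positivity), mul_pow, mul_pow, Real.sq_sqrt hε.le, Real.sq_sqrt hd.le]
    linarith [mul_le_mul_of_nonneg_right hηε hd.le, mul_pos hε hd]
  have hsM : √(t - c) * M ≤ 1 := by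
    rw [← Real.sqrt_sq hM.le, ← Real.sqrt_mul hd.le, Real.sqrt_le_one]
    refine le_trans ?_ hce
    have := ht.2
    gcongr
  have h2 : D * (2 * heatConst n * (16 * 2 ^ j * κ *
      (M ^ 2 * B ^ m * (weight m * ((m : ℝ) + 1) ^ j)) / D) * √(2 * (η * (t - c)))) ≤
      64 * 2 ^ j * heatConst n * κ * √ε * Y := by
    calc _ = 32 * 2 ^ j * heatConst n * κ * Y * (M * √(2 * (η * (t - c)))) := by
          rw [hY]; field_simp; ring
      _ ≤ 32 * 2 ^ j * heatConst n * κ * Y * (M * (2 * √ε * √(t - c))) := by gcongr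
      _ = 64 * 2 ^ j * heatConst n * κ * √ε * Y * (√(t - c) * M) := by ring
      _ ≤ 64 * 2 ^ j * heatConst n * κ * √ε * Y * 1 := by gcongr
      _ = _ := by ring
  have h3 := abs_sub_abs_le_abs_sub (dtx m I (U i) (t, x))
    (gop (unitPoly n) √(2 * (η * (t - c))) (dtx m I (U i)) s₀ x)
  have h4 := mul_le_mul_of_nonneg_left (h3.trans hG) hD.le
  rw [mul_sub] at h4
  linarith

/-- The cost of one space derivative on the heat kernel of the step `ε / (m + 1)`. -/
theorem inv_sqrt_step_le (hε : 0 < ε) {d : ℝ} (hd : 0 < d) (m : ℕ) :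
    √d / √(2 * (ε / (m + 1) * d)) ≤ ((m : ℝ) + 1) / √ε := by
  have hm : (0 : ℝ) < (m : ℝ) + 1 := by positivity
  rw [div_le_div_iff₀ (Real.sqrt_pos.2 (by positivity)) (Real.sqrt_pos.2 hε), ← Real.sqrt_mul hd.le]
  refine Real.sqrt_le_left (by positivity) |>.2 ?_
  rw [mul_pow, Real.sq_sqrt (by positivity)]
  have : ((m : ℝ) + 1) ^ 2 * (2 * (ε / (m + 1) * d)) = 2 * ((m + 1) * (d * ε)) := by
    field_simp
  rw [this]
  have h1 : (0 : ℝ) ≤ m := Nat.cast_nonneg m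
  nlinarith [mul_pos hd hε, mul_nonneg h1 (mul_pos hd hε).le]

/-- The improvement step for derivatives of positive order in space. One space derivative of the
initial term is moved onto the heat kernel, which costs a factor `(m + 1) / √ε`. -/
theorem IsNS.improve_space (h : IsNS U Q) (hc : a < c) (he : e < b) (hM : 0 < M)
    (hce : (e - c) * M ^ 2 ≤ 1) (hB : 0 ≤ B) (hε : 0 < ε) (hεj : ε * (j + 1 + 1) ≤ 1 / 2)
    (hεK : 64 * 2 ^ (j + 1) * heatConst n * √ε ≤ 1 / 2) {A Λ : ℝ} (hA1 : 1 ≤ A)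
    (hAΛ : 4 * heatConst n * A / √ε + A ^ 2 ≤ Λ)
    (h₀ : ∀ k, DerivBound U c e M B 0 k 1)
    (hlow : ∀ l ≤ j, ∀ k, DerivBound U c e M B l k A)
    (hΛ : ∀ k ≤ m, DerivBound U c e M B (j + 1) k Λ) :
    DerivBound U c e M B (j + 1) m (2 * heatConst n * A / √ε + A ^ 2 / 2 + Λ / 2) := by
  have hK := heatConst_nonneg (n := n)
  have hw := weight_pos m
  have hsε : 0 < √ε := Real.sqrt_pos.2 hε
  have hΛ0 : 0 ≤ Λ := le_trans (by positivity) hAΛ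
  intro t ht I hI i x
  rcases ht.1.eq_or_lt with rfl | hct
  · simp only [sub_self, Real.sqrt_zero]
    rw [zero_pow (by omega), zero_mul, zero_mul]
    positivity
  obtain ⟨i', I', rfl⟩ : ∃ i' I', I = i' :: I' := by
    cases I with
    | nil => simp at hI
    | cons i' I' => exact ⟨i', I', rfl⟩
  have hI' : I'.length = j := by simpa using hI
  have hd : 0 < t - c := by linarith
  -- at most one factor of a product carries all the space derivatives, and then the other one
  -- carries none and has the constant `1`
  have hdu := h.weighted_duhamel (κ := A ^ 2 + Λ) (j := j + 1) (m := m) hc he hM hce hB hε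
    (by push_cast; exact hεj) (by positivity) (fun k k' l l' hk hl => by
      rcases Nat.lt_or_ge l (j + 1) with h1 | h1
      · rcases Nat.lt_or_ge l' (j + 1) with h2 | h2
        · exact ⟨A, A, hlow l (by omega) k, hlow l' (by omega) k', by linarith, by
            rw [← sq]; linarith⟩
        · obtain rfl : l' = j + 1 := by omega
          obtain rfl : l = 0 := by omega
          exact ⟨1, Λ, h₀ k, hΛ k' (by omega), zero_le_one, by linarith [sq_nonneg A]⟩
      · obtain rfl : l = j + 1 := by omega
        obtain rfl : l' = 0 := by omega
        exact ⟨Λ, 1, hΛ k (by omega), h₀ k', hΛ0, by linarith [sq_nonneg A]⟩)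
      ⟨hct, ht.2⟩ (i' :: I') hI i x
  refine hdu.trans ?_
  have hm0 : (0 : ℝ) ≤ m := Nat.cast_nonneg m
  have hj0 : (0 : ℝ) ≤ j := Nat.cast_nonneg j
  have hst := inv_sqrt_step_le hε hd m
  have hstep := step_size (j := j) hε (by linarith) m
  set η := ε / ((m : ℝ) + 1) with hη
  obtain ⟨hη0, -, hηj, hη1⟩ := hstep
  set s₀ := t - η * (t - c) with hs₀
  have hηd := mul_pos hη0 hd
  have hηd' := mul_le_mul_of_nonneg_right hη1 hd.le
  have hs₀c : c < s₀ := by linarith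
  have hs₀t : s₀ ≤ t := by linarith
  have hsc : 0 < s₀ - c := by linarith
  have hssc : 0 < √(s₀ - c) := Real.sqrt_pos.2 hsc
  set α := √(2 * (η * (t - c)))
  have hα : 0 < α := Real.sqrt_pos.2 (by positivity)
  set D₀ := √(s₀ - c) ^ j * (s₀ - c) ^ m with hD₀
  have hD₀0 : 0 < D₀ := by positivity
  have hwt := weight_le_two_mul (j := j) (m := m) hη0.le hηj (by linarith) ht.1 hs₀.le
  have hval : ∀ y, |dtx m I' (U i) (s₀, y)| ≤
      A * (M * B ^ m * (weight m * ((m : ℝ) + 1) ^ j)) / D₀ := by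
    intro y
    rw [le_div_iff₀ hD₀0, mul_comm]
    exact hlow j le_rfl m s₀ ⟨hs₀c.le, hs₀t.trans ht.2⟩ I' hI' i y
  rw [dtx_cons]
  have hg := abs_gop_dx_le (x := x) hα ⟨hc.trans hs₀c, (hs₀t.trans ht.2).trans_lt he⟩ i'
    (dtx m I' (U i)) hval
  set Z := M * B ^ m * (weight m * ((m : ℝ) + 1) ^ j) with hZ
  have hZ0 : 0 ≤ Z := by positivity
  have hYZ : M * B ^ m * (weight m * ((m : ℝ) + 1) ^ (j + 1)) = Z * (m + 1) := by
    rw [hZ, pow_succ]; ring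
  rw [hYZ]
  have h1 : √(t - c) ^ (j + 1) * (t - c) ^ m *
      |gop (unitPoly n) α (dx i' (dtx m I' (U i))) s₀ x| ≤
      2 * heatConst n * A / √ε * (Z * (m + 1)) := by
    have hsd : 0 < √(t - c) := Real.sqrt_pos.2 hd
    calc _ ≤ √(t - c) ^ (j + 1) * (t - c) ^ m * (heatConst n * (A * Z / D₀) / α) := by gcongr
      _ = (√(t - c) ^ j * (t - c) ^ m) * (√(t - c) / α) * (heatConst n * (A * Z / D₀)) := by
          rw [pow_succ]; ring
      _ ≤ (2 * D₀) * ((m + 1) / √ε) * (heatConst n * (A * Z / D₀)) := by gcongr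
      _ = _ := by field_simp
  have h2 : 64 * 2 ^ (j + 1) * heatConst n * (A ^ 2 + Λ) * √ε * (Z * (m + 1)) ≤
      (A ^ 2 / 2 + Λ / 2) * (Z * (m + 1)) := by
    calc _ = (64 * 2 ^ (j + 1) * heatConst n * √ε) * (A ^ 2 + Λ) * (Z * (m + 1)) := by ring
      _ ≤ 1 / 2 * (A ^ 2 + Λ) * (Z * (m + 1)) := by gcongr
      _ = _ := by ring
  calc _ ≤ 2 * heatConst n * A / √ε * (Z * (m + 1)) + (A ^ 2 / 2 + Λ / 2) * (Z * (m + 1)) :=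
        add_le_add h1 h2
    _ = _ := by ring

/-- Passing from the weight of order `m` to that of order `m + 1` gains a factor of size `m + 1`. -/
theorem weight_pred_le {m : ℕ} : weight m * (((m + 1 : ℕ) : ℝ) + 1) ≤ 8 * weight (m + 1) := by
  unfold weight
  rw [Nat.factorial_succ]
  push_cast
  have hf : (0 : ℝ) < m.factorial := by exact_mod_cast m.factorial_pos
  have hm : (0 : ℝ) ≤ m := Nat.cast_nonneg m
  rw [div_mul_eq_mul_div, mul_div_assoc', div_le_div_iff₀ (by positivity) (by positivity)]
  have h1 : ((m : ℝ) + 1 + 1) ^ 3 ≤ 8 * (m + 1) ^ 3 := by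
    have : ((m : ℝ) + 1 + 1) ^ 3 ≤ (2 * (m + 1)) ^ 3 := by gcongr; linarith
    linarith [this, (by ring : (2 * ((m : ℝ) + 1)) ^ 3 = 8 * (m + 1) ^ 3)]
  calc _ = (m.factorial : ℝ) * ((m : ℝ) + 1 + 1) ^ 3 := by ring
    _ ≤ m.factorial * (8 * (m + 1) ^ 3) := by gcongr
    _ = _ := by ring

/-- The numerical part of the improvement step for time derivatives. With `T` the elapsed time, `α`
the width of the heat kernel and `μ` comparable to the order of differentiation, the initial term
contributes at most half of the bound for the derivative of order `m + 1` once `B` is a large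
multiple of `K / ε`. -/
theorem improve_time_aux {K M B ε σ w w' μ T r α D : ℝ} (hK : 0 ≤ K) (hM : 0 < M) (hB : 0 < B)
    (hε : 0 < ε) (hσε : ε ≤ σ) (hw : 0 < w) (hμ : 0 < μ) (hr : 0 < r) (hα : 0 < α)
    (hD : 0 < D) (hrT : r * r = T) (hα2 : α ^ 2 = 2 * (ε / μ * T)) (hrM : r * M ≤ 1)
    (hrα : r / α ≤ μ / σ) (hTD : T ^ m ≤ 2 * D) (hww : w * μ ≤ 8 * w')
    (hBK : 1040 * K ≤ ε * B) :
    T ^ (m + 1) * (K * (M * B ^ m * w / D) / α ^ 2 + 2 * K * (16 * (M ^ 2 * B ^ m * w) / D) / α) ≤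
      1 / 2 * (M * B ^ (m + 1) * w') := by
  have hT : 0 < T := hrT ▸ mul_pos hr hr
  have hw' : 0 < w' := by linarith [mul_pos hw hμ]
  set P := M * B ^ m with hP
  have hP0 : 0 < P := by positivity
  have e1 : T * (K * (P * w / D) / α ^ 2) = K * (P * (w * μ)) / D * (1 / (2 * ε)) := by
    rw [hα2]; field_simp
  have e2 : T * (2 * K * (16 * (M ^ 2 * B ^ m * w) / D) / α) =
      (r * M) * (r / α) * (32 * K * (P * w) / D) := by
    rw [← hrT, hP]; ring
  have e3 : (r * M) * (r / α) * (32 * K * (P * w) / D) ≤ 1 * (μ / σ) * (32 * K * (P * w) / D) := by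
    gcongr
  have e4 : 1 * (μ / σ) * (32 * K * (P * w) / D) ≤ K * (P * (w * μ)) / D * (32 / ε) := by
    calc 1 * (μ / σ) * (32 * K * (P * w) / D) ≤ 1 * (μ / ε) * (32 * K * (P * w) / D) := by gcongr
      _ = _ := by ring
  have e5 : K * (P * (w * μ)) / D ≤ K * (P * (8 * w')) / D := by gcongr
  calc _ = T ^ m * (T * (K * (P * w / D) / α ^ 2) +
        T * (2 * K * (16 * (M ^ 2 * B ^ m * w) / D) / α)) := by rw [pow_succ]; ring
    _ ≤ (2 * D) * (K * (P * (8 * w')) / D * (1 / (2 * ε)) + K * (P * (8 * w')) / D * (32 / ε)) := by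
        rw [e1, e2]
        refine mul_le_mul hTD (add_le_add (by gcongr) (e3.trans (e4.trans ?_)))
          (by positivity) (by positivity)
        exact mul_le_mul_of_nonneg_right e5 (by positivity)
    -- `2 * (8 / 2 + 8 * 32) = 520 = 1040 / 2`
    _ = (1040 * K / ε) * (1 / 2 * (P * w')) := by field_simp; ring
    _ ≤ B * (1 / 2 * (P * w')) := by
        gcongr
        rw [div_le_iff₀ hε]; linarith
    _ = _ := by rw [hP, pow_succ]; ring

/-- The improvement step for pure time derivatives. The time derivative of the initial term is
replaced through the momentum equation by space derivatives of lower time derivatives. -/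
theorem IsNS.improve_time (h : IsNS U Q) (hc : a < c) (he : e < b) (hM : 0 < M)
    (hce : (e - c) * M ^ 2 ≤ 1) (hε : 0 < ε) (hε2 : ε ≤ 1 / 2)
    (hεK : 64 * heatConst n * √ε ≤ 1 / 2) (hB : 0 < B) (hBK : 1040 * heatConst n ≤ ε * B)
    {Λ : ℝ} (hΛ1 : 1 ≤ Λ)
    (hlow : ∀ k ≤ m, DerivBound U c e M B 0 k 1)
    (hΛ : DerivBound U c e M B 0 (m + 1) Λ) :
    DerivBound U c e M B 0 (m + 1) (1 / 2 + Λ / 2) := by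
  have hK := heatConst_nonneg (n := n)
  have hw := weight_pos m
  have hw' := weight_pos (m + 1)
  have hsε : 0 < √ε := Real.sqrt_pos.2 hε
  intro t ht I hI i x
  obtain rfl : I = [] := List.length_eq_zero_iff.1 hI
  rcases ht.1.eq_or_lt with rfl | hct
  · simp only [sub_self]
    rw [zero_pow (by omega : m + 1 ≠ 0), mul_zero, zero_mul]
    positivity
  have hd : 0 < t - c := by linarith
  -- at most one factor of a product carries all the time derivatives
  have hdu := h.weighted_duhamel (κ := Λ) (j := 0) (m := m + 1) hc he hM hce hB.le hε
    (by simpa using hε2) (by positivity) (fun k k' l l' hk hl => by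
      obtain rfl : l = 0 := by omega
      obtain rfl : l' = 0 := by omega
      rcases Nat.lt_or_ge k (m + 1) with h1 | h1
      · rcases Nat.lt_or_ge k' (m + 1) with h2 | h2
        · exact ⟨1, 1, hlow k (by omega), hlow k' (by omega), zero_le_one, by linarith⟩
        · obtain rfl : k' = m + 1 := by omega
          exact ⟨1, Λ, hlow k (by omega), hΛ, zero_le_one, by linarith⟩
      · obtain rfl : k = m + 1 := by omega
        exact ⟨Λ, 1, hΛ, hlow k' (by omega), by linarith, by linarith⟩) ⟨hct, ht.2⟩ [] rfl i x
  refine hdu.trans ?_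
  simp only [pow_zero, one_mul, mul_one]
  have hm0 : (0 : ℝ) ≤ m := Nat.cast_nonneg m
  have hst := inv_sqrt_step_le hε hd (m + 1)
  have hstep := step_size (j := 0) hε (by simpa using hε2) (m + 1)
  set μ := ((m + 1 : ℕ) : ℝ) + 1 with hμ
  have hμm : μ = m + 2 := by rw [hμ]; push_cast; ring
  have hμ0 : 0 < μ := by positivity
  set η := ε / μ with hη
  obtain ⟨hη0, -, hηj', hη1⟩ := hstep
  have hηj : η * ((0 : ℕ) + m) ≤ 1 / 2 := by
    push_cast at hηj' ⊢
    linarith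
  set s₀ := t - η * (t - c) with hs₀
  have hηd := mul_pos hη0 hd
  have hηd' := mul_le_mul_of_nonneg_right hη1 hd.le
  have hs₀c : c < s₀ := by linarith
  have hs₀t : s₀ ≤ t := by linarith
  have hsc : 0 < s₀ - c := by linarith
  have hs₀m : s₀ ∈ Ioo a b := ⟨hc.trans hs₀c, (hs₀t.trans ht.2).trans_lt he⟩
  set α := √(2 * (η * (t - c))) with hαdef
  have hα : 0 < α := Real.sqrt_pos.2 (by positivity)
  have hα2 : α ^ 2 = 2 * (η * (t - c)) := Real.sq_sqrt (by positivity)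
  set D₀ := (s₀ - c) ^ m with hD₀
  have hD₀0 : 0 < D₀ := by positivity
  have hwt := weight_le_two_mul (j := 0) (m := m) hη0.le hηj (by linarith) ht.1 hs₀.le
  simp only [pow_zero, one_mul] at hwt
  rw [← hD₀] at hwt
  have hval : ∀ y, |dtx m [] (U i) (s₀, y)| ≤ M * B ^ m * weight m / D₀ := by
    intro y
    rw [le_div_iff₀ hD₀0, mul_comm]
    simpa using hlow m le_rfl s₀ ⟨hs₀c.le, hs₀t.trans ht.2⟩ [] rfl i y
  have hprod : ∀ p q y, |dtx m [] (U p * U q) (s₀, y)| ≤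
      16 * (M ^ 2 * B ^ m * weight m) / D₀ := by
    intro p q y
    have := DerivBound.abs_dtx_mul_le (U := U) (c := c) (e := e) (M := M) (B := B) (j := 0) (m := m)
      (κ := 1) (D := D₀) (s := s₀) hM.le hB.le zero_le_one hD₀0 ⟨hs₀c.le, hs₀t.trans ht.2⟩
      (by simp only [pow_zero, one_mul]; linarith)
      (fun k k' l l' hk hl => by
        obtain rfl : l = 0 := by omega
        obtain rfl : l' = 0 := by omega
        exact ⟨1, 1, hlow k (by omega), hlow k' (by omega), zero_le_one, by norm_num⟩)
      [] rfl p q y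
    simpa using this
  have hg : |gop (unitPoly n) α (dtx (m + 1) [] (U i)) s₀ x| ≤
      heatConst n * (M * B ^ m * weight m / D₀) / α ^ 2 +
        2 * heatConst n * (16 * (M ^ 2 * B ^ m * weight m) / D₀) / α := by
    have e1 : dtx (m + 1) [] (U i) = lap (dtx m [] (U i)) +
        (dt (dtx m [] (U i)) - lap (dtx m [] (U i))) := by
      rw [dtx_succ]; abel
    rw [e1, gop_add _ _ _ _ hs₀m]
    refine (abs_add_le _ _).trans (add_le_add ?_ ?_)
    · exact abs_gop_lap_le hα hs₀m _ hval
    · exact h.abs_gop_residual_le m [] i hs₀m hα (by positivity) hprod x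
  have hsM : √(t - c) * M ≤ 1 := by
    rw [← Real.sqrt_sq hM.le, ← Real.sqrt_mul hd.le, Real.sqrt_le_one]
    refine le_trans ?_ hce
    have := ht.2
    gcongr
  have hsd : 0 < √(t - c) := Real.sqrt_pos.2 hd
  have hsds : √(t - c) * √(t - c) = t - c := Real.mul_self_sqrt hd.le
  have hwp : weight m * μ ≤ 8 * weight (m + 1) := weight_pred_le
  have hsε1 : ε ≤ √ε := Real.le_sqrt_of_sq_le (by nlinarith)
  have h1 : (t - c) ^ (m + 1) * |gop (unitPoly n) α (dtx (m + 1) [] (U i)) s₀ x| ≤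
      1 / 2 * (M * B ^ (m + 1) * weight (m + 1)) := by
    refine (mul_le_mul_of_nonneg_left hg (by positivity)).trans ?_
    exact improve_time_aux hK hM hB hε hsε1 hw hμ0 hsd hα hD₀0 hsds hα2 hsM hst hwt hwp hBK
  have h2 : 64 * heatConst n * Λ * √ε * (M * B ^ (m + 1) * weight (m + 1)) ≤
      Λ / 2 * (M * B ^ (m + 1) * weight (m + 1)) := by
    calc _ = (64 * heatConst n * √ε) * Λ * (M * B ^ (m + 1) * weight (m + 1)) := by ring
      _ ≤ 1 / 2 * Λ * (M * B ^ (m + 1) * weight (m + 1)) := by gcongr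
      _ = _ := by ring
  linarith

end NavierStokes

end

/-! ### Estimates for all derivatives -/

noncomputable section

namespace NavierStokes

open Set Filter Topology SmoothPer

variable {n : ℕ}

/-- The fraction of the elapsed time by which the estimates of order `j` in space go back. -/
theorem exists_step_fraction (n j : ℕ) :
    ∃ ε : ℝ, 0 < ε ∧ ε * (j + 1) ≤ 1 / 2 ∧ 64 * 2 ^ j * heatConst n * √ε ≤ 1 / 2 := by
  have hK := heatConst_nonneg (n := n)
  set S := 1 / (2 * (64 * 2 ^ j * heatConst n) + 2 * (j + 1)) with hS
  have hden : 2 ≤ 2 * (64 * 2 ^ j * heatConst n) + 2 * ((j : ℝ) + 1) := by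
    have : 0 ≤ 64 * 2 ^ j * heatConst n := by positivity
    linarith [Nat.cast_nonneg (α := ℝ) j]
  have hS0 : 0 < S := by positivity
  have hSd : S * (2 * (64 * 2 ^ j * heatConst n) + 2 * ((j : ℝ) + 1)) = 1 := by
    rw [hS]; field_simp
  have hA : 0 ≤ S * (64 * 2 ^ j * heatConst n) := by positivity
  have hC : 0 ≤ S * ((j : ℝ) + 1) := by positivity
  refine ⟨S ^ 2, by positivity, ?_, ?_⟩
  · have hS1 : S ≤ 1 := by nlinarith
    have : S ^ 2 * ((j : ℝ) + 1) ≤ S * (j + 1) := by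
      have : S ^ 2 ≤ S := by nlinarith
      gcongr
    linarith
  · rw [Real.sqrt_sq hS0.le]
    linarith

/-- Pure time derivatives grow at most like `B ^ m m!`. -/
theorem exists_derivBound_time (n : ℕ) : ∃ B : ℝ, 1 ≤ B ∧
    ∀ {a b : ℝ} {U : Fin n → SmoothPer n a b} {Q : SmoothPer n a b}, IsNS U Q →
    ∀ {c e M : ℝ}, a < c → e < b → 0 < M → (e - c) * M ^ 2 ≤ 1 →
      (∀ s ∈ Icc c e, ∀ i x, |U i (s, x)| ≤ M) → ∀ m, DerivBound U c e M B 0 m 1 := by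
  obtain ⟨ε, hε, hε1, hε2⟩ := exists_step_fraction n 0
  set B := max 1 (1040 * heatConst n / ε)
  have hB1 : 1 ≤ B := le_max_left _ _
  have hBK : 1040 * heatConst n ≤ ε * B := by
    rw [← div_le_iff₀' hε]; exact le_max_right _ _
  have hB0 : 0 < B := by linarith
  refine ⟨B, hB1, ?_⟩
  intro a b U Q h c e M hc he hM hce hU m
  induction m using Nat.strong_induction_on with
  | _ m ih =>
    rcases m with _ | m
    · intro s hs I hI i x
      obtain rfl : I = [] := List.length_eq_zero_iff.1 hI
      simpa [weight] using hU s hs i x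
    · exact of_forall_improve (fun Λ Λ' hΛ => DerivBound.mono hM.le hB0.le hΛ)
        (DerivBound.of_forall_add hM.le hB0.le) (DerivBound.exists_const hc he hM hB0)
        fun Λ hΛ hP => h.improve_time hc he hM hce hε (by simpa using hε1)
          (by simpa using hε2) hB0 hBK hΛ (fun k hk => ih k (by omega)) hP

/-- The growth rate `B` in time is the same for all orders of differentiation in space. This is
what makes the Taylor series in time converge, together with all their space derivatives, on one
and the same interval. -/
theorem exists_derivBound (n : ℕ) : ∃ B : ℝ, 1 ≤ B ∧ ∀ j : ℕ, ∃ A : ℝ, 1 ≤ A ∧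
    ∀ {a b : ℝ} {U : Fin n → SmoothPer n a b} {Q : SmoothPer n a b}, IsNS U Q →
    ∀ {c e M : ℝ}, a < c → e < b → 0 < M → (e - c) * M ^ 2 ≤ 1 →
      (∀ s ∈ Icc c e, ∀ i x, |U i (s, x)| ≤ M) → ∀ l ≤ j, ∀ m, DerivBound U c e M B l m A := by
  have hK := heatConst_nonneg (n := n)
  obtain ⟨B, hB1, hBt⟩ := exists_derivBound_time n
  have hB0 : 0 < B := by linarith
  refine ⟨B, hB1, fun j => ?_⟩
  induction j with
  | zero =>
    refine ⟨1, le_rfl, ?_⟩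
    intro a b U Q h c e M hc he hM hce hU l hl m
    obtain rfl : l = 0 := by omega
    exact hBt h hc he hM hce hU m
  | succ j ihj =>
    obtain ⟨A, hA1, hA⟩ := ihj
    obtain ⟨ε, hε0, hε1, hε2⟩ := exists_step_fraction n (j + 1)
    set A' := 4 * heatConst n * A / √ε + A ^ 2 with hA'
    have hAA' : A ≤ A' := by
      have : 0 ≤ 4 * heatConst n * A / √ε := by positivity
      nlinarith
    refine ⟨A', hA1.trans hAA', ?_⟩
    intro a b U Q h c e M hc he hM hce hU l hl m
    have hlow := hA h hc he hM hce hU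
    rcases Nat.lt_or_ge l (j + 1) with h1 | h1
    · exact (hlow l (by omega) m).mono hM.le hB0.le hAA'
    obtain rfl : l = j + 1 := by omega
    induction m using Nat.strong_induction_on with
    | _ m ih =>
      refine of_forall_improve (fun Λ Λ' hΛ => DerivBound.mono hM.le hB0.le hΛ)
          (DerivBound.of_forall_add hM.le hB0.le) (DerivBound.exists_const hc he hM hB0)
          fun Λ hΛ hP => ?_
      refine (h.improve_space hc he hM hce hB0.le hε0 (by push_cast at hε1; exact hε1) hε2 hA1 hΛ
        (hBt h hc he hM hce hU) hlow fun k hk => ?_).mono hM.le hB0.le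
          (le_of_eq (by rw [hA']; ring))
      rcases hk.eq_or_lt with rfl | hk
      · exact hP
      · exact (ih k hk).mono hM.le hB0.le hΛ

/-- A priori estimate for all derivatives of a bounded solution on `(a, b)`. -/
theorem exists_deriv_estimate (n : ℕ) : ∃ B : ℝ, 1 ≤ B ∧ ∃ A : ℕ → ℝ, (∀ j, 0 ≤ A j) ∧
    ∀ {a b : ℝ} {U : Fin n → SmoothPer n a b} {Q : SmoothPer n a b}, IsNS U Q →
    ∀ {M : ℝ}, 0 < M → (b - a) * M ^ 2 ≤ 1 → (∀ s ∈ Ioo a b, ∀ i x, |U i (s, x)| ≤ M) →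
    ∀ s ∈ Ioo a b, ∀ m I i x, √(s - a) ^ I.length * (s - a) ^ m * |dtx m I (U i) (s, x)| ≤
      A I.length * M * B ^ m * (m.factorial * ((m : ℝ) + 1) ^ I.length) := by
  obtain ⟨B, hB1, hB⟩ := exists_derivBound n
  choose A hA1 hA using hB
  refine ⟨B, hB1, A, fun j => zero_le_one.trans (hA1 j), ?_⟩
  intro a b U Q h M hM hba hU s hs m I i x
  have hlim : Tendsto (fun c => √(s - c) ^ I.length * (s - c) ^ m * |dtx m I (U i) (s, x)|)
      (𝓝[>] a) (𝓝 (√(s - a) ^ I.length * (s - a) ^ m * |dtx m I (U i) (s, x)|)) := by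
    have : Continuous fun c => √(s - c) ^ I.length * (s - c) ^ m * |dtx m I (U i) (s, x)| := by
      fun_prop
    exact this.continuousAt.tendsto.mono_left nhdsWithin_le_nhds
  refine le_of_tendsto hlim ?_
  filter_upwards [Ioo_mem_nhdsGT hs.1] with c hc
  have hw : weight m ≤ m.factorial := div_le_self (Nat.cast_nonneg _) (by
    have := Nat.cast_nonneg (α := ℝ) m
    nlinarith)
  have h1 := hA I.length h (c := c) (e := s) hc.1 hs.2 hM
    (le_trans (by have := hc.1; have := hs.2; gcongr) hba)
    (fun r hr => hU r ⟨hc.1.trans_le hr.1, hr.2.trans_lt hs.2⟩) _ le_rfl m s ⟨hc.2.le, le_rfl⟩ I rfl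
    i x
  refine h1.trans ?_
  have := zero_le_one.trans (hA1 I.length)
  have hB0 : 0 ≤ B := by linarith
  calc _ ≤ A I.length * (M * B ^ m * (m.factorial * ((m : ℝ) + 1) ^ I.length)) := by gcongr
    _ = _ := by ring

end NavierStokes

end

/-! ### The doubling time of the maximum norm -/

noncomputable section

namespace NavierStokes

open Set Filter Topology SmoothPer

variable {n : ℕ}

/-- Strict bounds that are uniform in space persist for nearby times. -/
theorem SmoothPer.eventually_forall_abs_lt {a b : ℝ} (F : SmoothPer n a b) {t C : ℝ}
    (ht : t ∈ Ioo a b) (h : ∀ x, |F (t, x)| < C) : ∀ᶠ s in 𝓝 t, ∀ x, |F (s, x)| < C := by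
  have hK := isCompact_closedBall (0 : Rn n) (n * (2 * Real.pi))
  have h1 := hK.eventually_forall_of_forall_eventually (x₀ := t)
    (P := fun s x => |F (s, x)| < C) fun x _ =>
      ((F.continuousAt (mem_strip.2 ht)).abs.eventually_lt continuousAt_const (h x))
  filter_upwards [h1, Ioo_mem_nhds ht.1 ht.2] with s hs hs' x
  obtain ⟨y, hy, hyx⟩ := exists_bounded_representative x
  rw [← hyx _ (F.periodic hs')]
  exact hs y (by simpa using hy)

/-- The maximum norm of the velocity at most doubles on a time interval whose length is a small
multiple of the inverse square of its initial value. -/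
theorem exists_bootstrap_const (n : ℕ) : ∃ c : ℝ, 0 < c ∧
    ∀ {T : ℝ} {U : Fin n → SmoothPer n 0 T} {Q : SmoothPer n 0 T}, IsNS U Q →
    ∀ {F δ : ℝ}, 0 < F → T * F ^ 2 ≤ c → 0 < δ → (∀ s ∈ Ioc 0 δ, ∀ i x, |U i (s, x)| ≤ F) →
    ∀ s ∈ Ioo 0 T, ∀ i x, |U i (s, x)| ≤ 2 * F := by
  have hK := heatConst_nonneg (n := n)
  -- with this constant, Duhamel's principle bounds the nonlinear contribution by `F / 2`
  refine ⟨1 / (2 * (16 * heatConst n + 1) ^ 2), by positivity, ?_⟩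
  intro T U Q h F δ hF hT hδ hU t₁ ht₁
  by_contra hbad
  rcases le_or_gt t₁ δ with h1 | h1
  · exact hbad fun i x => (hU t₁ ⟨ht₁.1, h1⟩ i x).trans (by linarith)
  -- the bound holds strictly at the first time `τ` after which it fails, a contradiction
  set S := {s | s ∈ Icc δ t₁ ∧ ¬ ∀ i x, |U i (s, x)| ≤ 2 * F} with hS
  have hne : S.Nonempty := ⟨t₁, ⟨h1.le, le_rfl⟩, hbad⟩
  have hbdd : BddBelow S := ⟨δ, fun s hs => hs.1.1⟩
  set τ := sInf S with hτ
  have hδτ : δ ≤ τ := le_csInf hne fun s hs => hs.1.1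
  have hτt : τ ≤ t₁ := csInf_le hbdd ⟨⟨h1.le, le_rfl⟩, hbad⟩
  have hτT : τ < T := hτt.trans_lt ht₁.2
  have hgood : ∀ s ∈ Ico δ τ, ∀ i x, |U i (s, x)| ≤ 2 * F := by
    intro s hs
    by_contra hs'
    exact absurd (csInf_le hbdd ⟨⟨hs.1, hs.2.le.trans hτt⟩, hs'⟩) (not_le.2 hs.2)
  have hτU : ∀ i x, |U i (τ, x)| < 2 * F := by
    intro i x
    have h2 := h.abs_sub_gop_le 0 [] i (s₀ := δ) (t := τ) (G := 4 * F ^ 2) hδ hδτ hτT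
      (by positivity)
      (fun s hs j k y => by
        rw [dtx_zero_nil, coe_mul, abs_mul]
        calc _ ≤ (2 * F) * (2 * F) := by
              gcongr
              · exact hgood s hs j y
              · exact hgood s hs k y
          _ = _ := by ring) x
    simp only [dtx_zero_nil] at h2
    have h3 := abs_gop_le (unitPoly n) √(2 * (τ - δ)) (U i) (hU δ ⟨hδ, le_rfl⟩ i) x
    rw [mass_unitPoly, one_mul] at h3
    have h4 : F * √(2 * (τ - δ)) ≤ 1 / (16 * heatConst n + 1) := by
      rw [← Real.sqrt_sq hF.le, ← Real.sqrt_mul (by positivity)]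
      refine Real.sqrt_le_left (by positivity) |>.2 ?_
      have h5 : F ^ 2 * (2 * (τ - δ)) ≤ 2 * (T * F ^ 2) := by nlinarith [sq_nonneg F]
      refine h5.trans ((mul_le_mul_of_nonneg_left hT zero_le_two).trans (le_of_eq ?_))
      field_simp
    have h6 : 2 * heatConst n * (4 * F ^ 2) * √(2 * (τ - δ)) ≤ F / 2 := by
      calc _ = 8 * heatConst n * F * (F * √(2 * (τ - δ))) := by ring
        _ ≤ 8 * heatConst n * F * (1 / (16 * heatConst n + 1)) := by gcongr
        _ = F / 2 * (16 * heatConst n / (16 * heatConst n + 1)) := by ring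
        _ ≤ F / 2 * 1 := by
            gcongr
            rw [div_le_one (by positivity)]
            linarith
        _ = _ := by ring
    have h7 := abs_sub_abs_le_abs_sub (U i (τ, x)) (gop (unitPoly n) √(2 * (τ - δ)) (U i) δ x)
    linarith
  have hev : ∀ᶠ s in 𝓝 τ, ∀ i x, |U i (s, x)| < 2 * F :=
    eventually_all.2 fun i => (U i).eventually_forall_abs_lt ⟨hδ.trans_le hδτ, hτT⟩ (hτU i)
  obtain ⟨r, hr, hr'⟩ := mem_nhdsGE_iff_exists_Ico_subset.1 (mem_nhdsWithin_of_mem_nhds hev :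
    {s | ∀ i x, |U i (s, x)| < 2 * F} ∈ 𝓝[≥] τ)
  obtain ⟨s, hs, hsr⟩ := exists_lt_of_csInf_lt hne (show sInf S < r from hr)
  exact hs.2 fun i x => (hr' ⟨csInf_le hbdd hs, hsr⟩ i x).le

end NavierStokes

end

/-! ### Functions with a convergent Taylor series in time -/

noncomputable section

namespace NavierStokes

open Set Filter Topology SmoothPer
open Finset.HasAntidiagonal (antidiagonal)

variable {n : ℕ} {a b : ℝ}

/-- All derivatives in time grow at most like `R ^ m m!`, up to polynomial factors, on `[t₀, b)`,
and the same holds for all space derivatives with the same rate `R`; the constant and the degree of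
the polynomial may depend on the order in space. -/
def Controlled (t₀ R : ℝ) (W : SmoothPer n a b) : Prop :=
  ∀ L : ℕ, ∃ (A : ℝ) (j : ℕ), 0 ≤ A ∧ ∀ I : List (Fin n), I.length ≤ L →
    ∀ m, ∀ s ∈ Ico t₀ b, ∀ x, |dtx m I W (s, x)| ≤ A * R ^ m * (m.factorial * ((m : ℝ) + 1) ^ j)

namespace Controlled

variable {t₀ R : ℝ} {F G W : SmoothPer n a b}

theorem add (hR : 0 ≤ R) (hF : Controlled t₀ R F) (hG : Controlled t₀ R G) :
    Controlled t₀ R (F + G) := by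
  intro L
  obtain ⟨A, j, hA, h⟩ := hF L
  obtain ⟨A', j', hA', h'⟩ := hG L
  refine ⟨A + A', j + j', by positivity, fun I hI m s hs x => ?_⟩
  rw [map_add, coe_add]
  have h1 : (1 : ℝ) ≤ (m : ℝ) + 1 := by linarith [Nat.cast_nonneg (α := ℝ) m]
  have e1 : ((m : ℝ) + 1) ^ j ≤ ((m : ℝ) + 1) ^ (j + j') := pow_le_pow_right₀ h1 (by omega)
  have e2 : ((m : ℝ) + 1) ^ j' ≤ ((m : ℝ) + 1) ^ (j + j') := pow_le_pow_right₀ h1 (by omega)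
  rw [add_mul, add_mul]
  refine (abs_add_le _ _).trans (add_le_add ((h I hI m s hs x).trans ?_)
    ((h' I hI m s hs x).trans ?_)) <;> gcongr

theorem neg (hF : Controlled t₀ R F) : Controlled t₀ R (-F) := by
  intro L
  obtain ⟨A, j, hA, h⟩ := hF L
  refine ⟨A, j, hA, fun I hI m s hs x => ?_⟩
  rw [map_neg, coe_neg, abs_neg]
  exact h I hI m s hs x

theorem sub (hR : 0 ≤ R) (hF : Controlled t₀ R F) (hG : Controlled t₀ R G) :
    Controlled t₀ R (F - G) := by
  rw [sub_eq_add_neg]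
  exact hF.add hR hG.neg

theorem zero : Controlled t₀ R (0 : SmoothPer n a b) :=
  fun _ => ⟨0, 0, le_rfl, fun I _ m s _ x => by simp⟩

theorem sum (hR : 0 ≤ R) {ι : Type*} (S : Finset ι) (H : ι → SmoothPer n a b)
    (h : ∀ i, Controlled t₀ R (H i)) : Controlled t₀ R (∑ i ∈ S, H i) := by
  classical
  induction S using Finset.induction_on with
  | empty => simpa using zero
  | insert i S hi ih => rw [Finset.sum_insert hi]; exact (h i).add hR ih

theorem dx (i : Fin n) (hF : Controlled t₀ R F) : Controlled t₀ R (dx i F) := by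
  intro L
  obtain ⟨A, j, hA, h⟩ := hF (L + 1)
  refine ⟨A, j, hA, fun I hI m s hs x => ?_⟩
  rw [← dtx_cons']
  exact h (i :: I) (by simpa using hI) m s hs x

theorem dt (hR : 0 ≤ R) (hF : Controlled t₀ R F) : Controlled t₀ R (dt F) := by
  intro L
  obtain ⟨A, j, hA, h⟩ := hF L
  refine ⟨A * R * 2 ^ j, j + 1, by positivity, fun I hI m s hs x => ?_⟩
  rw [← dtx_succ']
  refine (h I hI (m + 1) s hs x).trans ?_
  have e : (((m + 1 : ℕ) : ℝ) + 1) ^ j ≤ (2 * ((m : ℝ) + 1)) ^ j := by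
    gcongr
    push_cast
    linarith [Nat.cast_nonneg (α := ℝ) m]
  rw [Nat.factorial_succ]
  calc _ ≤ A * R ^ (m + 1) * (((m + 1) * m.factorial : ℕ) * (2 * ((m : ℝ) + 1)) ^ j) := by gcongr
    _ = _ := by rw [mul_pow]; push_cast; ring

theorem mul (hR : 0 ≤ R) (hF : Controlled t₀ R F) (hG : Controlled t₀ R G) :
    Controlled t₀ R (F * G) := by
  intro L
  obtain ⟨A, j, hA, h⟩ := hF L
  obtain ⟨A', j', hA', h'⟩ := hG L
  refine ⟨A * A' * 2 ^ L, j + j' + 1, by positivity, fun I hI m s hs x => ?_⟩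
  have h1 : (1 : ℝ) ≤ (m : ℝ) + 1 := by linarith [Nat.cast_nonneg (α := ℝ) m]
  have key := abs_dtx_mul_le (s, x) m I F G
    (fun k k' _ _ => A * A' * R ^ m * (k.factorial * k'.factorial * ((m : ℝ) + 1) ^ (j + j')))
    (fun k k' J J' hk hJ => by
      have hk1 : ((k : ℝ) + 1) ≤ m + 1 := by
        rw [← hk]; push_cast; linarith [Nat.cast_nonneg (α := ℝ) k']
      have hk2 : ((k' : ℝ) + 1) ≤ m + 1 := by
        rw [← hk]; push_cast; linarith [Nat.cast_nonneg (α := ℝ) k]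
      calc _ ≤ (A * R ^ k * (k.factorial * ((k : ℝ) + 1) ^ j)) *
            (A' * R ^ k' * (k'.factorial * ((k' : ℝ) + 1) ^ j')) :=
            mul_le_mul (h J (by omega) k s hs x) (h' J' (by omega) k' s hs x) (abs_nonneg _)
              (by positivity)
        _ ≤ (A * R ^ k * (k.factorial * ((m : ℝ) + 1) ^ j)) *
            (A' * R ^ k' * (k'.factorial * ((m : ℝ) + 1) ^ j')) := by gcongr
        _ = _ := by rw [← hk, pow_add, pow_add]; ring)
  refine key.trans ?_
  have hI2 : ∑ r ∈ antidiagonal I.length, (I.length.choose r.1 : ℝ) = 2 ^ I.length := by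
    rw [Finset.Nat.sum_antidiagonal_eq_sum_range_succ_mk]
    exact_mod_cast Nat.sum_range_choose I.length
  have hterm : ∀ p ∈ antidiagonal m, (m.choose p.1 : ℝ) * ∑ r ∈ antidiagonal I.length,
      (I.length.choose r.1 : ℝ) *
        (A * A' * R ^ m * (p.1.factorial * p.2.factorial * ((m : ℝ) + 1) ^ (j + j'))) =
      2 ^ I.length * (A * A' * R ^ m * (m.factorial * ((m : ℝ) + 1) ^ (j + j'))) := by
    intro p hp
    have hf : ((m.choose p.1 * p.1.factorial * p.2.factorial : ℕ) : ℝ) = m.factorial := by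
      obtain rfl := (Finset.HasAntidiagonal.mem_antidiagonal.1 hp).symm
      rw [← Nat.add_choose_mul_factorial_mul_factorial p.1 p.2, Nat.choose_symm_add]
    push_cast at hf
    rw [← Finset.sum_mul, hI2, ← hf]
    ring
  rw [Finset.sum_congr rfl hterm, Finset.sum_const, Finset.Nat.card_antidiagonal, nsmul_eq_mul]
  have h2 : (2 : ℝ) ^ I.length ≤ 2 ^ L := pow_le_pow_right₀ one_le_two hI
  calc _ ≤ ((m + 1 : ℕ) : ℝ) *
        (2 ^ L * (A * A' * R ^ m * (m.factorial * ((m : ℝ) + 1) ^ (j + j')))) := by gcongr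
    _ = _ := by rw [pow_succ]; push_cast; ring

end Controlled

theorem summable_succ_pow_mul_geometric (j : ℕ) {q : ℝ} (hq : 0 ≤ q) (hq1 : q < 1) :
    Summable fun m : ℕ => ((m : ℝ) + 1) ^ j * q ^ m := by
  rcases hq.eq_or_lt with rfl | hq0
  · refine summable_of_ne_finset_zero (s := {0}) fun m hm => ?_
    rw [zero_pow (by simpa using hm), mul_zero]
  have h := summable_pow_mul_geometric_of_norm_lt_one (R := ℝ) j (r := q)
    (by rwa [Real.norm_of_nonneg hq])
  have h2 := ((summable_nat_add_iff 1).2 h).mul_left q⁻¹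
  refine h2.congr fun m => ?_
  push_cast
  rw [pow_succ]
  field_simp

/-- The Taylor series in time of `W` about `t₀`. The sum is meaningful only where the series
converges; for controlled functions with rate `R` this is so for `R |t - t₀| < 1`. -/
def taylorExt (t₀ : ℝ) (W : SmoothPer n a b) (q : ℝ × Rn n) : ℝ :=
  ∑' m : ℕ, (q.1 - t₀) ^ m / m.factorial * dtx m [] W (t₀, q.2)

namespace Controlled

variable {t₀ R ρ : ℝ} {F G W : SmoothPer n a b}

/-- The terms of the Taylor series have a summable majorant that does not depend on the point. -/
theorem exists_summable (hW : Controlled t₀ R W) (ht₀ : t₀ ∈ Ioo a b) (hR : 0 ≤ R) (hρ : 0 ≤ ρ)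
    (hRρ : R * ρ < 1) :
    ∃ g : ℕ → ℝ, Summable g ∧ ∀ m (q : ℝ × Rn n), |q.1 - t₀| ≤ ρ →
      |(q.1 - t₀) ^ m / m.factorial * dtx m [] W (t₀, q.2)| ≤ g m := by
  obtain ⟨A, j, hA, h⟩ := hW 0
  refine ⟨fun m => A * (((m : ℝ) + 1) ^ j * (R * ρ) ^ m),
    (summable_succ_pow_mul_geometric j (by positivity) hRρ).mul_left A, fun m q hq => ?_⟩
  have hf : (0 : ℝ) < m.factorial := by exact_mod_cast m.factorial_pos
  rw [abs_mul, abs_div, abs_pow, Nat.abs_cast]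
  calc _ ≤ ρ ^ m / m.factorial * (A * R ^ m * (m.factorial * ((m : ℝ) + 1) ^ j)) := by
        gcongr
        exact h [] le_rfl m t₀ ⟨le_rfl, ht₀.2⟩ q.2
    _ = _ := by simp only [mul_pow]; field_simp

theorem summable_norm (hW : Controlled t₀ R W) (ht₀ : t₀ ∈ Ioo a b) (hR : 0 ≤ R) (hρ : 0 ≤ ρ)
    (hRρ : R * ρ < 1) (q : ℝ × Rn n) (hq : |q.1 - t₀| ≤ ρ) :
    Summable fun m : ℕ => ‖(q.1 - t₀) ^ m / m.factorial * dtx m [] W (t₀, q.2)‖ := by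
  obtain ⟨g, hg, h⟩ := hW.exists_summable ht₀ hR hρ hRρ
  exact hg.of_nonneg_of_le (fun m => norm_nonneg _) fun m => h m q hq

theorem taylorExt_add (hF : Controlled t₀ R F) (hG : Controlled t₀ R G) (ht₀ : t₀ ∈ Ioo a b)
    (hR : 0 ≤ R) (hρ : 0 ≤ ρ) (hRρ : R * ρ < 1) (q : ℝ × Rn n) (hq : |q.1 - t₀| ≤ ρ) :
    taylorExt t₀ (F + G) q = taylorExt t₀ F q + taylorExt t₀ G q := by
  unfold taylorExt
  rw [← (hF.summable_norm ht₀ hR hρ hRρ q hq).of_norm.tsum_add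
    (hG.summable_norm ht₀ hR hρ hRρ q hq).of_norm]
  simp only [map_add, coe_add, mul_add]

theorem _root_.NavierStokes.taylorExt_neg (t₀ : ℝ) (F : SmoothPer n a b) (q : ℝ × Rn n) :
    taylorExt t₀ (-F) q = -taylorExt t₀ F q := by
  simp [taylorExt, tsum_neg]

theorem _root_.NavierStokes.taylorExt_zero (t₀ : ℝ) (q : ℝ × Rn n) :
    taylorExt t₀ (0 : SmoothPer n a b) q = 0 := by
  simp [taylorExt]

theorem taylorExt_sub (hF : Controlled t₀ R F) (hG : Controlled t₀ R G) (ht₀ : t₀ ∈ Ioo a b)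
    (hR : 0 ≤ R) (hρ : 0 ≤ ρ) (hRρ : R * ρ < 1) (q : ℝ × Rn n) (hq : |q.1 - t₀| ≤ ρ) :
    taylorExt t₀ (F - G) q = taylorExt t₀ F q - taylorExt t₀ G q := by
  rw [sub_eq_add_neg, hF.taylorExt_add hG.neg ht₀ hR hρ hRρ q hq, taylorExt_neg, sub_eq_add_neg]

theorem taylorExt_sum {ι : Type*} (S : Finset ι) {H : ι → SmoothPer n a b}
    (h : ∀ i, Controlled t₀ R (H i)) (ht₀ : t₀ ∈ Ioo a b)
    (hR : 0 ≤ R) (hρ : 0 ≤ ρ) (hRρ : R * ρ < 1) (q : ℝ × Rn n) (hq : |q.1 - t₀| ≤ ρ) :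
    taylorExt t₀ (∑ i ∈ S, H i) q = ∑ i ∈ S, taylorExt t₀ (H i) q := by
  classical
  induction S using Finset.induction_on with
  | empty => simp [taylorExt_zero]
  | insert i S hi ih =>
    rw [Finset.sum_insert hi, Finset.sum_insert hi, ← ih]
    exact (h i).taylorExt_add (Controlled.sum hR S H h) ht₀ hR hρ hRρ q hq

/-- The Taylor series in time of a product is the Cauchy product of the Taylor series. -/
theorem taylorExt_mul (hF : Controlled t₀ R F) (hG : Controlled t₀ R G) (ht₀ : t₀ ∈ Ioo a b)
    (hR : 0 ≤ R) (hρ : 0 ≤ ρ) (hRρ : R * ρ < 1) (q : ℝ × Rn n) (hq : |q.1 - t₀| ≤ ρ) :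
    taylorExt t₀ (F * G) q = taylorExt t₀ F q * taylorExt t₀ G q := by
  unfold taylorExt
  rw [tsum_mul_tsum_eq_tsum_sum_antidiagonal_of_summable_norm
    (hF.summable_norm ht₀ hR hρ hRρ q hq) (hG.summable_norm ht₀ hR hρ hRρ q hq)]
  refine tsum_congr fun m => ?_
  rw [dtx_nil_mul, Finset.mul_sum]
  refine Finset.sum_congr rfl fun p hp => ?_
  have hf : ((m.choose p.1 * p.1.factorial * p.2.factorial : ℕ) : ℝ) = m.factorial := by
    obtain rfl := (Finset.HasAntidiagonal.mem_antidiagonal.1 hp).symm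
    rw [← Nat.add_choose_mul_factorial_mul_factorial p.1 p.2, Nat.choose_symm_add]
  push_cast at hf
  have h1 : (0 : ℝ) < p.1.factorial := by exact_mod_cast p.1.factorial_pos
  have h2 : (0 : ℝ) < p.2.factorial := by exact_mod_cast p.2.factorial_pos
  have h3 : (0 : ℝ) < m.choose p.1 := by
    have := Nat.choose_pos (Finset.HasAntidiagonal.antidiagonal.fst_le hp)
    exact_mod_cast this
  rw [← hf, ← Finset.HasAntidiagonal.mem_antidiagonal.1 hp, pow_add]
  rw [Finset.HasAntidiagonal.mem_antidiagonal.1 hp]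
  field_simp

end Controlled

end NavierStokes

end

/-! ### Termwise differentiation and convergence of the Taylor series -/

noncomputable section

namespace NavierStokes

open Set Filter Topology SmoothPer

variable {n : ℕ} {a b : ℝ}

/-- The differential form of a scalar function on space-time with time derivative `τ` and space
derivatives `ξ i`. -/
def gradForm (τ : ℝ) (ξ : Fin n → ℝ) : ℝ × Rn n →L[ℝ] ℝ :=
  τ • ContinuousLinearMap.fst ℝ ℝ (Rn n) +
    ∑ i, ξ i • (EuclideanSpace.proj i : Rn n →L[ℝ] ℝ).comp (ContinuousLinearMap.snd ℝ ℝ (Rn n))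

theorem gradForm_apply (τ : ℝ) (ξ : Fin n → ℝ) (v : ℝ × Rn n) :
    gradForm τ ξ v = τ * v.1 + ∑ i, ξ i * v.2 i := by
  simp [gradForm]

theorem norm_gradForm_le (τ : ℝ) (ξ : Fin n → ℝ) : ‖gradForm τ ξ‖ ≤ |τ| + ∑ i, |ξ i| := by
  refine ContinuousLinearMap.opNorm_le_bound _ (by positivity) fun v => ?_
  rw [gradForm_apply, add_mul, Finset.sum_mul]
  refine (abs_add_le _ _).trans (add_le_add ?_ ((Finset.abs_sum_le_sum_abs _ _).trans
    (Finset.sum_le_sum fun i _ => ?_)))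
  · rw [abs_mul]
    gcongr
    exact norm_fst_le v
  · rw [abs_mul]
    gcongr
    exact (PiLp.norm_apply_le v.2 i).trans (norm_snd_le v)

theorem hasSum_gradForm {f : ℕ → ℝ} {g : ℕ → Fin n → ℝ} {τ : ℝ} {ξ : Fin n → ℝ} (hf : HasSum f τ)
    (hg : ∀ i, HasSum (fun m => g m i) (ξ i)) :
    HasSum (fun m => gradForm (f m) (g m)) (gradForm τ ξ) := by
  unfold gradForm
  exact (hf.smul_const _).add (hasSum_sum fun i _ => (hg i).smul_const _)

theorem SmoothPer.hasFDerivAt_slice_gradForm (F : SmoothPer n a b) {s : ℝ} (hs : s ∈ Ioo a b)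
    (q : ℝ × Rn n) :
    HasFDerivAt (fun q : ℝ × Rn n => F (s, q.2)) (gradForm 0 fun i => dx i F (s, q.2)) q := by
  have h := (F.hasFDerivAt_slice hs q.2).comp q (hasFDerivAt_snd (𝕜 := ℝ) (p := q))
  have e : (gradForm 0 fun i => dx i F (s, q.2)) =
      ((fderiv ℝ F (s, q.2)).comp (.inr ℝ ℝ (Rn n))).comp (.snd ℝ ℝ (Rn n)) := by
    refine ContinuousLinearMap.ext fun v => ?_
    rw [gradForm_apply, zero_mul, zero_add]
    refine Eq.trans ?_ (F.fderiv_inr_eq_sum hs q.2 v.2).symm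
    exact Finset.sum_congr rfl fun i _ => mul_comm _ _
  rw [e]
  exact h

namespace Controlled

variable {t₀ R ρ : ℝ} {F G W : SmoothPer n a b}

/-- The Taylor series may be differentiated term by term. -/
theorem hasFDerivAt_taylorExt (hW : Controlled t₀ R W) (ht₀ : t₀ ∈ Ioo a b) (hR : 0 ≤ R)
    (hρ : 0 < ρ) (hRρ : R * ρ < 1) {q : ℝ × Rn n} (hq : q ∈ strip n (t₀ - ρ) (t₀ + ρ)) :
    HasFDerivAt (taylorExt t₀ W)
      (gradForm (taylorExt t₀ (SmoothPer.dt W) q)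
        fun i => taylorExt t₀ (SmoothPer.dx i W) q) q := by
  obtain ⟨g, hg, hgb⟩ := (hW.dt hR).exists_summable ht₀ hR hρ.le hRρ
  choose g' hg' hgb' using fun i => (hW.dx i).exists_summable ht₀ hR hρ.le hRρ
  have habs : ∀ q ∈ strip n (t₀ - ρ) (t₀ + ρ), |q.1 - t₀| ≤ ρ := by
    intro q hq
    have : q.1 ∈ Ioo (t₀ - ρ) (t₀ + ρ) := by simpa [strip] using hq
    rw [abs_le]
    constructor <;> linarith [this.1, this.2]
  -- the time derivative of the `m`-th term is the term of index `m - 1` in the series of `dt W`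
  let f : ℕ → (ℝ × Rn n) → ℝ := fun m q =>
    (m * (q.1 - t₀) ^ (m - 1)) / m.factorial * dtx m [] W (t₀, q.2)
  have hf_succ : ∀ m q, f (m + 1) q =
      (q.1 - t₀) ^ m / m.factorial * dtx m [] (SmoothPer.dt W) (t₀, q.2) := by
    intro m q
    have hm : (0 : ℝ) < m.factorial := by exact_mod_cast m.factorial_pos
    simp only [f, Nat.factorial_succ, dtx_succ', Nat.add_sub_cancel]
    push_cast
    field_simp
  have hf_zero : ∀ q, f 0 q = 0 := fun q => by simp [f]
  let g₀ : ℕ → ℝ := fun m => match m with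
    | 0 => 0
    | m + 1 => g m
  have hg₀ : Summable g₀ := (summable_nat_add_iff 1).1 (by simpa [g₀] using hg)
  have hterm : ∀ (m : ℕ) (q : ℝ × Rn n), HasFDerivAt
      (fun q : ℝ × Rn n => (q.1 - t₀) ^ m / m.factorial * dtx m [] W (t₀, q.2))
      (gradForm (f m q) fun i =>
        (q.1 - t₀) ^ m / m.factorial * dtx m [] (SmoothPer.dx i W) (t₀, q.2)) q := by
    intro m q
    have h1 : HasFDerivAt (fun q : ℝ × Rn n => (q.1 - t₀) ^ m / m.factorial)
        (gradForm ((m * (q.1 - t₀) ^ (m - 1)) / m.factorial) fun _ => 0) q := by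
      have h2 : HasDerivAt (fun s : ℝ => (s - t₀) ^ m / m.factorial)
          ((m * (q.1 - t₀) ^ (m - 1)) / m.factorial) q.1 := by
        simpa using (((hasDerivAt_id q.1).sub_const t₀).pow m).div_const (m.factorial : ℝ)
      have h3 := h2.comp_hasFDerivAt q (hasFDerivAt_fst (𝕜 := ℝ) (p := q))
      convert! h3 using 1
      ext v <;> simp [gradForm_apply]
    have h2 := h1.mul ((dtx m [] W).hasFDerivAt_slice_gradForm ht₀ q)
    convert! h2 using 1
    ext v
    · simp [gradForm_apply, f, mul_comm]
    · simp [gradForm_apply, dtx_dx, Finset.mul_sum, mul_assoc]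
  have hpre : IsPreconnected (strip n (t₀ - ρ) (t₀ + ρ)) :=
    ((convex_Ioo _ _).prod convex_univ).isPreconnected
  have key := hasFDerivAt_tsum_of_isPreconnected (u := fun m => g₀ m + ∑ i, g' i m)
    (hg₀.add (summable_sum fun i _ => hg' i)) isOpen_strip hpre (fun m q _ => hterm m q)
    (fun m q hq => by
      refine (norm_gradForm_le _ _).trans (add_le_add ?_
        (Finset.sum_le_sum fun i _ => hgb' i m q (habs q hq)))
      cases m with
      | zero => simp [hf_zero, g₀]
      | succ m => rw [hf_succ]; exact hgb m q (habs q hq)) hq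
    (hW.summable_norm ht₀ hR hρ.le hRρ q (habs q hq)).of_norm hq
  convert! key using 1
  refine (HasSum.tsum_eq (hasSum_gradForm ?_ fun i => ?_)).symm
  · have := ((hW.dt hR).summable_norm ht₀ hR hρ.le hRρ q (habs q hq)).of_norm.hasSum
    rw [← hasSum_nat_add_iff' 1]
    simpa [hf_zero, hf_succ, taylorExt] using this
  · exact ((hW.dx i).summable_norm ht₀ hR hρ.le hRρ q (habs q hq)).of_norm.hasSum

theorem contDiffOn_taylorExt (hW : Controlled t₀ R W) (ht₀ : t₀ ∈ Ioo a b) (hR : 0 ≤ R)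
    (hρ : 0 < ρ) (hRρ : R * ρ < 1) :
    ContDiffOn ℝ ∞ (taylorExt t₀ W) (strip n (t₀ - ρ) (t₀ + ρ)) := by
  rw [contDiffOn_infty]
  intro k
  induction k generalizing W with
  | zero =>
    exact contDiffOn_zero.2 fun q hq =>
      (hW.hasFDerivAt_taylorExt ht₀ hR hρ hRρ hq).continuousAt.continuousWithinAt
  | succ k ih =>
    push_cast
    rw [contDiffOn_succ_iff_fderiv_of_isOpen isOpen_strip]
    refine ⟨fun q hq => (hW.hasFDerivAt_taylorExt ht₀ hR hρ hRρ
      hq).differentiableAt.differentiableWithinAt, by simp, ?_⟩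
    have : ContDiffOn ℝ k (fun q => gradForm (taylorExt t₀ (SmoothPer.dt W) q)
        fun i => taylorExt t₀ (SmoothPer.dx i W) q) (strip n (t₀ - ρ) (t₀ + ρ)) := by
      unfold gradForm
      exact ((ih (hW.dt hR)).smul contDiffOn_const).add
        (ContDiffOn.sum fun i _ => (ih (hW.dx i)).smul contDiffOn_const)
    exact this.congr fun q hq => (hW.hasFDerivAt_taylorExt ht₀ hR hρ hRρ hq).fderiv

/-- Taylor's formula in time with remainder of order `N`, for the time derivative of order `k`; the
auxiliary order `k` makes the induction on `N` work. -/
theorem _root_.NavierStokes.SmoothPer.abs_sub_taylor_le (W : SmoothPer n a b) (x : Rn n) {t : ℝ}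
    (ha : a < t₀) (hb : t < b) (N : ℕ) (C : ℝ) :
    ∀ k, (∀ s ∈ Icc t₀ t, |dtx (k + N) [] W (s, x)| ≤ C) → ∀ s ∈ Icc t₀ t,
      |dtx k [] W (s, x) - ∑ l ∈ Finset.range N,
        (s - t₀) ^ l / l.factorial * dtx (k + l) [] W (t₀, x)| ≤
      C * ((s - t₀) ^ N / N.factorial) := by
  induction N with
  | zero =>
    intro k hk s hs
    simpa using hk s hs
  | succ N ih =>
    intro k hk s hs
    have hmem : ∀ r ∈ Icc t₀ t, r ∈ Ioo a b := fun r hr => ⟨ha.trans_le hr.1, hr.2.trans_lt hb⟩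
    have hpow : ∀ (l : ℕ) (r : ℝ), HasDerivAt (fun r => (r - t₀) ^ (l + 1) / (l + 1).factorial)
        ((r - t₀) ^ l / l.factorial) r := by
      intro l r
      have hl : (0 : ℝ) < l.factorial := by exact_mod_cast l.factorial_pos
      have := (((hasDerivAt_id r).sub_const t₀).pow (l + 1)).div_const ((l + 1).factorial : ℝ)
      convert! this using 1
      rw [Nat.factorial_succ]
      simp only [id, Nat.add_sub_cancel, mul_one]
      push_cast
      field_simp
    have hder : ∀ r ∈ Icc t₀ t, HasDerivAt (fun r => dtx k [] W (r, x) -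
        ∑ l ∈ Finset.range (N + 1), (r - t₀) ^ l / l.factorial * dtx (k + l) [] W (t₀, x))
        (dtx (k + 1) [] W (r, x) -
        ∑ l ∈ Finset.range N, (r - t₀) ^ l / l.factorial * dtx (k + 1 + l) [] W (t₀, x)) r := by
      intro r hr
      have h1 := (dtx k [] W).hasDerivAt_time (hmem r hr) x
      rw [← dtx_succ] at h1
      refine h1.sub ?_
      simp only [Finset.sum_range_succ']
      simp only [pow_zero, Nat.factorial_zero]
      refine HasDerivAt.add_const _ (HasDerivAt.fun_sum fun l _ => ?_)
      have := (hpow l r).mul_const (dtx (k + (l + 1)) [] W (t₀, x))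
      rwa [show k + 1 + l = k + (l + 1) by ring]
    refine image_norm_le_of_norm_deriv_right_le_deriv_boundary' (a := t₀) (b := t)
      (f := fun r => dtx k [] W (r, x) -
        ∑ l ∈ Finset.range (N + 1), (r - t₀) ^ l / l.factorial * dtx (k + l) [] W (t₀, x))
      (f' := fun r => dtx (k + 1) [] W (r, x) -
        ∑ l ∈ Finset.range N, (r - t₀) ^ l / l.factorial * dtx (k + 1 + l) [] W (t₀, x))
      (B := fun r => C * ((r - t₀) ^ (N + 1) / (N + 1).factorial))
      (B' := fun r => C * ((r - t₀) ^ N / N.factorial))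
      (fun r hr => (hder r hr).continuousAt.continuousWithinAt)
      (fun r hr => (hder r (Ico_subset_Icc_self hr)).hasDerivWithinAt) ?_
      (by fun_prop) (fun r hr => ((hpow N r).const_mul C).hasDerivWithinAt) ?_ hs
    · simp [Finset.sum_range_succ']
    · intro r hr
      refine ih (k + 1) (fun s hs => ?_) r (Ico_subset_Icc_self hr)
      have := hk s hs
      rwa [show k + 1 + N = k + (N + 1) by ring]

/-- A controlled function is the sum of its Taylor series in time. -/
theorem taylorExt_eq (hW : Controlled t₀ R W) (ht₀ : t₀ ∈ Ioo a b) (hR : 0 ≤ R)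
    {t : ℝ} (ht : t ∈ Ico t₀ b) (hRt : R * (t - t₀) < 1) (x : Rn n) :
    taylorExt t₀ W (t, x) = W (t, x) := by
  obtain ⟨A, j, hA, h⟩ := hW 0
  have htt : 0 ≤ t - t₀ := by linarith [ht.1]
  have hs := (hW.summable_norm ht₀ hR htt hRt (t, x) (by
    rw [abs_of_nonneg htt])).of_norm.hasSum.tendsto_sum_nat
  refine tendsto_nhds_unique hs ?_
  rw [tendsto_iff_norm_sub_tendsto_zero]
  have hlim := ((summable_succ_pow_mul_geometric j (q := R * (t - t₀)) (by positivity)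
    hRt).mul_left A).tendsto_atTop_zero
  refine squeeze_zero (fun N => norm_nonneg _) (fun N => ?_) hlim
  have hN : (0 : ℝ) < N.factorial := by exact_mod_cast N.factorial_pos
  have := W.abs_sub_taylor_le x ht₀.1 ht.2 N (A * R ^ N * (N.factorial * ((N : ℝ) + 1) ^ j)) 0
    (fun s hs => by
      rw [zero_add]
      exact h [] le_rfl N s ⟨hs.1, hs.2.trans_lt ht.2⟩ x) t ⟨ht.1, le_rfl⟩
  simp only [dtx_zero_nil, zero_add] at this
  rw [norm_sub_rev, Real.norm_eq_abs]
  refine this.trans (le_of_eq ?_)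
  rw [mul_pow]
  field_simp

end Controlled

theorem isPeriodic_taylorExt (t₀ : ℝ) (ht₀ : t₀ ∈ Ioo a b) (W : SmoothPer n a b) (t : ℝ) :
    IsPeriodic fun x => taylorExt t₀ W (t, x) := by
  intro i x
  simp only [taylorExt]
  refine tsum_congr fun m => ?_
  exact congrArg _ ((dtx m [] W).periodic ht₀ i x)

end NavierStokes

end

/-! ### Extension of solutions by Taylor series -/

noncomputable section

namespace NavierStokes

open Set Filter Topology SmoothPer

variable {n : ℕ} {a b c d : ℝ}

theorem SmoothPer.eventuallyEq_der (v : ℝ × Rn n) {F : SmoothPer n a b} {G : SmoothPer n c d}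
    {q : ℝ × Rn n} (hq : q ∈ strip n a b) (hq' : q ∈ strip n c d) (h : F.1 =ᶠ[𝓝 q] G.1) :
    (der v F).1 =ᶠ[𝓝 q] (der v G).1 := by
  filter_upwards [h.eventuallyEq_nhds, isOpen_strip.mem_nhds hq, isOpen_strip.mem_nhds hq']
    with r hr h1 h2
  rw [der_apply v F h1, der_apply v G h2, hr.fderiv_eq]

/-- Being a solution is a local property. -/
theorem IsNS.of_local {U : Fin n → SmoothPer n a b} {Q : SmoothPer n a b}
    (h : ∀ q ∈ strip n a b, ∃ (c d : ℝ) (V : Fin n → SmoothPer n c d) (P : SmoothPer n c d),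
      IsNS V P ∧ q ∈ strip n c d ∧ (∀ i, (U i).1 =ᶠ[𝓝 q] (V i).1) ∧ Q.1 =ᶠ[𝓝 q] P.1) :
    IsNS U Q := by
  refine ⟨fun i => SmoothPer.ext fun q hq => ?_, SmoothPer.ext fun q hq => ?_⟩ <;>
    obtain ⟨c, d, V, P, hV, hq', hU, hQ⟩ := h q hq
  · have h1 := (eventuallyEq_der (1, 0) hq hq' (hU i)).eq_of_nhds
    have h2 : ∀ k, dx k (dx k (U i)) q = dx k (dx k (V i)) q := fun k =>
      (eventuallyEq_der (0, stdVec k) hq hq'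
        (eventuallyEq_der (0, stdVec k) hq hq' (hU i))).eq_of_nhds
    have h3 : ∀ k, dx k (U k * U i) q = dx k (V k * V i) q := fun k =>
      (eventuallyEq_der (0, stdVec k) hq hq' ((hU k).mul (hU i))).eq_of_nhds
    have h4 := (eventuallyEq_der (0, stdVec i) hq hq' hQ).eq_of_nhds
    have h5 := congrArg (fun F : SmoothPer n c d => F q) (hV.momentum i)
    simp only [lap_apply, coe_sub, coe_sum] at h5 ⊢
    simp only [h2, h3]
    exact h1.trans (h5.trans (by rw [← show dx i Q q = dx i P q from h4]))
  · have h1 : ∀ i, dx i (U i) q = dx i (V i) q := fun i =>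
      (eventuallyEq_der (0, stdVec i) hq hq' (hU i)).eq_of_nhds
    have h5 := congrArg (fun F : SmoothPer n c d => F q) hV.incompressible
    simp only [coe_sum] at h5 ⊢
    simp only [h1]
    exact h5

/-- If `F` on `(a, b)` and `G` on `(c, d)` agree on `(e, b)`, then they have a common extension. -/
theorem SmoothPer.exists_glue {e : ℝ} (hae : a ≤ e) (hce : c ≤ e) (heb : e < b) (hbd : b ≤ d)
    (F : SmoothPer n a b) (G : SmoothPer n c d) (h : ∀ t ∈ Ioo e b, ∀ x, F (t, x) = G (t, x)) :
    ∃ H : SmoothPer n a d, (∀ q ∈ strip n a b, H q = F q) ∧ ∀ q ∈ strip n e d, H q = G q := by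
  let H : ℝ × Rn n → ℝ := fun q => if q.1 < b then F q else G q
  have hF : ∀ q ∈ strip n a b, H q = F q := fun q hq => by
    have : q.1 ∈ Ioo a b := by simpa [strip] using hq
    exact if_pos this.2
  have hG : ∀ q ∈ strip n e d, H q = G q := fun q hq => by
    have hqc : q.1 ∈ Ioo e d := by simpa [strip] using hq
    by_cases hb : q.1 < b
    · exact (if_pos hb).trans (h q.1 ⟨hqc.1, hb⟩ q.2)
    · exact if_neg hb
  have hcov : ∀ q ∈ strip n a d, q ∈ strip n a b ∨ q ∈ strip n e d := by
    rintro ⟨t, x⟩ hq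
    rw [mem_strip] at hq
    rcases lt_or_ge t b with ht | ht
    · exact .inl (mem_strip.2 ⟨hq.1, ht⟩)
    · exact .inr (mem_strip.2 ⟨heb.trans_le ht, hq.2⟩)
  have hmono : strip n e d ⊆ strip n c d := prod_mono (Ioo_subset_Ioo_left hce) subset_rfl
  have h1 : ContDiffOn ℝ ∞ H (strip n a d) := by
    intro q hq
    apply ContDiffAt.contDiffWithinAt
    rcases hcov q hq with hq | hq
    · exact (F.contDiffAt hq).congr_of_eventuallyEq
        (mem_of_superset (isOpen_strip.mem_nhds hq) hF)
    · exact (G.contDiffAt (hmono hq)).congr_of_eventuallyEq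
        (mem_of_superset (isOpen_strip.mem_nhds hq) hG)
  have h2 : ∀ t ∈ Ioo a d, IsPeriodic fun x => H (t, x) := by
    intro t ht i x
    by_cases hb : t < b
    · simpa [H, hb] using F.periodic ⟨ht.1, hb⟩ i x
    · simpa [H, hb] using
        G.periodic ⟨hce.trans_lt (heb.trans_le (not_lt.1 hb)), ht.2⟩ i x
  have hsub : ∀ q, q ∈ strip n a b ∨ q ∈ strip n e d → q ∈ strip n a d := by
    rintro ⟨t, x⟩ (hq | hq) <;> rw [mem_strip] at hq ⊢
    · exact ⟨hq.1, hq.2.trans_le hbd⟩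
    · exact ⟨hae.trans_lt hq.1, hq.2⟩
  exact ⟨mk H h1 h2, fun q hq => (mk_apply (hsub q (.inl hq))).trans (hF q hq),
    fun q hq => (mk_apply (hsub q (.inr hq))).trans (hG q hq)⟩

namespace Controlled

variable {t₀ R ρ : ℝ} {W : SmoothPer n a b}

/-- The extension of a controlled function by its Taylor series in time, as a function on the
strip of half-width `ρ` about `t₀`. -/
def extend (hW : Controlled t₀ R W) (ht₀ : t₀ ∈ Ioo a b) (hR : 0 ≤ R) (hρ : 0 < ρ)
    (hRρ : R * ρ < 1) : SmoothPer n (t₀ - ρ) (t₀ + ρ) :=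
  mk (taylorExt t₀ W) (hW.contDiffOn_taylorExt ht₀ hR hρ hRρ)
    fun t _ => isPeriodic_taylorExt t₀ ht₀ W t

variable (hW : Controlled t₀ R W) (ht₀ : t₀ ∈ Ioo a b) (hR : 0 ≤ R) (hρ : 0 < ρ) (hRρ : R * ρ < 1)

theorem extend_apply {q : ℝ × Rn n} (hq : q ∈ strip n (t₀ - ρ) (t₀ + ρ)) :
    hW.extend ht₀ hR hρ hRρ q = taylorExt t₀ W q := mk_apply hq

theorem fderiv_extend {q : ℝ × Rn n} (hq : q ∈ strip n (t₀ - ρ) (t₀ + ρ)) :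
    fderiv ℝ (hW.extend ht₀ hR hρ hRρ).1 q =
      gradForm (taylorExt t₀ (SmoothPer.dt W) q) fun i => taylorExt t₀ (SmoothPer.dx i W) q := by
  have : (hW.extend ht₀ hR hρ hRρ).1 =ᶠ[𝓝 q] taylorExt t₀ W :=
    mem_of_superset (isOpen_strip.mem_nhds hq) fun r hr => hW.extend_apply ht₀ hR hρ hRρ hr
  rw [this.fderiv_eq]
  exact (hW.hasFDerivAt_taylorExt ht₀ hR hρ hRρ hq).fderiv

theorem dt_extend : SmoothPer.dt (hW.extend ht₀ hR hρ hRρ) =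
    (hW.dt hR).extend ht₀ hR hρ hRρ := by
  refine SmoothPer.ext fun q hq => ?_
  rw [extend_apply _ _ _ _ _ hq, SmoothPer.dt, der_apply _ _ hq,
    hW.fderiv_extend ht₀ hR hρ hRρ hq, gradForm_apply]
  simp

theorem dx_extend (i : Fin n) : SmoothPer.dx i (hW.extend ht₀ hR hρ hRρ) =
    (hW.dx i).extend ht₀ hR hρ hRρ := by
  refine SmoothPer.ext fun q hq => ?_
  rw [extend_apply _ _ _ _ _ hq, SmoothPer.dx, der_apply _ _ hq,
    hW.fderiv_extend ht₀ hR hρ hRρ hq, gradForm_apply]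
  simp [stdVec]

end Controlled

/-- The Taylor extension of a controlled solution is a solution. -/
theorem IsNS.extend {t₀ R ρ : ℝ} {U : Fin n → SmoothPer n a b} {Q : SmoothPer n a b}
    (h : IsNS U Q) (hU : ∀ i, Controlled t₀ R (U i)) (hQ : Controlled t₀ R Q)
    (ht₀ : t₀ ∈ Ioo a b) (hR : 0 ≤ R) (hρ : 0 < ρ) (hRρ : R * ρ < 1) :
    IsNS (fun i => (hU i).extend ht₀ hR hρ hRρ) (hQ.extend ht₀ hR hρ hRρ) := by
  have habs : ∀ q ∈ strip n (t₀ - ρ) (t₀ + ρ), |q.1 - t₀| ≤ ρ := by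
    intro q hq
    have : q.1 ∈ Ioo (t₀ - ρ) (t₀ + ρ) := by simpa [strip] using hq
    rw [abs_le]
    constructor <;> linarith [this.1, this.2]
  have hprod : ∀ k i, (hU k).extend ht₀ hR hρ hRρ * (hU i).extend ht₀ hR hρ hRρ =
      ((hU k).mul hR (hU i)).extend ht₀ hR hρ hRρ := fun k i => SmoothPer.ext fun q hq => by
    rw [coe_mul, Controlled.extend_apply _ _ _ _ _ hq, Controlled.extend_apply _ _ _ _ _ hq,
      Controlled.extend_apply _ _ _ _ _ hq,
      (hU k).taylorExt_mul (hU i) ht₀ hR hρ.le hRρ q (habs q hq)]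
  refine ⟨fun i => SmoothPer.ext fun q hq => ?_, SmoothPer.ext fun q hq => ?_⟩
  · have hl : ∀ k, Controlled t₀ R (dx k (dx k (U i))) := fun k => ((hU i).dx k).dx k
    have hm : ∀ k, Controlled t₀ R (dx k (U k * U i)) := fun k => ((hU k).mul hR (hU i)).dx k
    simp only [lap_apply, coe_sub, coe_sum, hprod, Controlled.dt_extend, Controlled.dx_extend,
      Controlled.extend_apply _ _ _ _ _ hq]
    rw [h.momentum i, lap_apply,
      Controlled.taylorExt_sub (.sub hR (.sum hR _ _ hl) (.sum hR _ _ hm)) (hQ.dx i)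
        ht₀ hR hρ.le hRρ q (habs q hq),
      Controlled.taylorExt_sub (.sum hR _ _ hl) (.sum hR _ _ hm) ht₀ hR hρ.le hRρ q (habs q hq),
      Controlled.taylorExt_sum _ hl ht₀ hR hρ.le hRρ q (habs q hq),
      Controlled.taylorExt_sum _ hm ht₀ hR hρ.le hRρ q (habs q hq)]
  · simp only [coe_sum, Controlled.dx_extend, Controlled.extend_apply _ _ _ _ _ hq]
    rw [← Controlled.taylorExt_sum _ (fun i => (hU i).dx i) ht₀ hR hρ.le hRρ q (habs q hq),
      h.incompressible, taylorExt_zero]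
    rfl

/-- The pressure normalized to vanish at the origin of space. The equations determine the pressure
only up to a function of time, and this choice makes it as regular in time as the velocity. -/
theorem SmoothPer.exists_normalized (Q : SmoothPer n a b) :
    ∃ P : SmoothPer n a b, ∀ t ∈ Ioo a b, ∀ x, P (t, x) = Q (t, x) - Q (t, 0) := by
  have h1 : ContDiffOn ℝ ∞ (fun q : ℝ × Rn n => Q q - Q (q.1, 0)) (strip n a b) := by
    refine Q.contDiffOn.sub (Q.contDiffOn.comp (f := fun q : ℝ × Rn n => (q.1, (0 : Rn n)))
      (by fun_prop) ?_)
    rintro ⟨t, x⟩ hq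
    simpa using hq
  refine ⟨mk _ h1 fun t ht i x => ?_, fun t ht x => mk_apply (mem_strip.2 ht)⟩
  have := Q.periodic ht i x
  simp_all

end NavierStokes

end

/-! ### Continuation of bounded solutions -/

noncomputable section

namespace NavierStokes

open Set Filter Topology SmoothPer

variable {n : ℕ} {a b : ℝ}

/-- If `W` vanishes at the point `y` for all times, then so do its time derivatives. -/
theorem SmoothPer.dtx_nil_eq_zero {W : SmoothPer n a b} {y : Rn n}
    (h0 : ∀ t ∈ Ioo a b, W (t, y) = 0) (m : ℕ) : ∀ t ∈ Ioo a b, dtx m [] W (t, y) = 0 := by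
  induction m with
  | zero => simpa using h0
  | succ m ih =>
    intro t ht
    rw [dtx_succ]
    have h1 := (dtx m [] W).hasDerivAt_time ht y
    have h2 : (fun s => dtx m [] W (s, y)) =ᶠ[𝓝 t] fun _ => (0 : ℝ) :=
      mem_of_superset (isOpen_Ioo.mem_nhds ht) ih
    exact (h1.congr_of_eventuallyEq h2.symm).unique (hasDerivAt_const t 0)

theorem SmoothPer.abs_sub_le_of_dx {W : SmoothPer n a b} {s : ℝ} (hs : s ∈ Ioo a b)
    {C : Fin n → ℝ} (h : ∀ i x, |dx i W (s, x)| ≤ C i) (x y : Rn n) :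
    |W (s, x) - W (s, y)| ≤ (∑ i, C i) * ‖x - y‖ := by
  refine convex_univ.norm_image_sub_le_of_norm_hasFDerivWithin_le (f := fun x => W (s, x))
    (fun x _ => (W.hasFDerivAt_slice hs x).hasFDerivWithinAt) (fun x _ => ?_)
    (mem_univ y) (mem_univ x)
  have hC : 0 ≤ ∑ i, C i := Finset.sum_nonneg fun i _ => (abs_nonneg _).trans (h i 0)
  refine ContinuousLinearMap.opNorm_le_bound _ hC fun z => ?_
  have e := W.fderiv_inr_eq_sum hs x z
  change ‖fderiv ℝ W (s, x) (0, z)‖ ≤ _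
  rw [e, Finset.sum_mul]
  refine (norm_sum_le _ _).trans (Finset.sum_le_sum fun i _ => ?_)
  rw [norm_mul, mul_comm]
  exact mul_le_mul (h i x) (PiLp.norm_apply_le z i) (norm_nonneg _) ((abs_nonneg _).trans (h i 0))

/-- A periodic function that vanishes at the origin of space is controlled by its gradient. -/
theorem Controlled.of_dx {t₀ R : ℝ} (ha : a < t₀) (hR : 0 ≤ R) {W : SmoothPer n a b}
    (h : ∀ i, Controlled t₀ R (SmoothPer.dx i W)) (h0 : ∀ t ∈ Ioo a b, W (t, 0) = 0) :
    Controlled t₀ R W := by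
  intro L
  choose A j hA hb using fun i => h i L
  have hb' : ∀ i (I : List (Fin n)), I.length ≤ L → ∀ m, ∀ s ∈ Ico t₀ b, ∀ x,
      |dtx m I (SmoothPer.dx i W) (s, x)| ≤
        A i * R ^ m * (m.factorial * ((m : ℝ) + 1) ^ (∑ i, j i)) := by
    intro i I hI m s hs x
    refine (hb i I hI m s hs x).trans ?_
    have h1 : (1 : ℝ) ≤ (m : ℝ) + 1 := by linarith [Nat.cast_nonneg (α := ℝ) m]
    have : j i ≤ ∑ i, j i := Finset.single_le_sum (fun _ _ => Nat.zero_le _) (Finset.mem_univ i)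
    have := hA i
    gcongr
  have hS : 0 ≤ ∑ i, A i := Finset.sum_nonneg fun i _ => hA i
  have hπ : 0 ≤ (n : ℝ) * (2 * Real.pi) := by positivity
  refine ⟨(∑ i, A i) * (n * (2 * Real.pi) + 1), ∑ i, j i, by positivity,
    fun I hI m s hs x => ?_⟩
  have hs' : s ∈ Ioo a b := ⟨ha.trans_le hs.1, hs.2⟩
  have hE : 0 ≤ R ^ m * (m.factorial * ((m : ℝ) + 1) ^ (∑ i, j i)) := by positivity
  cases I with
  | nil =>
    obtain ⟨y, hy, hyx⟩ := exists_bounded_representative x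
    have h1 := abs_sub_le_of_dx (W := dtx m [] W) hs'
      (C := fun i => A i * R ^ m * (m.factorial * ((m : ℝ) + 1) ^ (∑ i, j i)))
      (fun i x => by rw [← dtx_dx]; exact hb' i [] (by simp) m s hs x) y 0
    rw [dtx_nil_eq_zero h0 m s hs', sub_zero, sub_zero,
      hyx _ ((dtx m [] W).periodic hs')] at h1
    refine h1.trans ?_
    rw [← Finset.sum_mul, ← Finset.sum_mul]
    have : ‖y‖ ≤ n * (2 * Real.pi) + 1 := by linarith
    calc _ ≤ (∑ i, A i) * R ^ m * (m.factorial * ((m : ℝ) + 1) ^ (∑ i, j i)) *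
          (n * (2 * Real.pi) + 1) := by gcongr
      _ = _ := by ring
  | cons i I =>
    rw [dtx_cons']
    refine (hb' i I (by simp at hI; omega) m s hs x).trans ?_
    have h1 : A i ≤ ∑ i, A i := Finset.single_le_sum (fun i _ => hA i) (Finset.mem_univ i)
    have h2 : A i ≤ (∑ i, A i) * (n * (2 * Real.pi) + 1) := by nlinarith
    rw [mul_assoc, mul_assoc]
    gcongr

/-- Bounded solutions are analytic in time, with a radius of convergence at time `t₀` comparable
to `t₀`. -/
theorem exists_controlled (n : ℕ) : ∃ B : ℝ, 1 ≤ B ∧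
    ∀ {T : ℝ} {U : Fin n → SmoothPer n 0 T} {Q : SmoothPer n 0 T}, IsNS U Q →
      (∀ t ∈ Ioo 0 T, Q (t, 0) = 0) → ∀ {M : ℝ}, 0 < M → T * M ^ 2 ≤ 1 →
      (∀ s ∈ Ioo 0 T, ∀ i x, |U i (s, x)| ≤ M) → ∀ t₀ ∈ Ioo 0 T,
      (∀ i, Controlled t₀ (B / t₀) (U i)) ∧ Controlled t₀ (B / t₀) Q := by
  obtain ⟨B, hB, A, hA, h⟩ := exists_deriv_estimate n
  refine ⟨B, hB, fun {T U Q} hU hQ M hM hT hb t₀ ht₀ => ?_⟩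
  have ht : 0 < t₀ := ht₀.1
  have hR : 0 ≤ B / t₀ := by positivity
  have hUC : ∀ i, Controlled t₀ (B / t₀) (U i) := by
    intro i L
    have hterm : ∀ l, 0 ≤ A l * M / √t₀ ^ l := fun l => by have := hA l; positivity
    refine ⟨∑ l ∈ Finset.range (L + 1), A l * M / √t₀ ^ l, L,
      Finset.sum_nonneg fun l _ => hterm l, fun I hI m s hs x => ?_⟩
    have h1 := h hU hM (by simpa using hT) hb s ⟨ht.trans_le hs.1, hs.2⟩ m I i x
    rw [sub_zero] at h1
    have h2 : A I.length * M / √t₀ ^ I.length ≤ _ :=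
      Finset.single_le_sum (f := fun l => A l * M / √t₀ ^ l) (fun l _ => hterm l)
        (Finset.mem_range.2 (Nat.lt_succ_of_le hI))
    have h0 := (hterm I.length).trans h2
    have hsq : √t₀ ≤ √s := Real.sqrt_le_sqrt hs.1
    have hsq0 : 0 < √t₀ := Real.sqrt_pos.2 ht
    have h1' : (1 : ℝ) ≤ (m : ℝ) + 1 := by linarith [Nat.cast_nonneg (α := ℝ) m]
    calc |dtx m I (U i) (s, x)|
        = √t₀ ^ I.length * t₀ ^ m * |dtx m I (U i) (s, x)| / (√t₀ ^ I.length * t₀ ^ m) := by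
          field_simp
      _ ≤ √s ^ I.length * s ^ m * |dtx m I (U i) (s, x)| / (√t₀ ^ I.length * t₀ ^ m) := by
          have := hs.1
          gcongr
      _ ≤ A I.length * M * B ^ m * (m.factorial * ((m : ℝ) + 1) ^ I.length) /
            (√t₀ ^ I.length * t₀ ^ m) := by gcongr
      _ = A I.length * M / √t₀ ^ I.length * (B / t₀) ^ m *
            (m.factorial * ((m : ℝ) + 1) ^ I.length) := by
          rw [div_pow]; field_simp
      _ ≤ _ := by
          rw [mul_assoc, mul_assoc]
          exact mul_le_mul h2 (by gcongr) (by positivity) h0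
  refine ⟨hUC, Controlled.of_dx ht hR (fun i => ?_) hQ⟩
  have e : dx i Q = lap (U i) - ∑ k, dx k (U k * U i) - dt (U i) := by
    rw [hU.momentum i]; abel
  rw [e, lap_apply]
  exact ((Controlled.sum hR _ _ fun k => ((hUC i).dx k).dx k).sub hR
    (Controlled.sum hR _ _ fun k => ((hUC k).mul hR (hUC i)).dx k)).sub hR ((hUC i).dt hR)

/-- A solution bounded by `M` on `(0, T)`, where `T M² ≤ 1`, extends to a longer interval. -/
theorem exists_continuation {T : ℝ} (hT : 0 < T) {U : Fin n → SmoothPer n 0 T}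
    {Q : SmoothPer n 0 T} (hU : IsNS U Q) {M : ℝ} (hM : 0 < M) (hTM : T * M ^ 2 ≤ 1)
    (hb : ∀ s ∈ Ioo 0 T, ∀ i x, |U i (s, x)| ≤ M) :
    ∃ T' > T, ∃ (V : Fin n → SmoothPer n 0 T') (P : SmoothPer n 0 T'), IsNS V P ∧
      ∀ t ∈ Ioo 0 T, ∀ x, (∀ i, V i (t, x) = U i (t, x)) ∧ P (t, x) = Q (t, x) - Q (t, 0) := by
  obtain ⟨Q', hQ'⟩ := Q.exists_normalized
  have hU' : IsNS U Q' := by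
    refine ⟨fun i => ?_, hU.incompressible⟩
    rw [hU.momentum i]
    congr 1
    refine SmoothPer.ext fun q hq => ?_
    have hq1 : q.1 ∈ Ioo 0 T := by simpa [strip] using hq
    have h1 := Q.fderiv_inr_eq_sum hq1 q.2 (stdVec i)
    have h2 := Q'.fderiv_inr_eq_sum hq1 q.2 (stdVec i)
    have e : (fun x => Q' (q.1, x)) = fun x => Q (q.1, x) - Q (q.1, 0) :=
      funext fun x => hQ' q.1 hq1 x
    have h3 := Q'.hasFDerivAt_slice hq1 q.2
    rw [e] at h3
    have h4 := ((Q.hasFDerivAt_slice hq1 q.2).sub_const (Q (q.1, 0))).unique h3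
    have h5 := congrArg (fun l : Rn n →L[ℝ] ℝ => l (stdVec i)) h4
    rw [dx, der_apply _ _ hq, der_apply _ _ hq]
    exact h5
  obtain ⟨B, hB, hC⟩ := exists_controlled n
  -- with `R = B / t₀` this choice of `t₀` makes `R (T - t₀) ≤ 1 / 3`
  set t₀ := T - T / (4 * B) with ht₀
  have hB0 : 0 < B := by linarith
  have hε : 0 < T / (4 * B) := by positivity
  have hε' : T / (4 * B) * (4 * B) = T := by field_simp
  have ht₀' : t₀ ∈ Ioo 0 T := ⟨by nlinarith, by linarith⟩
  obtain ⟨hUC, hQC⟩ := hC hU' (fun t ht => by rw [hQ' t ht, sub_self]) hM hTM hb t₀ ht₀'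
  have ht0 : 0 < t₀ := ht₀'.1
  have hR : 0 ≤ B / t₀ := by positivity
  -- half-width `2 (T - t₀)` reaches beyond `T`, and `R` times it is at most `2 / 3`
  have hρ : 0 < 2 * (T - t₀) := by linarith
  have hRρ : B / t₀ * (2 * (T - t₀)) < 1 := by
    rw [div_mul_eq_mul_div, div_lt_one ht0]
    nlinarith
  have hE := hU'.extend hUC hQC ht₀' hR hρ hRρ
  have hsub : ∀ t ∈ Ioo t₀ T, ∀ x : Rn n, (t, x) ∈ strip n (t₀ - 2 * (T - t₀))
      (t₀ + 2 * (T - t₀)) := fun t ht x => mem_strip.2 ⟨by linarith [ht.1], by linarith [ht.2]⟩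
  have hagree : ∀ {W : SmoothPer n 0 T} (hW : Controlled t₀ (B / t₀) W), ∀ t ∈ Ioo t₀ T, ∀ x,
      W (t, x) = hW.extend ht₀' hR hρ hRρ (t, x) := fun {W} hW t ht x => by
    rw [hW.extend_apply ht₀' hR hρ hRρ (hsub t ht x)]
    refine (hW.taylorExt_eq ht₀' hR ⟨ht.1.le, ht.2⟩ (lt_of_le_of_lt ?_ hRρ) x).symm
    gcongr
    linarith [ht.2]
  have hlow : t₀ - 2 * (T - t₀) ≤ t₀ := by linarith
  have hTd : T ≤ t₀ + 2 * (T - t₀) := by linarith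
  choose V hV1 hV2 using fun i => exists_glue ht0.le hlow ht₀'.2 hTd (U i) _ (hagree (hUC i))
  obtain ⟨P, hP1, hP2⟩ := exists_glue ht0.le hlow ht₀'.2 hTd Q' _ (hagree hQC)
  refine ⟨t₀ + 2 * (T - t₀), by linarith, V, P, ?_, fun t ht x => ⟨fun i =>
    hV1 i _ (mem_strip.2 ht), by rw [hP1 _ (mem_strip.2 ht), hQ' t ht]⟩⟩
  refine IsNS.of_local fun q hq => ?_
  have hq1 : q.1 ∈ Ioo 0 (t₀ + 2 * (T - t₀)) := by simpa [strip] using hq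
  rcases lt_or_ge q.1 T with hqT | hqT
  · have hqm : q ∈ strip n 0 T := mem_strip.2 ⟨hq1.1, hqT⟩
    exact ⟨0, T, U, Q', hU', hqm, fun i =>
      mem_of_superset (isOpen_strip.mem_nhds hqm) (hV1 i),
      mem_of_superset (isOpen_strip.mem_nhds hqm) hP1⟩
  · have hqm : q ∈ strip n t₀ (t₀ + 2 * (T - t₀)) := mem_strip.2 ⟨ht₀'.2.trans_le hqT, hq1.2⟩
    exact ⟨_, _, _, _, hE, mem_strip.2 ⟨by linarith, hq1.2⟩, fun i =>
      mem_of_superset (isOpen_strip.mem_nhds hqm) (hV2 i),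
      mem_of_superset (isOpen_strip.mem_nhds hqm) hP2⟩

end NavierStokes

end

/-! ### Vector fields and their components -/

noncomputable section

namespace NavierStokes

open Set Filter Topology SmoothPer

variable {n : ℕ} {a b : ℝ}

section Slice

variable {t : ℝ} {g : Rn n → Rn n} {W : Fin n → SmoothPer n a b}

theorem fderiv_slice_vector (ht : t ∈ Ioo a b) (hg : ∀ x i, g x i = W i (t, x)) (x : Rn n) :
    DifferentiableAt ℝ g x ∧ ∀ z i, fderiv ℝ g x z i = fderiv ℝ (W i) (t, x) (0, z) := by
  have h : ∀ i, HasFDerivAt (fun x => g x i)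
      ((fderiv ℝ (W i) (t, x)).comp (.inr ℝ ℝ (Rn n))) x := fun i => by
    simp only [hg]
    exact (W i).hasFDerivAt_slice ht x
  have hd : DifferentiableAt ℝ g x := differentiableAt_euclidean.2 fun i => (h i).differentiableAt
  refine ⟨hd, fun z i => ?_⟩
  have h1 := ((EuclideanSpace.proj i : Rn n →L[ℝ] ℝ).hasFDerivAt.comp x hd.hasFDerivAt).unique (h i)
  exact congrArg (fun l : Rn n →L[ℝ] ℝ => l z) h1

theorem contDiff_slice_vector (ht : t ∈ Ioo a b) (hg : ∀ x i, g x i = W i (t, x)) :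
    ContDiff ℝ ∞ g := by
  refine contDiff_euclidean.2 fun i => contDiff_iff_contDiffAt.2 fun x => ?_
  simp only [hg]
  exact ((W i).contDiffAt (mem_strip.2 ht)).comp x (contDiffAt_const.prodMk contDiffAt_id)

theorem partialD_slice (ht : t ∈ Ioo a b) (hg : ∀ x i, g x i = W i (t, x)) (k : Fin n) (x : Rn n)
    (i : Fin n) : partialD k g x i = dx k (W i) (t, x) := by
  rw [partialD, (fderiv_slice_vector ht hg x).2, dx, der_apply _ _ (mem_strip.2 ht)]

theorem divergence_slice (ht : t ∈ Ioo a b) (hg : ∀ x i, g x i = W i (t, x)) (x : Rn n) :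
    divergence g x = (∑ i, dx i (W i)) (t, x) := by
  rw [divergence, coe_sum]
  exact Finset.sum_congr rfl fun i _ => partialD_slice ht hg i x i

theorem fderiv_slice (ht : t ∈ Ioo a b) (hg : ∀ x i, g x i = W i (t, x)) (x z : Rn n)
    (i : Fin n) : fderiv ℝ g x z i = ∑ k, z k * dx k (W i) (t, x) := by
  rw [(fderiv_slice_vector ht hg x).2, fderiv_inr_eq_sum _ ht]

theorem laplacian_slice (ht : t ∈ Ioo a b) (hg : ∀ x i, g x i = W i (t, x)) (x : Rn n)
    (i : Fin n) : Laplacian.laplacian g x i = lap (W i) (t, x) := by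
  rw [InnerProductSpace.laplacian_eq_iteratedFDeriv_orthonormalBasis g
    (EuclideanSpace.basisFun (Fin n) ℝ), lap_apply, coe_sum]
  have h2 : DifferentiableAt ℝ (fderiv ℝ g) x :=
    (((contDiff_slice_vector ht hg).fderiv_right (m := 1) (by norm_cast)).differentiable
      (by simp)) x
  simp only [WithLp.ofLp_sum, Finset.sum_apply]
  refine Finset.sum_congr rfl fun k _ => ?_
  rw [iteratedFDeriv_two_apply]
  have h1 : ∀ y j, partialD k g y j = dx k (W j) (t, y) := fun y j => partialD_slice ht hg k y j
  rw [← partialD_slice ht h1 k x i, partialD]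
  have : partialD k g = fun y => fderiv ℝ g y (stdVec k) := rfl
  rw [this, fderiv_clm_apply h2 (differentiableAt_const _)]
  simp [stdVec]

/-- The components of `D^α g` are iterated space derivatives of the components of `g`. -/
theorem exists_multiD_slice (ht : t ∈ Ioo a b) (hg : ∀ x i, g x i = W i (t, x))
    (α : Fin n → ℕ) :
    ∃ I : List (Fin n), I.length = ∑ i, α i ∧ ∀ x i, multiD α g x i = dtx 0 I (W i) (t, x) := by
  have hiter : ∀ (k : Fin n) (r : ℕ) (h : Rn n → Rn n) (I : List (Fin n)),
      (∀ x i, h x i = dtx 0 I (W i) (t, x)) →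
      ∀ x i, (partialD k)^[r] h x i = dtx 0 (List.replicate r k ++ I) (W i) (t, x) := by
    intro k r
    induction r with
    | zero => intro h I hI; simpa using hI
    | succ r ih =>
      intro h I hI x i
      rw [Function.iterate_succ_apply', List.replicate_succ, List.cons_append, dtx_cons]
      exact partialD_slice (W := fun i => dtx 0 (List.replicate r k ++ I) (W i)) ht
        (ih h I hI) k x i
  rw [← List.sum_ofFn, List.ofFn_eq_map]
  unfold multiD
  induction List.finRange n with
  | nil => exact ⟨[], by simp, by simpa using hg⟩
  | cons k l ih =>
    obtain ⟨I, hI, h⟩ := ih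
    exact ⟨List.replicate (α k) k ++ I, by simp [hI], hiter k (α k) _ I h⟩

end Slice

theorem gradient_slice {t : ℝ} (ht : t ∈ Ioo a b) {g : Rn n → ℝ} {Q : SmoothPer n a b}
    (hg : ∀ x, g x = Q (t, x)) (x : Rn n) (i : Fin n) :
    (gradient g x : Rn n) i = dx i Q (t, x) := by
  have h : HasFDerivAt g ((fderiv ℝ Q (t, x)).comp (.inr ℝ ℝ (Rn n))) x := by
    rw [funext hg]
    exact Q.hasFDerivAt_slice ht x
  have e := EuclideanSpace.basisFun_inner (𝕜 := ℝ) (ι := Fin n) (gradient g x) i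
  rw [← e, EuclideanSpace.basisFun_apply, real_inner_comm, gradient,
    InnerProductSpace.toDual_symm_apply, h.fderiv, dx, der_apply _ _ (mem_strip.2 ht)]
  rfl

/-- The momentum equation, in vector form and in components. -/
theorem momentum_iff {t : ℝ} (ht : t ∈ Ioo a b) {u : ℝ → Rn n → Rn n} {p : Rn n → ℝ}
    {U : Fin n → SmoothPer n a b} {Q : SmoothPer n a b} (hQ : ∀ x, p x = Q (t, x))
    (hU : ∀ s ∈ Ioo a b, ∀ x i, u s x i = U i (s, x)) (hdiv : ∑ i, dx i (U i) = 0) (x : Rn n) :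
    deriv (fun s => u s x) t + fderiv ℝ (u t) x (u t x) + gradient p x =
      Laplacian.laplacian (u t) x ↔
    ∀ i, dt (U i) (t, x) = (lap (U i) - ∑ k, dx k (U k * U i) - dx i Q) (t, x) := by
  have hder : ∀ i, deriv (fun s => u s x) t i = dt (U i) (t, x) := by
    have h : ∀ i, HasDerivAt (fun s => u s x i) (dt (U i) (t, x)) t := fun i =>
      ((U i).hasDerivAt_time ht x).congr_of_eventuallyEq
        (mem_of_superset (isOpen_Ioo.mem_nhds ht) fun s hs => hU s hs x i)
    have hd : DifferentiableAt ℝ (fun s => u s x) t :=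
      differentiableAt_euclidean.2 fun i => (h i).differentiableAt
    intro i
    have hp : HasDerivAt (fun s => u s x i) (deriv (fun s => u s x) t i) t :=
      (EuclideanSpace.proj i : Rn n →L[ℝ] ℝ).hasFDerivAt.comp_hasDerivAt t hd.hasDerivAt
    exact hp.unique (h i)
  have hconv : ∀ i, (∑ k, dx k (U k * U i)) (t, x) = ∑ k, U k (t, x) * dx k (U i) (t, x) := by
    intro i
    have : ∑ k, dx k (U k * U i) = (∑ k, dx k (U k)) * U i + ∑ k, U k * dx k (U i) := by
      simp only [dx, der_mul, Finset.sum_add_distrib, Finset.sum_mul]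
    rw [this, hdiv, zero_mul, zero_add, coe_sum]
    rfl
  rw [PiLp.ext_iff]
  refine forall_congr' fun i => ?_
  simp only [PiLp.add_apply, coe_sub]
  rw [hder, fderiv_slice ht (hU t ht), laplacian_slice ht (hU t ht), gradient_slice ht hQ, hconv]
  simp only [hU t ht]
  constructor <;> intro h <;> linarith

end NavierStokes

end

/-! ### The Cauchy problem -/

noncomputable section

namespace NavierStokes

open Set Filter Topology SmoothPer

variable {n : ℕ} {f : Rn n → Rn n} {T : EReal} {u : ℝ → Rn n → Rn n} {p : ℝ → Rn n → ℝ}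

theorem mem_timeInterval {t : ℝ} : t ∈ timeInterval T ↔ 0 ≤ t ∧ (t : EReal) < T := Iff.rfl

/-- For continuous periodic fields the supremum in `supNorm` is that of a bounded set. -/
theorem le_supNorm {g : Rn n → Rn n} (hg : Continuous g) (hp : IsPeriodic g) (x : Rn n) :
    ‖g x‖ ≤ supNorm g := by
  refine le_ciSup (f := fun x => ‖g x‖) ?_ x
  have hK := isCompact_closedBall (0 : Rn n) (n * (2 * Real.pi))
  obtain ⟨C, hC⟩ := hK.exists_bound_of_continuousOn hg.continuousOn
  refine ⟨C, ?_⟩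
  rintro _ ⟨x, rfl⟩
  obtain ⟨y, hy, hyx⟩ := exists_bounded_representative x
  have := hyx (fun x => ‖g x‖) fun i x => by simp only [hp i x]
  simp only at this ⊢
  rw [← this]
  exact hC y (by simpa using hy)

theorem supNorm_nonneg (g : Rn n → Rn n) : 0 ≤ supNorm g := Real.iSup_nonneg fun _ => norm_nonneg _

theorem derivNorm_le {a b t C : ℝ} {g : Rn n → Rn n} {W : Fin n → SmoothPer n a b}
    (ht : t ∈ Ioo a b) (hg : ∀ x i, g x i = W i (t, x)) {j : ℕ} (hC : 0 ≤ C)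
    (h : ∀ I : List (Fin n), I.length = j → ∀ i x, |dtx 0 I (W i) (t, x)| ≤ C) :
    derivNorm j g ≤ n * C := by
  have hnC : 0 ≤ n * C := by positivity
  refine Real.iSup_le (fun α => Real.iSup_le (fun x => ?_) hnC) hnC
  obtain ⟨I, hI, hm⟩ := exists_multiD_slice ht hg α.1
  refine norm_le_of_forall_abs_le fun i => ?_
  rw [hm]
  exact h I (hI.trans α.2) i x

namespace IsSolution

/-- On a bounded time interval the components of a solution satisfy the conservative system. -/
theorem exists_isNS (h : IsSolution f T u p) {b : ℝ} (hb : (b : EReal) ≤ T) :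
    ∃ (U : Fin n → SmoothPer n 0 b) (Q : SmoothPer n 0 b), IsNS U Q ∧
      ∀ t ∈ Ioo 0 b, ∀ x, (∀ i, u t x i = U i (t, x)) ∧ p t x = Q (t, x) := by
  have hmem : ∀ t ∈ Ioo 0 b, t ∈ timeInterval T := fun t ht =>
    ⟨ht.1.le, (EReal.coe_lt_coe_iff.2 ht.2).trans_le hb⟩
  have hsub : strip n 0 b ⊆ timeInterval T ×ˢ univ := prod_mono hmem subset_rfl
  let U : Fin n → SmoothPer n 0 b := fun i => SmoothPer.mk (fun q => u q.1 q.2 i)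
    (contDiffOn_euclidean.1 (h.smooth_velocity.mono hsub) i)
    fun t ht k x => by simp only [h.periodic_velocity t (hmem t ht) k x]
  let Q : SmoothPer n 0 b := SmoothPer.mk (fun q => p q.1 q.2) (h.smooth_pressure.mono hsub)
    fun t ht => h.periodic_pressure t (hmem t ht)
  have hU : ∀ t ∈ Ioo 0 b, ∀ x i, u t x i = U i (t, x) := fun t ht x i =>
    (mk_apply (F := fun q => u q.1 q.2 i) (mem_strip.2 ht)).symm
  have hQ : ∀ t ∈ Ioo 0 b, ∀ x, p t x = Q (t, x) := fun t ht x =>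
    (mk_apply (F := fun q => p q.1 q.2) (mem_strip.2 ht)).symm
  have hdiv : ∑ i, dx i (U i) = 0 := by
    refine SmoothPer.ext fun ⟨t, x⟩ hq => ?_
    rw [mem_strip] at hq
    rw [← divergence_slice hq (hU t hq)]
    exact h.incompressible t (hmem t hq) x
  refine ⟨U, Q, ⟨fun i => SmoothPer.ext fun ⟨t, x⟩ hq => ?_, hdiv⟩, fun t ht x =>
    ⟨hU t ht x, hQ t ht x⟩⟩
  rw [mem_strip] at hq
  exact (momentum_iff hq (hQ t hq) hU hdiv x).1
    (h.momentum t hq.1 (hmem t hq).2 x) i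

/-- A solution bounded by `M` on `[0, T)`, where `T M² ≤ 1`, extends to a longer interval. -/
theorem exists_longer {T M : ℝ} (h : IsSolution f T u p) (hM : 0 < M) (hTM : T * M ^ 2 ≤ 1)
    (hb : ∀ s ∈ Ioo 0 T, ∀ x i, |u s x i| ≤ M) :
    ∃ (T' : EReal) (u' : ℝ → Rn n → Rn n) (p' : ℝ → Rn n → ℝ), T < T' ∧ IsSolution f T' u' p' ∧
      ∀ t ∈ timeInterval T, u' t = u t := by
  have hT : 0 < T := by exact_mod_cast h.pos
  obtain ⟨U, Q, hU, hUu⟩ := h.exists_isNS le_rfl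
  obtain ⟨T', hT', V, P, hV, hVU⟩ := exists_continuation hT hU hM hTM fun s hs i x => by
    rw [← (hUu s hs x).1]
    exact hb s hs x i
  let u' : ℝ → Rn n → Rn n := fun t => if t < T then u t else
    fun x => WithLp.toLp 2 fun i => V i (t, x)
  let p' : ℝ → Rn n → ℝ := fun t => if t < T then fun x => p t x - p t 0 else fun x => P (t, x)
  have hmem : ∀ {t : ℝ} {S : ℝ}, t ∈ timeInterval (S : EReal) ↔ 0 ≤ t ∧ t < S := fun {t S} => by
    rw [mem_timeInterval, EReal.coe_lt_coe_iff]
  have hu : ∀ t < T, u' t = u t := fun t ht => if_pos ht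
  have hp : ∀ t < T, p' t = fun x => p t x - p t 0 := fun t ht => if_pos ht
  have huV : ∀ t ∈ Ioo 0 T', ∀ x i, u' t x i = V i (t, x) := by
    intro t ht x i
    by_cases htT : t < T
    · rw [hu t htT, (hUu t ⟨ht.1, htT⟩ x).1, (hVU t ⟨ht.1, htT⟩ x).1]
    · simp [u', htT]
  have hpP : ∀ t ∈ Ioo 0 T', ∀ x, p' t x = P (t, x) := by
    intro t ht x
    by_cases htT : t < T
    · rw [hp t htT, (hVU t ⟨ht.1, htT⟩ x).2, ← (hUu t ⟨ht.1, htT⟩ x).2, ← (hUu t ⟨ht.1, htT⟩ 0).2]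
    · simp [p', htT]
  -- near positive times the extended fields are components of the continuation,
  -- near time zero they are those of the given solution
  have hsmooth : ∀ {F : Type} [NormedAddCommGroup F] [NormedSpace ℝ F] (g : ℝ × Rn n → F),
      ContDiffOn ℝ ∞ g (strip n 0 T') → ContDiffOn ℝ ∞ g (timeInterval T ×ˢ univ) →
      ContDiffOn ℝ ∞ g (timeInterval T' ×ˢ univ) := by
    intro F _ _ g h1 h2 ⟨t, x⟩ hq
    have ht : 0 ≤ t ∧ t < T' := hmem.1 hq.1
    rcases ht.1.eq_or_lt with h0 | h0
    · refine (h2 (t, x) ⟨hmem.2 ⟨ht.1, h0 ▸ hT⟩, trivial⟩).mono_of_mem_nhdsWithin ?_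
      have hn : Iio T ×ˢ univ ∈ 𝓝 (t, x) :=
        (isOpen_Iio.prod isOpen_univ).mem_nhds ⟨h0 ▸ hT, trivial⟩
      filter_upwards [self_mem_nhdsWithin, mem_nhdsWithin_of_mem_nhds hn] with r hr hr'
      exact ⟨hmem.2 ⟨(hmem.1 hr.1).1, hr'.1⟩, trivial⟩
    · exact (h1.contDiffAt (isOpen_strip.mem_nhds (mem_strip.2 ⟨h0, ht.2⟩))).contDiffWithinAt
  have hIoo : ∀ q ∈ strip n 0 T', q.1 ∈ Ioo 0 T' := fun q hq => by simpa [strip] using hq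
  refine ⟨T', u', p', EReal.coe_lt_coe_iff.2 hT', ?_, fun t ht => hu t (hmem.1 ht).2⟩
  refine ⟨by exact_mod_cast hT.trans hT', hsmooth _ ?_ ?_, hsmooth _ ?_ ?_, fun t ht => ?_,
    fun t ht => ?_, fun t ht0 htT' x => ?_, fun t ht x => ?_, ?_⟩
  · exact contDiffOn_euclidean.2 fun i => (V i).contDiffOn.congr fun q hq => huV _ (hIoo q hq) _ _
  · exact h.smooth_velocity.congr fun q hq => by rw [hu _ (hmem.1 hq.1).2]
  · exact P.contDiffOn.congr fun q hq => hpP _ (hIoo q hq) _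
  · refine (h.smooth_pressure.sub (h.smooth_pressure.comp
      (f := fun q : ℝ × Rn n => (q.1, (0 : Rn n))) (by fun_prop) ?_)).congr fun q hq => by
        rw [hp _ (hmem.1 hq.1).2]; rfl
    exact fun q hq => ⟨hq.1, trivial⟩
  · have ht := hmem.1 ht
    by_cases htT : t < T
    · rw [hu t htT]
      exact h.periodic_velocity t (hmem.2 ⟨ht.1, htT⟩)
    · have ht' : t ∈ Ioo 0 T' := ⟨hT.trans_le (not_lt.1 htT), ht.2⟩
      intro k x
      ext i
      rw [huV t ht', huV t ht']
      exact (V i).periodic ht' k x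
  · have ht := hmem.1 ht
    by_cases htT : t < T
    · rw [hp t htT]
      intro k x
      simp only [h.periodic_pressure t (hmem.2 ⟨ht.1, htT⟩) k x]
    · have ht' : t ∈ Ioo 0 T' := ⟨hT.trans_le (not_lt.1 htT), ht.2⟩
      intro k x
      rw [hpP t ht', hpP t ht']
      exact P.periodic ht' k x
  · have ht : t ∈ Ioo 0 T' := ⟨ht0, EReal.coe_lt_coe_iff.1 htT'⟩
    refine (momentum_iff ht (hpP t ht) huV hV.incompressible x).2 fun i => ?_
    rw [hV.momentum i]
  · have ht := hmem.1 ht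
    by_cases htT : t < T
    · rw [hu t htT]
      exact h.incompressible t (hmem.2 ⟨ht.1, htT⟩) x
    · have ht' : t ∈ Ioo 0 T' := ⟨hT.trans_le (not_lt.1 htT), ht.2⟩
      rw [divergence_slice ht' (huV t ht'), hV.incompressible]
      rfl
  · rw [hu 0 hT, h.initial]

/-- A solution stays close to its initial value for a short time, uniformly in space. -/
theorem exists_initial_bound (h : IsSolution f T u p) {F : ℝ} (hF : ∀ x, ‖f x‖ < F) :
    ∃ δ : ℝ, 0 < δ ∧ (δ : EReal) < T ∧ ∀ s ∈ Icc 0 δ, ∀ x, ‖u s x‖ < F := by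
  obtain ⟨T₀, hT₀, hT₀T⟩ := EReal.lt_iff_exists_real_btwn.1 h.pos
  have hT₀ : 0 < T₀ := by exact_mod_cast hT₀
  have hK := isCompact_closedBall (0 : Rn n) (n * (2 * Real.pi))
  -- extending the solution to negative times by its initial value turns continuity from the right
  -- into continuity
  have hev : ∀ x ∈ Metric.closedBall (0 : Rn n) (n * (2 * Real.pi)),
      ∀ᶠ q : ℝ × Rn n in 𝓝 ((0 : ℝ), x), ‖u (max q.1 0) q.2‖ < F := by
    intro x _
    have h0 : ContinuousWithinAt (fun q : ℝ × Rn n => u q.1 q.2) (timeInterval T ×ˢ univ) (0, x) :=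
      h.smooth_velocity.continuousOn (0, x) ⟨⟨le_rfl, h.pos⟩, trivial⟩
    have hm : Tendsto (fun q : ℝ × Rn n => (max q.1 0, q.2)) (𝓝 (0, x))
        (𝓝[timeInterval T ×ˢ univ] (0, x)) := by
      refine tendsto_nhdsWithin_iff.2 ⟨?_, ?_⟩
      · have : Continuous fun q : ℝ × Rn n => (max q.1 0, q.2) := by fun_prop
        simpa using this.tendsto (0, x)
      · have : Iio T₀ ×ˢ univ ∈ 𝓝 ((0 : ℝ), x) :=
          (isOpen_Iio.prod isOpen_univ).mem_nhds ⟨hT₀, trivial⟩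
        filter_upwards [this] with q hq
        exact ⟨⟨le_max_right _ _, (EReal.coe_lt_coe_iff.2 (max_lt hq.1 hT₀)).trans hT₀T⟩, trivial⟩
    have h1 := (h0.tendsto.comp hm).norm
    refine h1.eventually_lt_const ?_
    simp only [h.initial]
    exact hF x
  have hE := hK.eventually_forall_of_forall_eventually (x₀ := (0 : ℝ))
    (P := fun s x => ‖u (max s 0) x‖ < F) hev
  obtain ⟨ε, hε, hεF⟩ := Metric.eventually_nhds_iff.1 hE
  refine ⟨min (ε / 2) T₀, by positivity, ?_, fun s hs x => ?_⟩
  · exact (EReal.coe_le_coe_iff.2 (min_le_right _ _)).trans_lt hT₀T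
  · have hsT : s ∈ timeInterval T := ⟨hs.1,
      (EReal.coe_le_coe_iff.2 (hs.2.trans (min_le_right _ _))).trans_lt hT₀T⟩
    obtain ⟨y, hy, hyx⟩ := exists_bounded_representative x
    have e : ‖u s y‖ = ‖u s x‖ := hyx (fun x => ‖u s x‖) fun i x => by
      simp only [h.periodic_velocity s hsT i x]
    have := hεF (y := s) (by
      rw [Real.dist_eq, sub_zero, abs_of_nonneg hs.1]
      have := hs.2.trans (min_le_left _ _)
      linarith) y (by simpa using hy)
    rwa [max_eq_left hs.1, e] at this

end IsSolution

/-- The solution is bounded by twice its initial size, with the parabolic estimates for its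
derivatives, up to a time depending only on the size of the initial velocity. -/
theorem exists_apriori (n : ℕ) : ∃ c : ℝ, 0 < c ∧ c ≤ 1 / 4 ∧ ∃ K : ℕ → ℝ,
    ∀ {f : Rn n → Rn n} {T : EReal} {u : ℝ → Rn n → Rn n} {p : ℝ → Rn n → ℝ},
      IsSolution f T u p → Continuous f → IsPeriodic f → ∀ {F b : ℝ}, supNorm f < F →
      (b : EReal) ≤ T → b * F ^ 2 ≤ c → ∀ t ∈ Ioo 0 b,
        (∀ x i, |u t x i| ≤ 2 * F) ∧ ∀ j, √t ^ j * derivNorm j (u t) ≤ K j * F := by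
  obtain ⟨c, hc, hboot⟩ := exists_bootstrap_const n
  obtain ⟨B, -, A, hA, hest⟩ := exists_deriv_estimate n
  refine ⟨min c (1 / 4), by positivity, min_le_right _ _, fun j => n * (2 * A j), ?_⟩
  intro f T u p h hf hper F b hF hb hbF t ht
  have hF0 : 0 < F := (supNorm_nonneg f).trans_lt hF
  obtain ⟨U, Q, hU, hUu⟩ := h.exists_isNS hb
  obtain ⟨δ, hδ, -, hδF⟩ := h.exists_initial_bound fun x => (le_supNorm hf hper x).trans_lt hF
  have hUb : ∀ s ∈ Ioo 0 b, ∀ i x, |U i (s, x)| ≤ 2 * F := by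
    refine hboot hU hF0 (hbF.trans (min_le_left _ _)) hδ fun s hs i x => ?_
    by_cases hsb : s < b
    · rw [← (hUu s ⟨hs.1, hsb⟩ x).1]
      exact (PiLp.norm_apply_le (u s x) i).trans (hδF s ⟨hs.1.le, hs.2⟩ x).le
    · rw [(U i).eq_zero (by simp [hsb]), abs_zero]
      exact hF0.le
  refine ⟨fun x i => by rw [(hUu t ht x).1]; exact hUb t ht i x, fun j => ?_⟩
  have hd := hest hU (M := 2 * F) (by positivity) (by
    have := hbF.trans (min_le_right _ _)
    linarith) hUb t ht 0
  have hs : 0 < √t ^ j := pow_pos (Real.sqrt_pos.2 ht.1) j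
  have hAj := hA j
  have h1 : derivNorm j (u t) ≤ n * (A j * (2 * F) / √t ^ j) := by
    refine derivNorm_le ht (fun x i => (hUu t ht x).1 i) (by positivity) fun I hI i x => ?_
    rw [le_div_iff₀ hs, mul_comm]
    have := hd I i x
    simpa [hI] using this
  calc √t ^ j * derivNorm j (u t) ≤ √t ^ j * (n * (A j * (2 * F) / √t ^ j)) := by gcongr
    _ = n * (2 * A j) * F := by field_simp

end NavierStokes

end

theorem theorem1p1 (n : ℕ) (hn : 3 ≤ n) :
    ∃ c₀ : ℝ, 0 < c₀ ∧ ∃ K : ℕ → ℝ,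
      ∀ (f : NavierStokes.Rn n → NavierStokes.Rn n),
        ContDiff ℝ ∞ f → NavierStokes.IsPeriodic f →
        (∀ x, NavierStokes.divergence f x = 0) →
        ∀ (T : EReal) (u : ℝ → NavierStokes.Rn n → NavierStokes.Rn n)
          (p : ℝ → NavierStokes.Rn n → ℝ),
          NavierStokes.IsMaximalSolution f T u p →
          ∀ t : ℝ, 0 < t → t * NavierStokes.supNorm f ^ 2 ≤ c₀ →
            (t : EReal) < T ∧
            ∀ j : ℕ, t ^ ((j : ℝ) / 2) * NavierStokes.derivNorm j (u t)
              ≤ K j * NavierStokes.supNorm f := by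
  obtain ⟨c, hc, hc4, K, hK⟩ := NavierStokes.exists_apriori n
  -- the factor `1 / 2` leaves room for bounds of `f` slightly larger than its maximum norm
  refine ⟨c / 2, by positivity, K, fun f hf hper _ T u p hmax t ht htS => ?_⟩
  have hsol := hmax.isSolution
  have hS := NavierStokes.supNorm_nonneg f
  have hlt : ∀ τ : ℝ, 0 < τ → τ * NavierStokes.supNorm f ^ 2 ≤ c / 2 →
      NavierStokes.supNorm f < √(c / τ) := by
    intro τ hτ h
    rw [Real.lt_sqrt hS, lt_div_iff₀ hτ]
    linarith
  have htT : (t : EReal) < T := by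
    -- otherwise `T` is finite and the solution is bounded up to time `T`, so it extends further
    by_contra! hTt
    lift T to ℝ using ⟨(hTt.trans_lt (EReal.coe_lt_top t)).ne,
      (EReal.bot_lt_zero.trans hsol.pos).ne'⟩
    have hT : 0 < T := by exact_mod_cast hsol.pos
    have hTt : T ≤ t := by exact_mod_cast hTt
    have hTF : T * √(c / T) ^ 2 = c := by
      rw [Real.sq_sqrt (by positivity)]
      field_simp
    have hb := hK hsol hf.continuous hper (hlt T hT (le_trans (by gcongr) htS)) le_rfl hTF.le
    have hF : 0 < √(c / T) := Real.sqrt_pos.2 (by positivity)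
    obtain ⟨T', u', p', hT', hsol', hext⟩ := hsol.exists_longer (M := 2 * √(c / T)) (by positivity)
      (by rw [mul_pow]; linarith) fun s hs => (hb s hs).1
    exact hmax.maximal T' u' p' hT' hsol' hext
  refine ⟨htT, fun j => ?_⟩
  have hpow : t ^ ((j : ℝ) / 2) = √t ^ j := by
    rw [Real.sqrt_eq_rpow, ← Real.rpow_natCast, ← Real.rpow_mul ht.le]
    congr 1
    ring
  rw [hpow]
  -- the estimate holds with every `F > supNorm f` close to `supNorm f` in place of `supNorm f`,
  -- hence in the limit; this covers `f = 0`
  have hlim : Filter.Tendsto (fun F => K j * F)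
      (nhdsWithin (NavierStokes.supNorm f) (Set.Ioi (NavierStokes.supNorm f)))
      (nhds (K j * NavierStokes.supNorm f)) :=
    ((continuous_const.mul continuous_id).tendsto _).mono_left nhdsWithin_le_nhds
  refine ge_of_tendsto hlim ?_
  filter_upwards [Ioo_mem_nhdsGT (hlt t ht htS)] with F hF
  have hF0 : 0 < F := hS.trans_lt hF.1
  have htF : t < c / F ^ 2 := by
    have := (Real.lt_sqrt hF0.le).1 hF.2
    rw [lt_div_iff₀ ht] at this
    rw [lt_div_iff₀ (by positivity)]
    linarith
  obtain ⟨r, htr, hrT⟩ := EReal.lt_iff_exists_real_btwn.1 htT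
  have htr : t < r := by exact_mod_cast htr
  refine (hK hsol hf.continuous hper hF.1 (b := min r (c / F ^ 2))
    ((EReal.coe_le_coe_iff.2 (min_le_left _ _)).trans hrT.le) ?_ t ⟨ht, lt_min htr htF⟩).2 j
  calc min r (c / F ^ 2) * F ^ 2 ≤ c / F ^ 2 * F ^ 2 := by gcongr; exact min_le_right _ _
    _ = c := by field_simp
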